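/- Let $\mathfrak{k}$ be a separable complex Hilbert space and let $\mathfrak{R}=\{\emptyset\}+\mathbb{R}+\mathbb{R}^2+\cdots$ (disjoint union) carry the measure $\int f(w)\,dw=f(\emptyset)+\sum_{n\ge1}\frac1{n!}\int_{\mathbb{R}^n}f(t_1,\dots,t_n)\,dt_1\cdots dt_n$. Let $\Gamma=L^2_s(\mathfrak{R},\mathfrak{k})$ be the Fock space of symmetric square integrable functions. For $w\in\mathbb{R}^n$ put $\#w=n$. For $k=0,1,2,\dots$ let $\Gamma_k$ be the space of those $f\in\Gamma$ with $$\|f\|_{\Gamma_k}^2=\int(\#w+1)^k\|f(w)\|^2\,dw<\infty ,$$ and let $\mathcal{K}$ be the space of symmetric continuous functions $\mathfrak{R}\to\mathfrak{k}$ with compact support. Let $A_1,A_0,A_{-1},B$ be bounded operators on $\mathfrak{k}$ satisfying the unitarity conditions: there is a unitary $\Upsilon$ with $A_0=\Upsilon-1$, $A_1=-\Upsilon A_{-1}^+$ and $B+B^+=-A_1^+A_1=-A_{-1}A_{-1}^+$. For $s\le t$ and finite families of real numbers $t_\sigma,t_\tau,t_\upsilon$ whose members are all different, $s_1<\dots<s_p$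 in increasing order, put $$u^t_s(\sigma,\tau,\upsilon)=\mathbf 1\{s<s_1,\ s_p<t\}\;e^{(t-s_p)B}A_{i_p}e^{(s_p-s_{p-1})B}A_{i_{p-1}}\cdots A_{i_1}e^{(s_1-s)B},$$ where $i_j=1,0,-1$ according to whether $s_j$ belongs to $t_\sigma$, $t_\tau$ or $t_\upsilon$ (so that $u^t_s(\emptyset,\emptyset,\emptyset)=e^{(t-s)B}$), and for $f\in\mathcal{K}$ put $$(\mathcal{O}(u^t_s)f)(\omega)=\sum_{\alpha\subset\omega}\ \sum_{\beta\subset\omega\setminus\alpha}\int u^t_s(\alpha,\beta,\upsilon)\,f(\omega\setminus\alpha+\upsilon)\,d\upsilon .$$ Then there is exactly one family of unitary operators $U^t_s$ $(s,t\in\mathbb{R})$ on $\Gamma$ such that $U^t_s$ extends $\mathcal{O}(u^t_s):\mathcal{K}\to\Gamma$ for $s\le t$ and $U^t_s=(U^s_t)^+$ for $t<s$. For every $k$ there is a real polynomial $P$ of degree $\le k$ such that for all $s,t\in\mathbb{R}$ and all $g\in\Gamma_k$ one has $U^t_sg\in\Gamma_k$ and $$\|U^t_sg\|_{\Gamma_k}^2\le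 P(|t-s|)\,\|g\|_{\Gamma_k}^2 .$$ Moreover, let $(\Theta(t)f)(t_1,\dots,t_n)=f(t_1+t,\dots,t_n+t)$ and $W(t)=\Theta(t)U^t_0$. Then, for the same $P$ and all $t\in\mathbb{R}$, $g\in\Gamma_k$, one has $W(t)g\in\Gamma_k$ and $\|W(t)g\|_{\Gamma_k}^2\le P(|t|)\,\|g\|_{\Gamma_k}^2$. -/

import Mathlib

open MeasureTheory
open scoped ENNReal

noncomputable section

namespace WhiteNoise

/-- The space `{∅} + ℝ + ℝ² + ⋯` of finite words of real numbers, a disjoint union (with the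
disjoint union topology and σ-algebra). -/
abbrev Word : Type := Σ n : ℕ, (Fin n → ℝ)

/-- The Lebesgue measure on words: `∫ f = f(∅) + ∑ₙ (1/n!) ∫_{ℝⁿ} f(t₁,…,tₙ) dt₁⋯dtₙ`. -/
def wordMeasure : Measure Word :=
  Measure.sum fun n : ℕ =>
    ((n.factorial : ℝ≥0∞)⁻¹) • (volume : Measure (Fin n → ℝ)).map fun x => (⟨n, x⟩ : Word)

/-- The action of a family of permutations (one for each word length) on words. -/
def permWord (p : ∀ n : ℕ, Equiv.Perm (Fin n)) (w : Word) : Word := ⟨w.1, w.2 ∘ p w.1⟩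

/-- The shift `(t₁,…,tₙ) ↦ (t₁+r,…,tₙ+r)`. -/
def shiftWord (r : ℝ) (w : Word) : Word := ⟨w.1, fun i => w.2 i + r⟩

/-- Concatenation of words. -/
def concat (v w : Word) : Word := ⟨v.1 + w.1, Fin.append v.2 w.2⟩

/-- The subword of `w` with the letters whose positions lie in `a`. -/
def subword (w : Word) (a : Finset (Fin w.1)) : Word := ⟨a.card, w.2 ∘ a.orderEmbOfFin rfl⟩

theorem measurableSet_word {s : Set Word} :
    MeasurableSet s ↔ ∀ n : ℕ, MeasurableSet ((fun x : Fin n → ℝ => (⟨n, x⟩ : Word)) ⁻¹' s) :=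
  MeasurableSpace.measurableSet_iInf

/-- A map of words that preserves the length and, on each `ℝⁿ`, Lebesgue measure, preserves
the measure on words. -/
theorem measurePreserving_of_fiber (φ : ∀ n : ℕ, (Fin n → ℝ) → (Fin n → ℝ))
    (hφ : ∀ n, MeasurePreserving (φ n) volume volume) :
    MeasurePreserving (fun w : Word => (⟨w.1, φ w.1 w.2⟩ : Word)) wordMeasure wordMeasure := by
  have hmk : ∀ n : ℕ, Measurable (fun x : Fin n → ℝ => (⟨n, x⟩ : Word)) := fun n s hs =>
    measurableSet_word.1 hs n
  have hm : Measurable (fun w : Word => (⟨w.1, φ w.1 w.2⟩ : Word)) := 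
    fun s hs => measurableSet_word.2 fun n => (hφ n).measurable (hmk n hs)
  refine ⟨hm, ?_⟩
  unfold wordMeasure
  rw [Measure.map_sum hm.aemeasurable]
  congr 1
  funext n
  rw [Measure.map_smul, Measure.map_map hm (hmk n)]
  have h : (fun w : Word => (⟨w.1, φ w.1 w.2⟩ : Word)) ∘ (fun x : Fin n → ℝ => (⟨n, x⟩ : Word))
      = (fun x : Fin n → ℝ => (⟨n, x⟩ : Word)) ∘ φ n := rfl
  rw [h, ← Measure.map_map (hmk n) (hφ n).measurable, (hφ n).map_eq]

theorem measurePreserving_permWord (p : ∀ n : ℕ, Equiv.Perm (Fin n)) :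
    MeasurePreserving (permWord p) wordMeasure wordMeasure :=
  measurePreserving_of_fiber (fun n x => x ∘ p n) fun n =>
    volume_preserving_arrowCongr' (p n).symm (MeasurableEquiv.refl ℝ)
      (MeasurePreserving.id volume)

theorem measurePreserving_shiftWord (r : ℝ) :
    MeasurePreserving (shiftWord r) wordMeasure wordMeasure :=
  measurePreserving_of_fiber (fun _ x i => x i + r) fun _ =>
    measurePreserving_add_right volume (fun _ => r)

section Fock

variable (𝔨 : Type*) [NormedAddCommGroup 𝔨] [InnerProductSpace ℂ 𝔨]

/-- The Fock space: the (classes of) square integrable functions from words to `𝔨` that are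
symmetric, i.e. invariant under permutations of the letters. -/
def Fock : Submodule ℂ (Lp 𝔨 2 wordMeasure) where
  carrier := {f | ∀ p, (f : Word → 𝔨) ∘ permWord p =ᵐ[wordMeasure] f}
  zero_mem' p := by
    have h := Lp.coeFn_zero 𝔨 2 wordMeasure
    have h' := (measurePreserving_permWord p).quasiMeasurePreserving.ae_eq_comp h
    exact h'.trans h.symm
  add_mem' {f g} hf hg p := by
    have h := Lp.coeFn_add f g
    have h' := (measurePreserving_permWord p).quasiMeasurePreserving.ae_eq_comp h
    refine h'.trans (Filter.EventuallyEq.trans ?_ h.symm)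
    exact (hf p).add (hg p)
  smul_mem' c f hf p := by
    have h := Lp.coeFn_smul c f
    have h' := (measurePreserving_permWord p).quasiMeasurePreserving.ae_eq_comp h
    refine h'.trans (Filter.EventuallyEq.trans ?_ h.symm)
    exact (hf p).const_smul c

/-- The symmetric continuous functions with compact support from words to `𝔨`. -/
def testFunctions : Set (Word → 𝔨) :=
  {f | Continuous f ∧ HasCompactSupport f ∧ ∀ p w, f (permWord p w) = f w}

variable {𝔨}

/-- A (chosen) representative of an element of the Fock space. -/
def rep (f : Fock 𝔨) : Word → 𝔨 := ((f : Lp 𝔨 2 wordMeasure) : Word → 𝔨)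

variable (𝔨)

/-- The space `Γ_k`: the elements `f` of the Fock space with
`⟨f|(N+1)^k|f⟩ = ∫ (#w+1)^k ‖f(w)‖² dw < ∞`. -/
def Gamma (k : ℕ) : Set (Fock 𝔨) :=
  {f | Integrable (fun w : Word => ((w.1 : ℝ) + 1) ^ k * ‖rep f w‖ ^ 2) wordMeasure}

variable {𝔨}

/-- The norm of `Γ_k`. -/
def gammaNorm (k : ℕ) (f : Fock 𝔨) : ℝ :=
  Real.sqrt (∫ w : Word, ((w.1 : ℝ) + 1) ^ k * ‖rep f w‖ ^ 2 ∂wordMeasure)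

variable (𝔨)

/-- The time shift on the Fock space, `(Θ(r) f)(t₁,…,tₙ) = f(t₁+r,…,tₙ+r)`. -/
def timeShift (r : ℝ) : Fock 𝔨 →ₗᵢ[ℂ] Fock 𝔨 where
  toLinearMap :=
    ((Lp.compMeasurePreservingₗᵢ ℂ (E := 𝔨) (p := 2) (shiftWord r)
      (measurePreserving_shiftWord r)).toLinearMap).restrict (by
        intro f hf p
        have hs := measurePreserving_shiftWord r
        have h := Lp.coeFn_compMeasurePreserving f hs
        have h1 := (measurePreserving_permWord p).quasiMeasurePreserving.ae_eq_comp h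
        have h2 := hs.quasiMeasurePreserving.ae_eq_comp (hf p)
        exact h1.trans (Filter.EventuallyEq.trans h2 h.symm))
  norm_map' f := (Lp.compMeasurePreservingₗᵢ ℂ (E := 𝔨) (p := 2) (shiftWord r)
      (measurePreserving_shiftWord r)).norm_map f

end Fock

section Kernel

variable {𝔨 : Type*} [NormedAddCommGroup 𝔨] [InnerProductSpace ℂ 𝔨]

/-- For `[(s₁,C₁),…,(sₙ,Cₙ)]` the product
`e^{(t-sₙ)B} Cₙ e^{(sₙ-sₙ₋₁)B} Cₙ₋₁ ⋯ C₁ e^{(s₁-s)B}`. -/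
def chainProduct (B : 𝔨 →L[ℂ] 𝔨) (t : ℝ) : ℝ → List (ℝ × (𝔨 →L[ℂ] 𝔨)) → (𝔨 →L[ℂ] 𝔨)
  | s, [] => NormedSpace.exp (((t - s : ℝ) : ℂ) • B)
  | s, (r, C) :: l => chainProduct B t r l * C * NormedSpace.exp (((r - s : ℝ) : ℂ) • B)

/-- The letters of the three words `σ`, `τ`, `υ`, marked with `A₁`, `A₀`, `A₋₁` respectively. -/
def markedPoints (A₁ A₀ Am : 𝔨 →L[ℂ] 𝔨) (σ τ υ : Word) : List (ℝ × (𝔨 →L[ℂ] 𝔨)) :=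
  List.ofFn (fun i => (σ.2 i, A₁)) ++ List.ofFn (fun i => (τ.2 i, A₀)) ++
    List.ofFn (fun i => (υ.2 i, Am))

open Classical in
/-- The kernel `u^t_s(A₁,A₀,A₋₁;B)(σ,τ,υ)`: the marked points are put in increasing order and
multiplied, provided that they all lie in `]s,t[`. It is set to zero on the null set where two of
the points coincide. -/
def kernel (A₁ A₀ Am B : 𝔨 →L[ℂ] 𝔨) (t s : ℝ) (σ τ υ : Word) : 𝔨 →L[ℂ] 𝔨 :=
  if ((markedPoints A₁ A₀ Am σ τ υ).map Prod.fst).Nodup ∧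
      ∀ x ∈ markedPoints A₁ A₀ Am σ τ υ, s < x.1 ∧ x.1 < t then
    chainProduct B t s
      ((markedPoints A₁ A₀ Am σ τ υ).insertionSort fun x y => x.1 ≤ y.1)
  else 0

/-- The operator `𝒪(F)` with kernel `F`, for functions `g` on words:
`(𝒪(F)g)(ω) = ∑_{α ⊆ ω} ∑_{β ⊆ ω∖α} ∫ F(α,β,υ) g((ω∖α)+υ) dυ`. -/
def kernelOp (F : Word → Word → Word → (𝔨 →L[ℂ] 𝔨)) (g : Word → 𝔨) (ω : Word) : 𝔨 :=
  ∑ α : Finset (Fin ω.1), ∑ β ∈ αᶜ.powerset,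
    ∫ υ : Word, F (subword ω α) (subword ω β) υ (g (concat (subword ω αᶜ) υ)) ∂wordMeasure

/-- The family `U t s = U^t_s` of unitary operators on the Fock space belongs to the kernels
`u^t_s(A₁,A₀,A₋₁;B)`: for `s ≤ t` the operator `U^t_s` extends `𝒪(u^t_s)` from the test functions
to the Fock space, and for `t < s` it is the adjoint (the inverse) of `U^s_t`. -/
def IsUnitarySolution (A₁ A₀ Am B : 𝔨 →L[ℂ] 𝔨) (U : ℝ → ℝ → (Fock 𝔨 ≃ₗᵢ[ℂ] Fock 𝔨)) : Prop :=
  (∀ s t : ℝ, s ≤ t → ∀ f ∈ testFunctions 𝔨, ∀ g : Fock 𝔨, rep g =ᵐ[wordMeasure] f →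
      rep (U t s g) =ᵐ[wordMeasure] kernelOp (kernel A₁ A₀ Am B t s) f) ∧
    ∀ s t : ℝ, t < s → U t s = (U s t).symm

/-- The conditions on the coefficients for the unitarity of the evolution. -/
def UnitarityConditions [CompleteSpace 𝔨] (A₁ A₀ Am B : 𝔨 →L[ℂ] 𝔨) : Prop :=
  ∃ Υ ∈ unitary (𝔨 →L[ℂ] 𝔨),
    A₀ = Υ - 1 ∧ A₁ = -(Υ * star Am) ∧
      B + star B = -(star A₁ * A₁) ∧ B + star B = -(Am * star Am)

/-- The operators `W(t) = Θ(t) U^t_0`. -/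
def groupW (U : ℝ → ℝ → (Fock 𝔨 ≃ₗᵢ[ℂ] Fock 𝔨)) (t : ℝ) : Fock 𝔨 →ₗᵢ[ℂ] Fock 𝔨 :=
  (timeShift 𝔨 t).comp (U t 0).toLinearIsometry

end Kernel

end WhiteNoise

end

open MeasureTheory
open scoped ENNReal

noncomputable section

/-! A symmetric function on words depends only on the multiset of letters, so `𝒪(u^t_s)` is studied
as an operator `Coeff.evolve` on functions of multisets. Its domain is not the test functions, which
the evolution need not preserve, but the larger invariant space `tame`: measurable functions with
`‖f(M)‖ ≤ C q^{#M}` that vanish unless all letters lie in some `[-R, R]`. The majorants `env` are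
integrable because their integrals over `ℝⁿ` form an exponential series, and every interchange of
integrals rests on them.

Peeling off the last point of the time ordered product gives an integral equation for `y_t =
𝒪(u^t_s) f` (`Coeff.evolve_integral_eq`). With `v_r = 𝒪(u^r_s)(f(r + ·))` it reads `y_t(X) = f(X) +
∑_{r ∈ X, s<r<t} (A₁ y_r(X−r) + A₀ v_r(X−r)) + ∫_s^t (A₋₁ v_r(X) + B y_r(X)) dr`. For fixed `X` this
is a path in `𝔨` with drift and finitely many jumps, so its squared norm can be computed. By
adaptedness (`Coeff.evolve_cons_of_le`) the value just before a jump at `r ∈ X` is `v_r(X−r)`. The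
unitarity conditions then turn both contributions into one function `flux`: a jump at `r` adds
`flux_r(X−r)`, the drift subtracts `flux_r(X)`.

Weight this by `W(#X)` and integrate over `X`. The Mecke formula `integral_sum_erase` converts the
sum over letters into an integral over `r`, and the balance becomes `∫ (W(n+1) − W(n)) flux_r dr`
(`Coeff.wnorm_evolve`). Constant `W` gives isometry. For `W(n) = (n+1)^{k+1}` the difference is at
most a constant times `(n+1)^k`, the flux is at most `2‖A₁‖²‖y_r‖² + ‖v_r‖²`, and induction on `k`
yields a polynomial bound (`Coeff.wnorm_evolve_le`). Each step uses that the integral over `r` of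
the `k`-th squared norm of `f(r + ·)` is at most the `(k+1)`-st squared norm of `f`.

For surjectivity, taking adjoints of the kernel reverses the order of the factors, which a
reflection of time repairs. Hence the adjoint of the evolution is, up to reflection, the evolution
with coefficients `(A₋₁⁺, A₀⁺, A₁⁺, B⁺)` (`Coeff.integral_inner_evolve_dual`). The unitarity
conditions are invariant under this exchange, so the adjoint is isometric too and obeys the same
kind of bound. Test functions are dense in the Fock space, and two mutually adjoint isometries on a
dense subspace extend to a unitary operator and its inverse. Density also gives uniqueness. The
bounds pass from tame functions to `Γ_k` by truncating the number of letters, which makes the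
weighted norm continuous (`gammaNorm_map_le`). The time shift preserves all these norms. -/

namespace WhiteNoise

/-! ### Words and multisets of letters -/

/-- The word of length `n` with letters `x`. -/
def mkWord (n : ℕ) (x : Fin n → ℝ) : Word := ⟨n, x⟩

/-- The multiset of letters of a word. -/
def letters (w : Word) : Multiset ℝ := Finset.univ.val.map w.2

theorem letters_mkWord (n : ℕ) (x : Fin n → ℝ) :
    letters (mkWord n x) = Finset.univ.val.map x := rfl

theorem letters_eq_ofFn (w : Word) : letters w = (List.ofFn w.2 : Multiset ℝ) :=
  Fin.univ_val_map w.2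

theorem card_letters (w : Word) : (letters w).card = w.1 := by
  simp [letters]

theorem map_univ_comp_orderEmbOfFin {n : ℕ} (a : Finset (Fin n)) {m : ℕ} (h : a.card = m)
    (x : Fin n → ℝ) :
    (Finset.univ.val.map (x ∘ a.orderEmbOfFin h)) = a.val.map x := by
  conv_rhs => rw [← Finset.map_orderEmbOfFin_univ a h]
  rw [Finset.map_val, Multiset.map_map]
  rfl

theorem letters_subword (w : Word) (a : Finset (Fin w.1)) :
    letters (subword w a) = a.val.map w.2 :=
  map_univ_comp_orderEmbOfFin a rfl w.2

theorem letters_concat (v w : Word) : letters (concat v w) = letters v + letters w := by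
  simp only [letters_eq_ofFn]
  change ((List.ofFn (Fin.append v.2 w.2) : List ℝ) : Multiset ℝ) = _
  rw [List.ofFn_fin_append, Multiset.coe_add]

theorem letters_permWord (p : ∀ n : ℕ, Equiv.Perm (Fin n)) (w : Word) :
    letters (permWord p w) = letters w := by
  simp only [letters, permWord]
  rw [← Multiset.map_map]
  congr 1
  exact congrArg Finset.val (Finset.map_univ_equiv (p w.1))

/-- Sorting both tuples produces the same increasing list, so one tuple is obtained from the other
by one sorting permutation and the inverse of the other one. -/
theorem exists_comp_perm_of_map_univ_eq {n : ℕ} {x y : Fin n → ℝ}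
    (h : Finset.univ.val.map x = Finset.univ.val.map y) : ∃ p : Equiv.Perm (Fin n), y = x ∘ p := by
  have key : x ∘ Tuple.sort x = y ∘ Tuple.sort y := by
    apply List.ofFn_injective
    refine List.Perm.eq_of_pairwise (le := (· ≤ ·)) (fun a b _ _ h1 h2 => le_antisymm h1 h2)
      ?_ ?_ ?_
    · exact (Tuple.monotone_sort x).sortedLE_ofFn.pairwise
    · exact (Tuple.monotone_sort y).sortedLE_ofFn.pairwise
    · refine ((Tuple.sort x).ofFn_comp_perm x).trans (List.Perm.trans ?_
        ((Tuple.sort y).ofFn_comp_perm y).symm)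
      rw [← Multiset.coe_eq_coe, ← Fin.univ_val_map, ← Fin.univ_val_map, h]
  refine ⟨(Tuple.sort y).symm.trans (Tuple.sort x), ?_⟩
  funext i
  have := congrFun key ((Tuple.sort y).symm i)
  simpa using this.symm

/-- This is what allows a symmetric function on words to be read as a function of multisets. -/
theorem exists_permWord_of_letters_eq {v w : Word} (h : letters v = letters w) :
    ∃ p : ∀ n : ℕ, Equiv.Perm (Fin n), w = permWord p v := by
  obtain ⟨n, x⟩ := v
  obtain ⟨m, y⟩ := w
  have hn : n = m := by simpa [card_letters] using congrArg Multiset.card h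
  subst hn
  obtain ⟨p, hp⟩ := exists_comp_perm_of_map_univ_eq h
  classical
  refine ⟨fun k => if hk : k = n then hk ▸ p else 1, ?_⟩
  simp only [permWord, dite_true]
  exact congrArg _ hp

theorem mem_letters {w : Word} {r : ℝ} : r ∈ letters w ↔ ∃ i, w.2 i = r := by
  simp [letters]

/-! ### Measurability on words -/

theorem measurable_mkWord (n : ℕ) : Measurable (mkWord n) := fun _ hs => measurableSet_word.1 hs n

theorem measurable_of_comp_mkWord {β : Type*} [MeasurableSpace β] {g : Word → β}
    (h : ∀ n, Measurable fun x => g (mkWord n x)) : Measurable g :=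
  fun _ hs => measurableSet_word.2 fun n => h n hs

theorem measurable_length : Measurable (fun w : Word => w.1) :=
  measurable_of_comp_mkWord fun _ => measurable_const

/-- The letters of a word of length `n`, and `0` if the word has a different length. -/
def fiberCoord (n : ℕ) (w : Word) : Fin n → ℝ := if h : w.1 = n then h ▸ w.2 else 0

theorem mkWord_fiberCoord {n : ℕ} {w : Word} (h : w.1 = n) : mkWord n (fiberCoord n w) = w := by
  subst h
  simp [fiberCoord, mkWord]

theorem measurable_fiberCoord (n : ℕ) : Measurable (fiberCoord n) := by
  refine measurable_of_comp_mkWord fun m => ?_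
  by_cases h : m = n
  · subst h
    have : (fun x => fiberCoord m (mkWord m x)) = id := by
      funext x; simp [fiberCoord, mkWord]
    rw [this]; exact measurable_id
  · have : (fun x => fiberCoord n (mkWord m x)) = fun _ => 0 := by
      funext x; simp [fiberCoord, mkWord, h]
    rw [this]; exact measurable_const

/-- Words split into countably many measurable pieces of constant length, and on each piece
`fiberCoord` recovers the letters measurably. -/
theorem measurable_of_comp_prod_mkWord {X β : Type*} [MeasurableSpace X] [MeasurableSpace β]
    {g : X × Word → β} (h : ∀ n, Measurable fun p : X × (Fin n → ℝ) => g (p.1, mkWord n p.2)) :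
    Measurable g := by
  intro s hs
  have : g ⁻¹' s = ⋃ n, ({p | p.2.1 = n} ∩ (fun p : X × Word => (p.1, fiberCoord n p.2)) ⁻¹'
      ((fun p : X × (Fin n → ℝ) => g (p.1, mkWord n p.2)) ⁻¹' s)) := by
    ext p
    simp only [Set.mem_preimage, Set.mem_iUnion, Set.mem_inter_iff, Set.mem_ofPred_eq,
      exists_eq_left', mkWord_fiberCoord rfl]
  rw [this]
  refine MeasurableSet.iUnion fun n => MeasurableSet.inter ?_ ?_
  · exact (measurable_length.comp measurable_snd) (measurableSet_singleton n)
  · exact (measurable_fst.prodMk ((measurable_fiberCoord n).comp measurable_snd)) (h n hs)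

/-- The operator-valued kernels live in a space that need not be separable, so separability of the
range has to be carried along; here the range is a countable union of separable ranges. -/
theorem stronglyMeasurable_of_comp_prod_mkWord {X E : Type*} [MeasurableSpace X]
    [TopologicalSpace E] [TopologicalSpace.PseudoMetrizableSpace E] {g : X × Word → E}
    (h : ∀ n, StronglyMeasurable fun p : X × (Fin n → ℝ) => g (p.1, mkWord n p.2)) :
    StronglyMeasurable g := by
  borelize E
  refine stronglyMeasurable_iff_measurable_separable.2
    ⟨measurable_of_comp_prod_mkWord fun n => (h n).measurable, ?_⟩
  refine (TopologicalSpace.IsSeparable.iUnion fun n => (h n).isSeparable_range).mono ?_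
  rintro _ ⟨⟨x, n, y⟩, rfl⟩
  exact Set.mem_iUnion.2 ⟨n, (x, y), rfl⟩

theorem stronglyMeasurable_of_comp_mkWord {E : Type*}
    [TopologicalSpace E] [TopologicalSpace.PseudoMetrizableSpace E] {g : Word → E}
    (h : ∀ n, StronglyMeasurable fun x => g (mkWord n x)) : StronglyMeasurable g := by
  have : StronglyMeasurable fun p : Unit × Word => g p.2 :=
    stronglyMeasurable_of_comp_prod_mkWord fun n => (h n).comp_measurable measurable_snd
  exact this.comp_measurable (measurable_const.prodMk measurable_id : Measurable
    fun w : Word => ((), w))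

/-- Prepend a letter to a word. -/
def consWord (r : ℝ) (w : Word) : Word := ⟨w.1 + 1, Fin.cons r w.2⟩

theorem letters_consWord (r : ℝ) (w : Word) : letters (consWord r w) = r ::ₘ letters w := by
  simp only [letters_eq_ofFn]
  change ((List.ofFn (Fin.cons r w.2 : Fin (w.1 + 1) → ℝ) : List ℝ) : Multiset ℝ) = _
  rw [List.ofFn_cons]
  rfl

theorem measurable_consWord : Measurable fun p : ℝ × Word => consWord p.1 p.2 := by
  refine measurable_of_comp_prod_mkWord fun n => (measurable_mkWord (n + 1)).comp ?_
  refine measurable_pi_iff.2 fun i => ?_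
  refine Fin.cases ?_ (fun j => ?_) i
  · exact measurable_fst
  · simp only [mkWord, Fin.cons_succ]
    exact (measurable_pi_apply j).comp measurable_snd

theorem measurable_concat : Measurable fun p : Word × Word => concat p.1 p.2 := by
  refine measurable_of_comp_prod_mkWord fun n => ?_
  have : Measurable fun q : (Fin n → ℝ) × Word => concat q.2 (mkWord n q.1) := by
    refine measurable_of_comp_prod_mkWord fun m => (measurable_mkWord (m + n)).comp ?_
    refine measurable_pi_iff.2 fun i => ?_
    refine Fin.addCases (fun j => ?_) (fun j => ?_) i
    · simp only [mkWord, Fin.append_left]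
      exact (measurable_pi_apply j).comp measurable_snd
    · simp only [mkWord, Fin.append_right]
      exact (measurable_pi_apply j).comp measurable_fst
  exact this.comp measurable_swap

/-- Reflection of the letters. -/
def negWord (w : Word) : Word := ⟨w.1, fun i => - w.2 i⟩

theorem letters_negWord (w : Word) : letters (negWord w) = (letters w).map Neg.neg := by
  simp only [letters, negWord, Multiset.map_map]
  rfl

theorem measurePreserving_negWord : MeasurePreserving negWord wordMeasure wordMeasure :=
  measurePreserving_of_fiber (fun _ x i => - x i) fun _ => Measure.measurePreserving_neg volume

instance : SFinite wordMeasure := by unfold wordMeasure; infer_instance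

/-! ### Integration on words -/

theorem wordMeasure_eq_sum : wordMeasure = Measure.sum fun n : ℕ =>
    ((n.factorial : ℝ≥0∞)⁻¹) • (volume : Measure (Fin n → ℝ)).map (mkWord n) := rfl

theorem lintegral_wordMeasure {g : Word → ℝ≥0∞} (hg : Measurable g) :
    ∫⁻ w, g w ∂wordMeasure
      = ∑' n : ℕ, (n.factorial : ℝ≥0∞)⁻¹ * ∫⁻ x : Fin n → ℝ, g (mkWord n x) := by
  rw [wordMeasure_eq_sum, lintegral_sum_measure]
  congr 1
  funext n
  rw [lintegral_smul_measure, lintegral_map hg (measurable_mkWord n), smul_eq_mul]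

theorem ae_wordMeasure_iff {p : Word → Prop} (hp : MeasurableSet {w | p w}) :
    (∀ᵐ w ∂wordMeasure, p w) ↔ ∀ n, ∀ᵐ x : Fin n → ℝ, p (mkWord n x) := by
  rw [wordMeasure_eq_sum, Measure.ae_sum_iff' hp]
  refine forall_congr' fun n => ?_
  rw [← ae_map_iff (measurable_mkWord n).aemeasurable hp]
  have h0 : ((n.factorial : ℝ≥0∞)⁻¹) ≠ 0 := by simp
  simp only [ae_iff, Measure.smul_apply, smul_eq_mul, mul_eq_zero, h0, false_or]

theorem integral_wordMeasure {E : Type*} [NormedAddCommGroup E] [NormedSpace ℝ E]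
    {g : Word → E} (hg : Integrable g wordMeasure) (hm : StronglyMeasurable g) :
    ∫ w, g w ∂wordMeasure = ∑' n : ℕ, (n.factorial : ℝ)⁻¹ • ∫ x : Fin n → ℝ, g (mkWord n x) := by
  rw [wordMeasure_eq_sum] at hg ⊢
  rw [integral_sum_measure hg]
  congr 1
  funext n
  rw [integral_smul_measure, integral_map (measurable_mkWord n).aemeasurable
    hm.aestronglyMeasurable]
  simp

/-! ### The number of letters and products over letters -/

/-- The function `M ↦ ∏_{r ∈ M} q·1{|r| ≤ R}` that dominates functions of exponential type with
letters in `[-R, R]`. -/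
def env (q R : ℝ) (M : Multiset ℝ) : ℝ := (M.map fun r => if |r| ≤ R then q else 0).prod

@[simp] theorem env_zero (q R : ℝ) : env q R 0 = 1 := by simp [env]

theorem env_cons (q R r : ℝ) (M : Multiset ℝ) :
    env q R (r ::ₘ M) = (if |r| ≤ R then q else 0) * env q R M := by simp [env]

theorem env_add (q R : ℝ) (M M' : Multiset ℝ) : env q R (M + M') = env q R M * env q R M' := by
  simp [env]

theorem env_nonneg {q : ℝ} (hq : 0 ≤ q) (R : ℝ) (M : Multiset ℝ) : 0 ≤ env q R M := by
  refine Multiset.prod_nonneg fun a ha => ?_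
  obtain ⟨r, _, rfl⟩ := Multiset.mem_map.1 ha
  split_ifs <;> simp [hq]

theorem env_mul (q q' R : ℝ) (M : Multiset ℝ) : env q R M * env q' R M = env (q * q') R M := by
  rw [env, env, env, ← Multiset.prod_map_mul]
  congr 2
  funext r
  split_ifs <;> simp

theorem env_mono {q q' R R' : ℝ} (hq : 0 ≤ q) (h : q ≤ q') (hR : R ≤ R') (M : Multiset ℝ) :
    env q R M ≤ env q' R' M := by
  induction M using Multiset.induction_on with
  | empty => simp
  | cons a s ih =>
    rw [env_cons, env_cons]
    refine mul_le_mul ?_ ih (env_nonneg hq _ _) ?_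
    · by_cases h1 : |a| ≤ R
      · simp [h1, h1.trans hR, h]
      · simp only [h1, if_false]; split_ifs <;> linarith
    · split_ifs <;> linarith

theorem env_eq_pow {q R : ℝ} {M : Multiset ℝ} (h : ∀ r ∈ M, |r| ≤ R) :
    env q R M = q ^ M.card := by
  rw [env, Multiset.map_congr rfl (g := fun _ => q) (fun r hr => by simp [h r hr])]
  simp

/-- This is the expansion of a product of factors `a + b`: each letter goes to the left part with
factor `a` or to the right part with factor `b`. -/
theorem sum_antidiagonal_env (a b R : ℝ) (M : Multiset ℝ) :
    (M.antidiagonal.map fun p => env a R p.1 * env b R p.2).sum = env (a + b) R M := by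
  simp only [env]
  rw [← Multiset.prod_map_add]
  congr 2
  funext r
  split_ifs <;> simp

theorem env_letters_mkWord (q R : ℝ) (n : ℕ) (x : Fin n → ℝ) :
    env q R (letters (mkWord n x)) = ∏ i, if |x i| ≤ R then q else 0 := by
  simp only [env, letters_mkWord, Multiset.map_map, Finset.prod, Function.comp_def]

theorem measurable_env (q R : ℝ) : Measurable fun w : Word => env q R (letters w) := by
  refine measurable_of_comp_mkWord fun n => ?_
  simp only [env_letters_mkWord]
  refine Finset.measurable_fun_prod _ fun i _ => Measurable.ite ?_ measurable_const measurable_const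
  exact measurableSet_le (measurable_pi_apply i).abs measurable_const

/-- The integral over `ℝⁿ` is the `n`-th power of a one-dimensional integral, so with the factors
`1/n!` the total is an exponential series. -/
theorem integrable_env {q : ℝ} (hq : 0 ≤ q) (R : ℝ) :
    Integrable (fun w : Word => env q R (letters w)) wordMeasure := by
  have hint : Integrable (fun r : ℝ => if |r| ≤ R then q else 0) := by
    have h1 : Integrable (Set.indicator (Set.Icc (-R) R) fun _ : ℝ => q) :=
      (integrable_indicator_iff measurableSet_Icc).2
        (integrableOn_const (hs := by simp [Real.volume_Icc]))
    refine h1.congr (ae_of_all _ fun r => ?_)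
    simp [Set.indicator_apply, abs_le]
  have hfib : ∀ n, Integrable fun x : Fin n → ℝ => env q R (letters (mkWord n x)) := fun n => by
    simp only [env_letters_mkWord]
    exact Integrable.fintype_prod fun _ => hint
  rw [wordMeasure_eq_sum]
  have hm := (measurable_env q R).aestronglyMeasurable (μ := wordMeasure)
  refine integrable_sum_measure (fun n => ?_) ?_
  · refine Integrable.smul_measure ?_ (by simp [Nat.factorial_ne_zero])
    exact (integrable_map_measure (measurable_env q R).aestronglyMeasurable
      (measurable_mkWord n).aemeasurable).2 (hfib n)
  · have : ∀ n : ℕ, ∫ w, ‖env q R (letters w)‖ ∂(((n.factorial : ℝ≥0∞)⁻¹) •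
        (volume : Measure (Fin n → ℝ)).map (mkWord n))
        = (∫ r : ℝ, if |r| ≤ R then q else 0) ^ n / n.factorial := fun n => by
      rw [integral_smul_measure, integral_map (measurable_mkWord n).aemeasurable
        (measurable_env q R).norm.aestronglyMeasurable]
      have h1 : ∀ x : Fin n → ℝ, ‖env q R (letters (mkWord n x))‖
          = ∏ i, if |x i| ≤ R then q else 0 := fun x => by
        rw [Real.norm_of_nonneg (env_nonneg hq _ _), env_letters_mkWord]
      simp only [h1]
      rw [integral_fintype_prod_volume_eq_prod (fun _ r => if |r| ≤ R then q else 0)]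
      simp [div_eq_inv_mul]
    simp only [this]
    exact Real.summable_pow_div_factorial _

theorem ae_nodup_letters : ∀ᵐ w ∂wordMeasure, (letters w).Nodup := by
  have key : ∀ n (i j : Fin n), i ≠ j → ∀ᵐ x : Fin n → ℝ, x i ≠ x j := fun n i j hij => by
    -- The diagonal `x i = x j` is a proper linear subspace, hence a null set.
    have h0 := Measure.addHaar_submodule (volume : Measure (Fin n → ℝ))
      (LinearMap.ker (LinearMap.proj (R := ℝ) (φ := fun _ : Fin n => ℝ) i - LinearMap.proj j)) (by
        intro h
        have : (Pi.single i 1 : Fin n → ℝ) ∈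
          LinearMap.ker (LinearMap.proj (R := ℝ) (φ := fun _ : Fin n => ℝ) i
            - LinearMap.proj j) := by
          rw [h]; trivial
        simp [LinearMap.mem_ker, hij.symm] at this)
    rw [ae_iff]
    refine measure_mono_null (fun x hx => ?_) h0
    simpa [LinearMap.mem_ker, sub_eq_zero] using hx
  have hiff : ∀ w : Word, (letters w).Nodup ↔ Function.Injective w.2 := fun w => by
    rw [letters, Multiset.nodup_map_iff_inj_on Finset.univ.nodup]
    exact ⟨fun h a b hab => h a (Finset.mem_univ a) b (Finset.mem_univ b) hab,
      fun h a _ b _ hab => h hab⟩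
  have hinj : ∀ n (x : Fin n → ℝ), Function.Injective x ↔ ∀ i j, i ≠ j → x i ≠ x j :=
    fun n x => ⟨fun h i j hij he => hij (h he), fun h i j he => by_contra fun hij => h i j hij he⟩
  rw [ae_wordMeasure_iff]
  · intro n
    simp only [hiff, mkWord, hinj]
    refine ae_all_iff.2 fun i => ae_all_iff.2 fun j => ?_
    by_cases hij : i = j
    · simp [hij]
    · filter_upwards [key n i j hij] with x hx _ using hx
  · refine measurableSet_word.2 fun n => ?_
    have : mkWord n ⁻¹' {w | (letters w).Nodup}
        = ⋂ i : Fin n, ⋂ j : Fin n, ⋂ _ : i ≠ j, {x : Fin n → ℝ | x i = x j}ᶜ := by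
      ext x
      simp only [Set.mem_preimage, Set.mem_ofPred_eq, hiff, mkWord, hinj, Set.mem_iInter,
        Set.mem_compl_iff, ne_eq]
    change MeasurableSet (mkWord n ⁻¹' _)
    rw [this]
    refine MeasurableSet.iInter fun i => MeasurableSet.iInter fun j => MeasurableSet.iInter fun _ => ?_
    exact (measurableSet_eq_fun (measurable_pi_apply i) (measurable_pi_apply j)).compl

/-! ### Sums over the ways to split a multiset -/

/-- Translates sums over subsets of positions, which define `kernelOp`, into sums over splittings of
the multiset. Repeated letters are counted with the same multiplicity on both sides. -/
theorem sum_antidiagonal_map {ι β E : Type*} [DecidableEq ι] [AddCommMonoid E] (S : Finset ι)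
    (x : ι → β) (φ : Multiset β × Multiset β → E) :
    ((S.val.map x).antidiagonal.map φ).sum
      = ∑ a ∈ S.powerset, φ (a.val.map x, (S \ a).val.map x) := by
  induction S using Finset.induction_on generalizing φ with
  | empty => simp
  | insert i S hi ih =>
    rw [Finset.sum_powerset_insert hi, Finset.insert_val_of_notMem hi, Multiset.map_cons,
      Multiset.antidiagonal_cons, Multiset.map_add, Multiset.sum_add, Multiset.map_map,
      Multiset.map_map, ih, ih]
    congr 1
    · refine Finset.sum_congr rfl fun a ha => ?_
      have hia : i ∉ a := fun h => hi (Finset.mem_powerset.1 ha h)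
      have : insert i S \ a = insert i (S \ a) := Finset.insert_sdiff_of_notMem _ hia
      rw [this, Finset.insert_val_of_notMem (fun h => hi (Finset.mem_sdiff.1 h).1)]
      simp
    · refine Finset.sum_congr rfl fun a ha => ?_
      have hia : i ∉ a := fun h => hi (Finset.mem_powerset.1 ha h)
      have : insert i S \ insert i a = S \ a := by
        rw [Finset.insert_sdiff_insert, Finset.sdiff_insert_of_notMem hi]
      rw [this, Finset.insert_val_of_notMem hia]
      simp

section Multiset

variable {β E : Type*} [DecidableEq β] [AddCommMonoid E]

theorem sum_antidiagonal_ite_fst_eq_zero (X : Multiset β) (φ : Multiset β → E) :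
    (X.antidiagonal.map fun p => if p.1 = 0 then φ p.2 else 0).sum = φ X := by
  induction X using Multiset.induction_on generalizing φ with
  | empty => simp
  | cons a s ih =>
    rw [Multiset.antidiagonal_cons, Multiset.map_add, Multiset.sum_add, Multiset.map_map,
      Multiset.map_map]
    simp only [Function.comp_def, Prod.map_fst, Prod.map_snd, id, Multiset.cons_ne_zero, if_false]
    rw [ih fun M => φ (a ::ₘ M)]
    simp

theorem sum_antidiagonal_ite_card_fst_eq_one (X : Multiset β) (φ : Multiset β → Multiset β → E) :
    (X.antidiagonal.map fun p => if p.1.card = 1 then φ p.1 p.2 else 0).sum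
      = (X.map fun r => φ {r} (X.erase r)).sum := by
  induction X using Multiset.induction_on generalizing φ with
  | empty => simp
  | cons a s ih =>
    rw [Multiset.antidiagonal_cons, Multiset.map_add, Multiset.sum_add, Multiset.map_map,
      Multiset.map_map, Multiset.map_cons, Multiset.sum_cons, add_comm]
    congr 1
    · rw [Multiset.erase_cons_head, ← sum_antidiagonal_ite_fst_eq_zero s (φ {a})]
      congr 1
      refine Multiset.map_congr rfl fun p _ => ?_
      simp only [Function.comp_def, Prod.map_fst, Prod.map_snd, id, Multiset.card_cons,
        Nat.add_eq_right, Multiset.card_eq_zero]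
      split_ifs with h
      · rw [h]; rfl
      · rfl
    · simp only [Function.comp_def, Prod.map_fst, Prod.map_snd, id]
      rw [ih fun M N => φ M (a ::ₘ N)]
      congr 1
      refine Multiset.map_congr rfl fun r hr => ?_
      rw [Multiset.erase_cons_tail_of_mem hr]

/-- Removing a letter from the first part of a splitting, and then summing over all splittings,
is the same as first removing a letter and then splitting. -/
theorem sum_antidiagonal_sum_fst (X : Multiset β) (φ : β → Multiset β → Multiset β → E) :
    (X.antidiagonal.map fun p => (p.1.map fun r => φ r (p.1.erase r) p.2).sum).sum
      = (X.map fun r => ((X.erase r).antidiagonal.map fun p => φ r p.1 p.2).sum).sum := by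
  induction X using Multiset.induction_on generalizing φ with
  | empty => simp
  | cons a s ih =>
    rw [Multiset.antidiagonal_cons, Multiset.map_add, Multiset.sum_add, Multiset.map_map,
      Multiset.map_map, Multiset.map_cons, Multiset.sum_cons, Multiset.erase_cons_head]
    simp only [Function.comp_def, Prod.map_fst, Prod.map_snd, id, Multiset.map_cons,
      Multiset.sum_cons, Multiset.erase_cons_head, Multiset.sum_map_add]
    have h1 : (s.map fun r => (((a ::ₘ s).erase r).antidiagonal.map fun p => φ r p.1 p.2).sum)
        = s.map fun r => ((s.erase r).antidiagonal.map fun p => φ r p.1 (a ::ₘ p.2)).sum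
          + ((s.erase r).antidiagonal.map fun p => φ r (a ::ₘ p.1) p.2).sum := by
      refine Multiset.map_congr rfl fun r hr => ?_
      rw [Multiset.erase_cons_tail_of_mem hr, Multiset.antidiagonal_cons, Multiset.map_add,
        Multiset.sum_add, Multiset.map_map, Multiset.map_map]
      rfl
    have h2 : (s.antidiagonal.map fun p => (p.1.map fun r => φ r ((a ::ₘ p.1).erase r) p.2).sum)
        = s.antidiagonal.map fun p => (p.1.map fun r => φ r (a ::ₘ (p.1.erase r)) p.2).sum := by
      refine Multiset.map_congr rfl fun p _ => ?_
      congr 1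
      refine Multiset.map_congr rfl fun r hr => ?_
      rw [Multiset.erase_cons_tail_of_mem hr]
    rw [h1, h2, Multiset.sum_map_add, ih fun r M N => φ r M (a ::ₘ N),
      ih fun r M N => φ r (a ::ₘ M) N]
    ac_rfl

omit [DecidableEq β] in
theorem sum_antidiagonal_swap (X : Multiset β) (φ : Multiset β → Multiset β → E) :
    (X.antidiagonal.map fun p => φ p.1 p.2).sum = (X.antidiagonal.map fun p => φ p.2 p.1).sum := by
  conv_lhs => rw [← Multiset.map_swap_antidiagonal, Multiset.map_map]
  rfl

theorem sum_antidiagonal_sum_snd (X : Multiset β) (φ : β → Multiset β → Multiset β → E) :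
    (X.antidiagonal.map fun p => (p.2.map fun r => φ r p.1 (p.2.erase r)).sum).sum
      = (X.map fun r => ((X.erase r).antidiagonal.map fun p => φ r p.1 p.2).sum).sum := by
  rw [sum_antidiagonal_swap X fun M N => (N.map fun r => φ r M (N.erase r)).sum,
    sum_antidiagonal_sum_fst X fun r M N => φ r N M]
  congr 1
  refine Multiset.map_congr rfl fun r _ => ?_
  rw [sum_antidiagonal_swap]

end Multiset

/-! ### The sum-integral formulas -/

/-- Split the word with letters `x` into the subwords at the positions in `a` and at the others. -/
def splitWord (n : ℕ) (a : Finset (Fin n)) (x : Fin n → ℝ) : Word × Word :=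
  (mkWord a.card (x ∘ a.orderEmbOfFin rfl), mkWord aᶜ.card (x ∘ aᶜ.orderEmbOfFin rfl))

theorem measurable_splitWord (n : ℕ) (a : Finset (Fin n)) : Measurable (splitWord n a) :=
  ((measurable_mkWord _).comp (measurable_pi_iff.2 fun _ => measurable_pi_apply _)).prodMk
    ((measurable_mkWord _).comp (measurable_pi_iff.2 fun _ => measurable_pi_apply _))

/-- Lebesgue measure on the words of length `n`. -/
def fiberMeasure (n : ℕ) : Measure Word := (volume : Measure (Fin n → ℝ)).map (mkWord n)

instance (n : ℕ) : SFinite (fiberMeasure n) := by unfold fiberMeasure; infer_instance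

/-- Splitting the coordinates along `a` and its complement identifies `ℝⁿ` with a product and
preserves Lebesgue measure. -/
theorem map_splitWord (n : ℕ) (a : Finset (Fin n)) :
    (volume : Measure (Fin n → ℝ)).map (splitWord n a)
      = (fiberMeasure a.card).prod (fiberMeasure aᶜ.card) := by
  rw [fiberMeasure, fiberMeasure, Measure.map_prod_map _ _ (measurable_mkWord _)
    (measurable_mkWord _)]
  have h1 := volume_preserving_arrowCongr' (finSumEquivOfFinset (s := a) rfl rfl).symm
    (MeasurableEquiv.refl ℝ) (MeasurePreserving.id volume)
  have h2 := (volume_measurePreserving_sumPiEquivProdPi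
    (fun _ : Fin a.card ⊕ Fin aᶜ.card => ℝ)).comp h1
  rw [← Measure.volume_eq_prod, ← h2.map_eq, Measure.map_map
    ((measurable_mkWord _).prodMap (measurable_mkWord _)) h2.measurable]
  rfl

/-- The product of the two series is regrouped by total length `n`. There are `n.choose m` subsets
of size `m`, each contributing the same product measure, and `n.choose m / n! = 1 / (m! (n-m)!)`. -/
theorem wordMeasure_prod_eq_sum : wordMeasure.prod wordMeasure = Measure.sum fun n : ℕ =>
    (n.factorial : ℝ≥0∞)⁻¹ • ∑ a : Finset (Fin n),
      (volume : Measure (Fin n → ℝ)).map (splitWord n a) := by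
  have hw : wordMeasure = Measure.sum fun n : ℕ => ((n.factorial : ℝ≥0∞)⁻¹) • fiberMeasure n := rfl
  refine Measure.ext fun s hs => ?_
  rw [hw, Measure.prod_sum, Measure.sum_apply _ hs, Measure.sum_apply _ hs,
    ← Finset.HasAntidiagonal.sigmaAntidiagonalEquivProd.tsum_eq, ENNReal.tsum_sigma']
  congr 1
  funext n
  rw [tsum_fintype, Finset.univ_eq_attach]
  simp only [Finset.HasAntidiagonal.sigmaAntidiagonalEquivProd_apply]
  rw [Finset.sum_attach (Finset.HasAntidiagonal.antidiagonal n) fun p : ℕ × ℕ =>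
    ((((p.1.factorial : ℝ≥0∞)⁻¹) • fiberMeasure p.1).prod
      (((p.2.factorial : ℝ≥0∞)⁻¹) • fiberMeasure p.2)) s,
    Finset.Nat.sum_antidiagonal_eq_sum_range_succ_mk]
  have h1 : ∀ a : Finset (Fin n), (volume : Measure (Fin n → ℝ)).map (splitWord n a)
      = (fiberMeasure a.card).prod (fiberMeasure (n - a.card)) := fun a => by
    rw [map_splitWord, Finset.card_compl, Fintype.card_fin]
  simp only [h1, Measure.smul_apply, Measure.coe_finsetSum, Finset.sum_apply, smul_eq_mul]
  rw [← Finset.powerset_univ, Finset.sum_powerset_apply_card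
    (fun m => (((fiberMeasure m).prod (fiberMeasure (n - m))) s)), Finset.mul_sum]
  rw [Finset.card_univ, Fintype.card_fin]
  refine Finset.sum_congr rfl fun m hm => ?_
  have hmn : m ≤ n := Nat.lt_succ_iff.1 (Finset.mem_range.1 hm)
  have hfin : ∀ k : ℕ, (k.factorial : ℝ≥0∞)⁻¹ ≠ ∞ := fun k => by simp [Nat.factorial_ne_zero]
  have hsm : (((m.factorial : ℝ≥0∞)⁻¹ • fiberMeasure m).prod
      (((n - m).factorial : ℝ≥0∞)⁻¹ • fiberMeasure (n - m)))
      = ((m.factorial : ℝ≥0∞)⁻¹ * ((n - m).factorial : ℝ≥0∞)⁻¹) •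
        ((fiberMeasure m).prod (fiberMeasure (n - m))) := by
    rw [Measure.prod_smul_left, Measure.prod_smul_right, smul_smul]
  rw [hsm, Measure.smul_apply, smul_eq_mul, nsmul_eq_mul, ← mul_assoc]
  congr 1
  have h0 : ∀ k : ℕ, (k.factorial : ℝ≥0∞) ≠ 0 := fun k => by simp [Nat.factorial_ne_zero]
  have ht : ∀ k : ℕ, (k.factorial : ℝ≥0∞) ≠ ∞ := fun k => ENNReal.natCast_ne_top _
  have hc : (n.factorial : ℝ≥0∞) = n.choose m * m.factorial * (n - m).factorial := by
    exact_mod_cast (Nat.choose_mul_factorial_mul_factorial hmn).symm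
  have hC0 : (n.choose m : ℝ≥0∞) ≠ 0 := by
    exact_mod_cast (Nat.choose_pos hmn).ne'
  have hCt : (n.choose m : ℝ≥0∞) ≠ ∞ := ENNReal.natCast_ne_top _
  rw [hc, ENNReal.mul_inv (Or.inr (ht _)) (Or.inr (h0 _)),
    ENNReal.mul_inv (Or.inl hC0) (Or.inl hCt)]
  calc (m.factorial : ℝ≥0∞)⁻¹ * ((n - m).factorial : ℝ≥0∞)⁻¹
      = (n.choose m * (n.choose m : ℝ≥0∞)⁻¹)
        * ((m.factorial : ℝ≥0∞)⁻¹ * ((n - m).factorial : ℝ≥0∞)⁻¹) := by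
        rw [ENNReal.mul_inv_cancel hC0 hCt, one_mul]
    _ = _ := by ring

section SumIntegral

variable {E : Type*} [NormedAddCommGroup E] [NormedSpace ℝ E]

omit [NormedSpace ℝ E] in
theorem sum_antidiagonal_letters_mkWord (n : ℕ) (x : Fin n → ℝ)
    (H : Multiset ℝ → Multiset ℝ → E) :
    ((letters (mkWord n x)).antidiagonal.map fun p => H p.1 p.2).sum
      = ∑ a : Finset (Fin n), H (letters (splitWord n a x).1) (letters (splitWord n a x).2) := by
  rw [letters_mkWord, sum_antidiagonal_map, Finset.powerset_univ]
  refine Finset.sum_congr rfl fun a _ => ?_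
  simp only [splitWord, letters_mkWord, map_univ_comp_orderEmbOfFin, Finset.compl_eq_univ_sdiff]

omit [NormedSpace ℝ E] in
theorem stronglyMeasurable_sum_antidiagonal_prod {X : Type*} [MeasurableSpace X]
    {H : X → Multiset ℝ → Multiset ℝ → E}
    (hm : StronglyMeasurable fun p : X × Word × Word => H p.1 (letters p.2.1) (letters p.2.2)) :
    StronglyMeasurable fun p : X × Word =>
      ((letters p.2).antidiagonal.map fun u => H p.1 u.1 u.2).sum := by
  refine stronglyMeasurable_of_comp_prod_mkWord fun n => ?_
  simp only [sum_antidiagonal_letters_mkWord]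
  exact Finset.stronglyMeasurable_fun_sum _ fun a _ => hm.comp_measurable
    (measurable_fst.prodMk ((measurable_splitWord n a).comp measurable_snd))

variable {H : Multiset ℝ → Multiset ℝ → E}
  (hm : StronglyMeasurable fun p : Word × Word => H (letters p.1) (letters p.2))
include hm

omit [NormedSpace ℝ E] in
theorem stronglyMeasurable_sum_antidiagonal : StronglyMeasurable fun w : Word =>
    ((letters w).antidiagonal.map fun p => H p.1 p.2).sum := by
  refine stronglyMeasurable_of_comp_mkWord fun n => ?_
  simp only [sum_antidiagonal_letters_mkWord]
  exact Finset.stronglyMeasurable_fun_sum _ fun a _ =>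
    hm.comp_measurable (measurable_splitWord n a)

variable (hi : Integrable (fun p : Word × Word => H (letters p.1) (letters p.2))
  (wordMeasure.prod wordMeasure))
include hi

-- On words of length `n` both the sum over splittings and the product measure are sums over the
-- same subsets of `Fin n`, so integrability for the product measure gives integrability here
-- through the triangle inequality.
omit [NormedSpace ℝ E] in
theorem integrable_sum_antidiagonal : Integrable (fun w : Word =>
    ((letters w).antidiagonal.map fun p => H p.1 p.2).sum) wordMeasure := by
  have hsm := stronglyMeasurable_sum_antidiagonal hm
  rw [wordMeasure_prod_eq_sum] at hi
  obtain ⟨hi1, hi2⟩ := integrable_sum_measure_iff.1 hi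
  have h0 : ∀ n : ℕ, (n.factorial : ℝ≥0∞)⁻¹ ≠ 0 := fun n => by simp
  have ht : ∀ n : ℕ, (n.factorial : ℝ≥0∞)⁻¹ ≠ ∞ := fun n => by simp [Nat.factorial_ne_zero]
  have hia : ∀ n (a : Finset (Fin n)), Integrable (fun x =>
      H (letters (splitWord n a x).1) (letters (splitWord n a x).2)) := fun n a => by
    have h := (integrable_smul_measure (h0 n) (ht n)).1 (hi1 n)
    rw [integrable_finsetSum_measure] at h
    exact (integrable_map_measure hm.aestronglyMeasurable
      (measurable_splitWord n a).aemeasurable).1 (h a (Finset.mem_univ a))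
  rw [wordMeasure_eq_sum]
  refine integrable_sum_measure (fun n => ?_) (Summable.of_nonneg_of_le
    (fun n => integral_nonneg fun _ => norm_nonneg _) (fun n => ?_) hi2)
  · refine Integrable.smul_measure ((integrable_map_measure hsm.aestronglyMeasurable
      (measurable_mkWord n).aemeasurable).2 ?_) (ht n)
    simp only [Function.comp_def, sum_antidiagonal_letters_mkWord]
    exact integrable_finsetSum _ fun a _ => hia n a
  · rw [integral_smul_measure, integral_smul_measure, integral_map
      (measurable_mkWord n).aemeasurable hsm.norm.aestronglyMeasurable,
      integral_finsetSum_measure fun a _ => (integrable_map_measure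
        hm.norm.aestronglyMeasurable (measurable_splitWord n a).aemeasurable).2 (hia n a).norm]
    refine smul_le_smul_of_nonneg_left ?_ ENNReal.toReal_nonneg
    simp only [sum_antidiagonal_letters_mkWord]
    simp only [integral_map (measurable_splitWord n _).aemeasurable hm.norm.aestronglyMeasurable]
    rw [← integral_finsetSum _ fun a _ => (hia n a).norm]
    exact integral_mono (integrable_finsetSum _ fun a _ => hia n a).norm
      (integrable_finsetSum _ fun a _ => (hia n a).norm) fun x => norm_sum_le _ _

/-- The sum-integral formula. -/
theorem integral_sum_antidiagonal :
    ∫ w, ((letters w).antidiagonal.map fun p => H p.1 p.2).sum ∂wordMeasure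
      = ∫ p : Word × Word, H (letters p.1) (letters p.2) ∂wordMeasure.prod wordMeasure := by
  have hsm := stronglyMeasurable_sum_antidiagonal hm
  rw [integral_wordMeasure (integrable_sum_antidiagonal hm hi) hsm]
  rw [wordMeasure_prod_eq_sum] at hi ⊢
  obtain ⟨hi1, -⟩ := integrable_sum_measure_iff.1 hi
  rw [integral_sum_measure hi]
  congr 1
  funext n
  have h := (integrable_smul_measure (by simp) (by simp [Nat.factorial_ne_zero])).1 (hi1 n)
  rw [integrable_finsetSum_measure] at h
  rw [integral_smul_measure, integral_finsetSum_measure fun a _ => h a (Finset.mem_univ a)]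
  simp only [sum_antidiagonal_letters_mkWord]
  simp only [integral_map (measurable_splitWord n _).aemeasurable hm.aestronglyMeasurable]
  have h' : ∀ a : Finset (Fin n), Integrable fun x =>
      H (letters (splitWord n a x).1) (letters (splitWord n a x).2) := fun a =>
    (integrable_map_measure hm.aestronglyMeasurable
      (measurable_splitWord n a).aemeasurable).1 (h a (Finset.mem_univ a))
  rw [integral_finsetSum _ fun a _ => h' a]
  simp

end SumIntegral

/-- The word with the single letter `r`. -/
def singleWord (r : ℝ) : Word := mkWord 1 fun _ => r

theorem letters_singleWord (r : ℝ) : letters (singleWord r) = {r} := by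
  simp [singleWord, letters_mkWord]

theorem measurable_singleWord : Measurable singleWord :=
  (measurable_mkWord 1).comp (measurable_pi_iff.2 fun _ => measurable_id)

theorem wordMeasure_restrict_length_one :
    wordMeasure.restrict {w | w.1 = 1} = (volume : Measure ℝ).map singleWord := by
  have hS : MeasurableSet {w : Word | w.1 = 1} := measurable_length (measurableSet_singleton 1)
  refine Measure.ext fun s hs => ?_
  rw [Measure.restrict_apply hs, wordMeasure_eq_sum, Measure.sum_apply _ (hs.inter hS),
    tsum_eq_single 1, Measure.map_apply measurable_singleWord hs, Measure.smul_apply,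
    Measure.map_apply (measurable_mkWord 1) (hs.inter hS)]
  · simp only [Nat.factorial_one, Nat.cast_one, inv_one, one_smul]
    have h := (volume_preserving_funUnique (Fin 1) ℝ).symm
    refine (h.measure_preimage (measurable_mkWord 1 (hs.inter hS)).nullMeasurableSet).symm.trans ?_
    congr 1
    ext r
    simp only [Set.mem_preimage, Set.mem_inter_iff, Set.mem_ofPred_eq]
    exact ⟨fun h => h.1, fun h => ⟨h, rfl⟩⟩
  · intro n hn
    rw [Measure.smul_apply, Measure.map_apply (measurable_mkWord n) (hs.inter hS)]
    have : mkWord n ⁻¹' (s ∩ {w | w.1 = 1}) = ∅ := by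
      ext x
      simp [mkWord, hn]
    simp [this]

section Mecke

variable {E : Type*} [NormedAddCommGroup E] [NormedSpace ℝ E]
  {G : ℝ → Multiset ℝ → E}
  (hm : StronglyMeasurable fun p : ℝ × Word => G p.1 (letters p.2))
include hm

-- On a multiset with exactly one letter, `sum` returns that letter; it serves as a measurable way
-- to read the letter off.
omit [NormedSpace ℝ E] in
theorem stronglyMeasurable_ite_card : StronglyMeasurable fun p : Word × Word =>
    if (letters p.1).card = 1 then G (letters p.1).sum (letters p.2) else 0 := by
  refine StronglyMeasurable.ite ?_ ?_ stronglyMeasurable_const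
  · simp only [card_letters]
    exact (measurable_length.comp measurable_fst) (measurableSet_singleton 1)
  · refine hm.comp_measurable (Measurable.prodMk (Measurable.comp
      (g := fun w => (letters w).sum) ?_ measurable_fst) measurable_snd)
    refine measurable_of_comp_mkWord fun n => ?_
    simp only [letters_mkWord]
    exact Finset.measurable_fun_sum _ fun i _ => measurable_pi_apply i

variable (hi : Integrable (fun p : ℝ × Word => G p.1 (letters p.2))
  ((volume : Measure ℝ).prod wordMeasure))
include hi

/-- The measure of words restricted to one letter is Lebesgue measure on `ℝ`. With this, the
sum-integral formula, applied to splittings whose first part is a single letter, becomes the Mecke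
formula. -/
theorem integrable_ite_card_and_integral_eq : Integrable (fun p : Word × Word =>
      if (letters p.1).card = 1 then G (letters p.1).sum (letters p.2) else 0)
      (wordMeasure.prod wordMeasure) ∧
    ∫ p : Word × Word, (if (letters p.1).card = 1 then G (letters p.1).sum (letters p.2) else 0)
      ∂wordMeasure.prod wordMeasure
      = ∫ p : ℝ × Word, G p.1 (letters p.2) ∂(volume : Measure ℝ).prod wordMeasure := by
  have hS : MeasurableSet {w : Word | w.1 = 1} := measurable_length (measurableSet_singleton 1)
  have hmi := stronglyMeasurable_ite_card hm
  have hind : (fun p : Word × Word =>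
      if (letters p.1).card = 1 then G (letters p.1).sum (letters p.2) else 0)
      = Set.indicator ({w | w.1 = 1} ×ˢ Set.univ) (fun p : Word × Word =>
      if (letters p.1).card = 1 then G (letters p.1).sum (letters p.2) else 0) := by
    funext p
    by_cases h : p.1.1 = 1
    · rw [Set.indicator_of_mem (by simp [h])]
    · rw [Set.indicator_of_notMem (by simp [h]), if_neg (by rwa [card_letters])]
  have hmap : ((wordMeasure.prod wordMeasure).restrict ({w | w.1 = 1} ×ˢ Set.univ))
      = ((volume : Measure ℝ).prod wordMeasure).map (Prod.map singleWord id) := by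
    rw [← Measure.prod_restrict, wordMeasure_restrict_length_one, Measure.restrict_univ,
      ← Measure.map_prod_map _ _ measurable_singleWord measurable_id, Measure.map_id]
  have hcomp : (fun p : Word × Word =>
      if (letters p.1).card = 1 then G (letters p.1).sum (letters p.2) else 0)
      ∘ (Prod.map singleWord id) = fun p : ℝ × Word => G p.1 (letters p.2) := by
    funext p
    simp [letters_singleWord]
  have hpm : Measurable (Prod.map singleWord (id : Word → Word)) :=
    measurable_singleWord.prodMap measurable_id
  constructor
  · rw [hind, integrable_indicator_iff (hS.prod MeasurableSet.univ), IntegrableOn, hmap,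
      integrable_map_measure hmi.aestronglyMeasurable hpm.aemeasurable, hcomp]
    exact hi
  · rw [hind, integral_indicator (hS.prod MeasurableSet.univ), hmap,
      integral_map hpm.aemeasurable hmi.aestronglyMeasurable]
    exact congrArg (fun f => ∫ p, f p ∂(volume : Measure ℝ).prod wordMeasure) hcomp

theorem integrable_sum_erase : Integrable (fun w : Word =>
    ((letters w).map fun r => G r ((letters w).erase r)).sum) wordMeasure := by
  have := integrable_sum_antidiagonal (H := fun M N => if M.card = 1 then G M.sum N else 0)
    (stronglyMeasurable_ite_card hm) (integrable_ite_card_and_integral_eq hm hi).1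
  simpa only [sum_antidiagonal_ite_card_fst_eq_one _ fun M N => G M.sum N,
    Multiset.sum_singleton] using this

/-- The sum-integral formula for the choice of one letter (the Mecke formula). -/
theorem integral_sum_erase :
    ∫ w, ((letters w).map fun r => G r ((letters w).erase r)).sum ∂wordMeasure
      = ∫ p : ℝ × Word, G p.1 (letters p.2) ∂(volume : Measure ℝ).prod wordMeasure := by
  have := integral_sum_antidiagonal (H := fun M N => if M.card = 1 then G M.sum N else 0)
    (stronglyMeasurable_ite_card hm) (integrable_ite_card_and_integral_eq hm hi).1
  rw [(integrable_ite_card_and_integral_eq hm hi).2] at this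
  simpa only [sum_antidiagonal_ite_card_fst_eq_one _ fun M N => G M.sum N,
    Multiset.sum_singleton] using this

end Mecke

theorem integrable_and_integral_sum_erase_Ioo {E : Type*} [NormedAddCommGroup E] [NormedSpace ℝ E]
    [CompleteSpace E] {s t : ℝ} {G : ℝ → Multiset ℝ → E}
    (hm : StronglyMeasurable fun p : ℝ × Word => G p.1 (letters p.2))
    (hi : Integrable (fun p : ℝ × Word => G p.1 (letters p.2))
      ((volume.restrict (Set.Ioo s t)).prod wordMeasure)) :
    Integrable (fun w : Word => ((letters w).map fun r =>
      if s < r ∧ r < t then G r ((letters w).erase r) else 0).sum) wordMeasure ∧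
    ∫ w : Word, ((letters w).map fun r =>
      if s < r ∧ r < t then G r ((letters w).erase r) else 0).sum ∂wordMeasure
      = ∫ r in Set.Ioo s t, ∫ w, G r (letters w) ∂wordMeasure := by
  have hmG : StronglyMeasurable fun p : ℝ × Word => if s < p.1 ∧ p.1 < t then
      G p.1 (letters p.2) else 0 := by
    refine StronglyMeasurable.ite ?_ hm stronglyMeasurable_const
    exact (measurableSet_lt measurable_const measurable_fst).inter
      (measurableSet_lt measurable_fst measurable_const)
  have hS : MeasurableSet (Set.Ioo s t ×ˢ (Set.univ : Set Word)) :=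
    measurableSet_Ioo.prod MeasurableSet.univ
  have hind : (fun p : ℝ × Word => if s < p.1 ∧ p.1 < t then G p.1 (letters p.2) else 0)
      = Set.indicator (Set.Ioo s t ×ˢ (Set.univ : Set Word)) fun p => G p.1 (letters p.2) := by
    funext p
    simp [Set.indicator_apply]
  have hprod : ((volume : Measure ℝ).prod wordMeasure).restrict (Set.Ioo s t ×ˢ Set.univ)
      = (volume.restrict (Set.Ioo s t)).prod wordMeasure := by
    rw [← Measure.prod_restrict, Measure.restrict_univ]
  have hiG : Integrable (fun p : ℝ × Word => if s < p.1 ∧ p.1 < t then G p.1 (letters p.2) else 0)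
      ((volume : Measure ℝ).prod wordMeasure) := by
    rw [hind, integrable_indicator_iff hS, IntegrableOn, hprod]
    exact hi
  refine ⟨integrable_sum_erase (G := fun r M => if s < r ∧ r < t then G r M else 0) hmG hiG, ?_⟩
  rw [integral_sum_erase (G := fun r M => if s < r ∧ r < t then G r M else 0) hmG hiG, hind,
    integral_indicator hS, hprod, integral_prod _ hi]

/-! ### The one-parameter group generated by the drift. -/

section Flow

variable {𝔨 : Type*} [NormedAddCommGroup 𝔨] [InnerProductSpace ℂ 𝔨]

/-- The one-parameter group `u ↦ e^{uB}`. -/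
def flow (B : 𝔨 →L[ℂ] 𝔨) (u : ℝ) : 𝔨 →L[ℂ] 𝔨 := NormedSpace.exp ((u : ℂ) • B)

@[simp] theorem flow_zero (B : 𝔨 →L[ℂ] 𝔨) : flow B 0 = 1 := by simp [flow]

variable [CompleteSpace 𝔨]

theorem hasDerivAt_flow (B : 𝔨 →L[ℂ] 𝔨) (u : ℝ) : HasDerivAt (flow B) (B * flow B u) u := by
  have h := hasDerivAt_exp_smul_const' (𝕂 := ℝ) B u
  have h1 : flow B = fun u : ℝ => NormedSpace.exp (u • B) := by
    funext v
    rw [flow, Complex.coe_smul]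
  rw [h1]
  exact h

theorem continuous_flow (B : 𝔨 →L[ℂ] 𝔨) : Continuous (flow B) :=
  continuous_iff_continuousAt.2 fun u => (hasDerivAt_flow B u).continuousAt

theorem star_flow (B : 𝔨 →L[ℂ] 𝔨) (u : ℝ) : star (flow B u) = flow (star B) u := by
  rw [flow, flow, NormedSpace.star_exp, star_smul]
  simp

theorem norm_flow_le (B : 𝔨 →L[ℂ] 𝔨) {u : ℝ} (hu : 0 ≤ u) :
    ‖flow B u‖ ≤ Real.exp (‖B‖ * u) := by
  have hs : Summable fun n : ℕ => (‖B‖ * u) ^ n / n.factorial :=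
    Real.summable_pow_div_factorial _
  rw [flow, NormedSpace.exp_eq_tsum ℂ, Real.exp_eq_exp_ℝ, NormedSpace.exp_eq_tsum_div]
  refine tsum_of_norm_bounded hs.hasSum fun n => ?_
  rw [norm_smul, norm_inv, div_eq_inv_mul]
  simp only [RCLike.norm_natCast]
  refine mul_le_mul_of_nonneg_left ?_ (by positivity)
  -- The zeroth term is separate because `‖1‖ = 1` fails when `𝔨` is trivial; only `‖1‖ ≤ 1` is
  -- available.
  rcases n with _ | n
  · rw [pow_zero, pow_zero]
    exact ContinuousLinearMap.norm_id_le
  · refine (norm_pow_le' _ n.succ_pos).trans ?_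
    rw [norm_smul, Complex.norm_real, Real.norm_of_nonneg hu, mul_comm]

end Flow

/-! ### Time ordered products of marked points. -/

section ChainKernel

variable {𝔨 : Type*} [NormedAddCommGroup 𝔨] [InnerProductSpace ℂ 𝔨]

/-- Comparison by time is antisymmetric on a list with distinct times, so the sorted list depends
only on the multiset. This makes the time ordered product a function of the multiset. -/
theorem insertionSort_eq_of_perm [DecidableRel fun x y : ℝ × (𝔨 →L[ℂ] 𝔨) => x.1 ≤ y.1]
    {l l' : List (ℝ × (𝔨 →L[ℂ] 𝔨))} (h : l.Perm l') (hl : (l.map Prod.fst).Nodup) :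
    l.insertionSort (fun x y => x.1 ≤ y.1) = l'.insertionSort (fun x y => x.1 ≤ y.1) := by
  have : IsTrans (ℝ × (𝔨 →L[ℂ] 𝔨)) fun x y => x.1 ≤ y.1 := ⟨fun _ _ _ h1 h2 => le_trans h1 h2⟩
  have : Std.Total fun x y : ℝ × (𝔨 →L[ℂ] 𝔨) => x.1 ≤ y.1 := ⟨fun x y => le_total x.1 y.1⟩
  refine List.Perm.eq_of_pairwise (le := fun x y : ℝ × (𝔨 →L[ℂ] 𝔨) => x.1 ≤ y.1) ?_
    (List.pairwise_insertionSort _ _) (List.pairwise_insertionSort _ _)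
    ((List.perm_insertionSort _ _).trans (h.trans (List.perm_insertionSort _ _).symm))
  intro a b ha hb h1 h2
  rw [List.mem_insertionSort] at ha hb
  exact List.inj_on_of_nodup_map hl ha (h.mem_iff.2 hb) (le_antisymm h1 h2)

open Classical in
/-- The time ordered product of a multiset of marked points, as a function of the multiset. -/
def chainKernel (B : 𝔨 →L[ℂ] 𝔨) (t s : ℝ) (M : Multiset (ℝ × (𝔨 →L[ℂ] 𝔨))) : 𝔨 →L[ℂ] 𝔨 :=
  if (M.map Prod.fst).Nodup ∧ ∀ x ∈ M, s < x.1 ∧ x.1 < t then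
    chainProduct B t s (M.toList.insertionSort fun x y => x.1 ≤ y.1)
  else 0

open Classical in
theorem chainKernel_coe (B : 𝔨 →L[ℂ] 𝔨) (t s : ℝ) (l : List (ℝ × (𝔨 →L[ℂ] 𝔨))) :
    chainKernel B t s l = if (l.map Prod.fst).Nodup ∧ ∀ x ∈ l, s < x.1 ∧ x.1 < t then
      chainProduct B t s (l.insertionSort fun x y => x.1 ≤ y.1) else 0 := by
  have hc : (((l : Multiset (ℝ × (𝔨 →L[ℂ] 𝔨))).map Prod.fst).Nodup
      ∧ ∀ x ∈ (l : Multiset (ℝ × (𝔨 →L[ℂ] 𝔨))), s < x.1 ∧ x.1 < t)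
      ↔ ((l.map Prod.fst).Nodup ∧ ∀ x ∈ l, s < x.1 ∧ x.1 < t) := by
    simp
  rw [chainKernel]
  by_cases h : (l.map Prod.fst).Nodup ∧ ∀ x ∈ l, s < x.1 ∧ x.1 < t
  · rw [if_pos (hc.2 h), if_pos h]
    congr 1
    refine (insertionSort_eq_of_perm ?_ h.1).symm
    exact (Multiset.coe_eq_coe.1 (Multiset.coe_toList _)).symm
  · rw [if_neg (fun h' => h (hc.1 h')), if_neg h]

theorem chainKernel_zero (B : 𝔨 →L[ℂ] 𝔨) (t s : ℝ) : chainKernel B t s 0 = flow B (t - s) := by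
  have := chainKernel_coe B t s []
  simpa [chainProduct, flow] using this

theorem chainKernel_eq_zero_of_mem (B : 𝔨 →L[ℂ] 𝔨) {t s : ℝ} {M : Multiset (ℝ × (𝔨 →L[ℂ] 𝔨))}
    {x : ℝ × (𝔨 →L[ℂ] 𝔨)} (hx : x ∈ M) (h : ¬ (s < x.1 ∧ x.1 < t)) : chainKernel B t s M = 0 :=
  if_neg fun h' => h (h'.2 x hx)

theorem chainKernel_cons_eq_zero (B : 𝔨 →L[ℂ] 𝔨) {t s : ℝ} {M : Multiset (ℝ × (𝔨 →L[ℂ] 𝔨))}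
    {x y : ℝ × (𝔨 →L[ℂ] 𝔨)} (hy : y ∈ M) (h : y.1 = x.1) : chainKernel B t s (x ::ₘ M) = 0 := by
  refine if_neg fun h' => ?_
  rw [Multiset.map_cons, Multiset.nodup_cons] at h'
  exact h'.1.1 (Multiset.mem_map.2 ⟨y, hy, h⟩)

theorem chainProduct_append (B : 𝔨 →L[ℂ] 𝔨) (t s r : ℝ) (C : 𝔨 →L[ℂ] 𝔨)
    (l : List (ℝ × (𝔨 →L[ℂ] 𝔨))) :
    chainProduct B t s (l ++ [(r, C)]) = flow B (t - r) * C * chainProduct B r s l := by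
  induction l generalizing s with
  | nil => simp [chainProduct, flow]
  | cons x l ih =>
    obtain ⟨r', C'⟩ := x
    simp only [List.cons_append, chainProduct, ih, mul_assoc]

theorem chainKernel_coe_of_pairwise (B : 𝔨 →L[ℂ] 𝔨) {t s : ℝ} {l : List (ℝ × (𝔨 →L[ℂ] 𝔨))}
    (hl : l.Pairwise fun x y => x.1 < y.1) (h : ∀ x ∈ l, s < x.1 ∧ x.1 < t) :
    chainKernel B t s l = chainProduct B t s l := by
  have hn : (l.map Prod.fst).Nodup := by
    rw [List.Nodup, List.pairwise_map]
    exact hl.imp fun h => h.ne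
  rw [chainKernel_coe, if_pos ⟨hn, h⟩, List.Pairwise.insertionSort_eq (hl.imp fun h => h.le)]

/-- A multiset of points with different times is the multiset of an increasing list. -/
theorem exists_pairwise_lt (M : Multiset (ℝ × (𝔨 →L[ℂ] 𝔨))) (hM : (M.map Prod.fst).Nodup) :
    ∃ l : List (ℝ × (𝔨 →L[ℂ] 𝔨)), M = l ∧ l.Pairwise fun x y => x.1 < y.1 := by
  classical
  have : IsTrans (ℝ × (𝔨 →L[ℂ] 𝔨)) fun x y => x.1 ≤ y.1 := ⟨fun _ _ _ h1 h2 => le_trans h1 h2⟩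
  have : Std.Total fun x y : ℝ × (𝔨 →L[ℂ] 𝔨) => x.1 ≤ y.1 := ⟨fun x y => le_total x.1 y.1⟩
  have hMl : M = (M.toList.insertionSort fun x y => x.1 ≤ y.1 : List (ℝ × (𝔨 →L[ℂ] 𝔨))) := by
    conv_lhs => rw [← Multiset.coe_toList M]
    exact Multiset.coe_eq_coe.2 (List.perm_insertionSort _ _).symm
  refine ⟨_, hMl, ?_⟩
  have h1 := List.pairwise_insertionSort (fun x y : ℝ × (𝔨 →L[ℂ] 𝔨) => x.1 ≤ y.1) M.toList
  rw [hMl, Multiset.map_coe, Multiset.coe_nodup, List.Nodup, List.pairwise_map] at hM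
  exact h1.imp₂ (fun _ _ h h' => lt_of_le_of_ne h h') hM

/-- The kernel factorizes at the last point. -/
theorem chainKernel_cons_of_lt (B : 𝔨 →L[ℂ] 𝔨) {t s r : ℝ} {C : 𝔨 →L[ℂ] 𝔨}
    {M : Multiset (ℝ × (𝔨 →L[ℂ] 𝔨))} (h1 : s < r) (h2 : r < t) (hM : ∀ x ∈ M, x.1 < r) :
    chainKernel B t s ((r, C) ::ₘ M) = flow B (t - r) * C * chainKernel B r s M := by
  by_cases hn : (M.map Prod.fst).Nodup ∧ ∀ x ∈ M, s < x.1
  · obtain ⟨l, rfl, hl⟩ := exists_pairwise_lt M hn.1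
    have hM' : ∀ x ∈ l, x.1 < r := fun x hx => hM x (Multiset.mem_coe.2 hx)
    have hs' : ∀ x ∈ l, s < x.1 := fun x hx => hn.2 x (Multiset.mem_coe.2 hx)
    have hp : (l ++ [(r, C)]).Pairwise fun x y => x.1 < y.1 := by
      rw [List.pairwise_append]
      refine ⟨hl, List.pairwise_singleton _ _, fun x hx y hy => ?_⟩
      rw [List.mem_singleton.1 hy]
      exact hM' x hx
    have he : ((r, C) ::ₘ (l : Multiset (ℝ × (𝔨 →L[ℂ] 𝔨))))
        = ((l ++ [(r, C)] : List (ℝ × (𝔨 →L[ℂ] 𝔨))) : Multiset _) := by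
      rw [Multiset.cons_coe]
      exact Multiset.coe_eq_coe.2 (List.perm_append_singleton _ _).symm
    rw [he, chainKernel_coe_of_pairwise B hp, chainKernel_coe_of_pairwise B hl,
      chainProduct_append]
    · exact fun x hx => ⟨hs' x hx, hM' x hx⟩
    · intro x hx
      rcases List.mem_append.1 hx with hx | hx
      · exact ⟨hs' x hx, (hM' x hx).trans h2⟩
      · rw [List.mem_singleton.1 hx]; exact ⟨h1, h2⟩
  · rw [chainKernel, chainKernel, if_neg, if_neg, mul_zero]
    · exact fun h => hn ⟨h.1, fun x hx => (h.2 x hx).1⟩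
    · intro h
      rw [Multiset.map_cons, Multiset.nodup_cons] at h
      exact hn ⟨h.1.2, fun x hx => (h.2 x (Multiset.mem_cons_of_mem hx)).1⟩

theorem exists_cons_max (M : Multiset (ℝ × (𝔨 →L[ℂ] 𝔨))) (hM : M ≠ 0) :
    ∃ x N, M = x ::ₘ N ∧ ∀ y ∈ N, y.1 ≤ x.1 := by
  induction M using Multiset.induction_on with
  | empty => exact absurd rfl hM
  | cons a M ih =>
    by_cases h0 : M = 0
    · exact ⟨a, M, rfl, by simp [h0]⟩
    · obtain ⟨x, N, rfl, hx⟩ := ih h0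
      rcases le_total x.1 a.1 with h | h
      · refine ⟨a, x ::ₘ N, rfl, fun y hy => ?_⟩
        rcases Multiset.mem_cons.1 hy with rfl | hy
        · exact h
        · exact (hx y hy).trans h
      · refine ⟨x, a ::ₘ N, Multiset.cons_swap _ _ _, fun y hy => ?_⟩
        rcases Multiset.mem_cons.1 hy with rfl | hy
        · exact h
        · exact hx y hy

open Classical in
/-- The recursion for the kernel. -/
theorem chainKernel_rec (B : 𝔨 →L[ℂ] 𝔨) (t s : ℝ) (M : Multiset (ℝ × (𝔨 →L[ℂ] 𝔨))) :
    chainKernel B t s M = (if M = 0 then flow B (t - s) else 0)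
      + (M.map fun x => if s < x.1 ∧ x.1 < t then
          flow B (t - x.1) * x.2 * chainKernel B x.1 s (M.erase x) else 0).sum := by
  by_cases h0 : M = 0
  · subst h0
    simp [chainKernel_zero]
  obtain ⟨x, N, rfl, hx⟩ := exists_cons_max M h0
  rw [if_neg h0, zero_add, Multiset.map_cons, Multiset.sum_cons, Multiset.erase_cons_head]
  -- Only a last point `x` can contribute: for any other choice `y` the point `x` stays in the
  -- remaining multiset, its time is not before `y.1`, and the kernel up to time `y.1` vanishes.
  have hz : (N.map fun y => if s < y.1 ∧ y.1 < t then
      flow B (t - y.1) * y.2 * chainKernel B y.1 s ((x ::ₘ N).erase y) else 0).sum = 0 := by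
    refine Multiset.sum_eq_zero fun z hz => ?_
    obtain ⟨y, hy, rfl⟩ := Multiset.mem_map.1 hz
    rw [chainKernel_eq_zero_of_mem B (x := x), mul_zero, ite_self]
    · by_cases hxy : x = y
      · subst hxy; rwa [Multiset.erase_cons_head]
      · exact (Multiset.mem_erase_of_ne hxy).2 (Multiset.mem_cons_self x N)
    · exact fun h => absurd h.2 (not_lt.2 (hx y hy))
  rw [hz, add_zero]
  by_cases hst : s < x.1 ∧ x.1 < t
  · rw [if_pos hst]
    -- If the last time is attained twice, both sides vanish: on the left the times are not
    -- distinct, on the right a remaining point sits at the end of the open interval.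
    by_cases hd : ∃ y ∈ N, y.1 = x.1
    · obtain ⟨y, hy, hyx⟩ := hd
      rw [chainKernel_cons_eq_zero B hy hyx, chainKernel_eq_zero_of_mem B hy (by simp [hyx]),
        mul_zero]
    · refine chainKernel_cons_of_lt B hst.1 hst.2 fun y hy => lt_of_le_of_ne (hx y hy) fun h => ?_
      exact hd ⟨y, hy, h⟩
  · rw [if_neg hst, chainKernel_eq_zero_of_mem B (Multiset.mem_cons_self x N) hst]

variable [CompleteSpace 𝔨]

/-- The last point is peeled off repeatedly; the exponential factors over consecutive intervals
multiply to `e^{‖B‖(t-s)}`, and every mark costs a factor `c`. -/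
theorem norm_chainKernel_le (B : 𝔨 →L[ℂ] 𝔨) {t s c R : ℝ} (hc : 0 ≤ c) (hst : s ≤ t)
    (hs : |s| ≤ R) (ht : |t| ≤ R) (M : Multiset (ℝ × (𝔨 →L[ℂ] 𝔨))) (hM : ∀ x ∈ M, ‖x.2‖ ≤ c) :
    ‖chainKernel B t s M‖ ≤ Real.exp (‖B‖ * (t - s)) * env c R (M.map Prod.fst) := by
  induction h : M.card generalizing M t with
  | zero =>
    rw [Multiset.card_eq_zero] at h
    subst h
    simpa [chainKernel_zero] using norm_flow_le B (sub_nonneg.2 hst)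
  | succ n ih =>
    have hpos : 0 ≤ Real.exp (‖B‖ * (t - s)) * env c R (M.map Prod.fst) :=
      mul_nonneg (Real.exp_nonneg _) (env_nonneg hc _ _)
    have h0 : M ≠ 0 := by rintro rfl; simp at h
    obtain ⟨x, N, rfl, hx⟩ := exists_cons_max M h0
    by_cases hst' : s < x.1 ∧ x.1 < t
    · by_cases hd : ∃ y ∈ N, y.1 = x.1
      · obtain ⟨y, hy, hyx⟩ := hd
        rw [chainKernel_cons_eq_zero B hy hyx, norm_zero]
        exact hpos
      · have hlt : ∀ y ∈ N, y.1 < x.1 :=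
          fun y hy => lt_of_le_of_ne (hx y hy) fun h => hd ⟨y, hy, h⟩
        have hxR : |x.1| ≤ R := by
          rw [abs_le] at hs ht ⊢
          constructor <;> linarith [hst'.1, hst'.2]
        have hN := ih hst'.1.le hxR N (fun y hy => hM y (Multiset.mem_cons_of_mem hy))
          (by simpa using h)
        rw [show x = (x.1, x.2) from rfl, chainKernel_cons_of_lt B hst'.1 hst'.2 hlt,
          Multiset.map_cons, env_cons, if_pos hxR]
        have h1 := norm_flow_le B (sub_nonneg.2 hst'.2.le)
        have h2 := hM x (Multiset.mem_cons_self x N)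
        calc ‖flow B (t - x.1) * x.2 * chainKernel B x.1 s N‖
            ≤ ‖flow B (t - x.1)‖ * ‖x.2‖ * ‖chainKernel B x.1 s N‖ :=
              (norm_mul_le _ _).trans (mul_le_mul_of_nonneg_right (norm_mul_le _ _)
                (norm_nonneg _))
          _ ≤ Real.exp (‖B‖ * (t - x.1)) * c
              * (Real.exp (‖B‖ * (x.1 - s)) * env c R (N.map Prod.fst)) := by
              gcongr
          _ = Real.exp (‖B‖ * (t - x.1)) * Real.exp (‖B‖ * (x.1 - s))
              * (c * env c R (N.map Prod.fst)) := by ring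
          _ = _ := by rw [← Real.exp_add]; congr 2; ring
    · rw [chainKernel_eq_zero_of_mem B (Multiset.mem_cons_self x N) hst', norm_zero]
      exact hpos

/-- Induction on the number of points through `chainKernel_rec`. Measurability must be joint in the
end time and the points, because the recursion puts a point in the place of the end time. -/
theorem stronglyMeasurable_chainKernel {ι : Type*} [Finite ι] (B : 𝔨 →L[ℂ] 𝔨) (s : ℝ)
    (C : ι → 𝔨 →L[ℂ] 𝔨) (S : Finset ι) :
    StronglyMeasurable fun p : ℝ × (ι → ℝ) =>
      chainKernel B p.1 s (S.val.map fun i => (p.2 i, C i)) := by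
  classical
  induction h : S.card generalizing S with
  | zero =>
    rw [Finset.card_eq_zero] at h
    subst h
    simp only [Finset.empty_val, Multiset.map_zero, chainKernel_zero]
    exact (continuous_flow B).comp_stronglyMeasurable
      (measurable_fst.sub_const s).stronglyMeasurable
  | succ n ih =>
    have hS : S ≠ ∅ := by rintro rfl; simp at h
    have he : (fun p : ℝ × (ι → ℝ) => chainKernel B p.1 s (S.val.map fun i => (p.2 i, C i)))
        = fun p => ∑ i ∈ S, if s < p.2 i ∧ p.2 i < p.1 then flow B (p.1 - p.2 i) * C i *
          chainKernel B (p.2 i) s ((S.erase i).val.map fun i => (p.2 i, C i)) else 0 := by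
      funext p
      rw [chainKernel_rec, if_neg (by simpa using hS), zero_add, Multiset.map_map]
      refine congrArg Multiset.sum (Multiset.map_congr rfl fun i hi => ?_)
      simp only [Function.comp_def]
      rw [← Multiset.map_erase_of_mem _ _ hi, Finset.erase_val]
    rw [he]
    refine Finset.stronglyMeasurable_fun_sum _ fun i hi => ?_
    have hmi : Measurable fun p : ℝ × (ι → ℝ) => p.2 i := (measurable_pi_apply i).comp measurable_snd
    refine StronglyMeasurable.ite ?_ ?_ stronglyMeasurable_const
    · exact (measurableSet_lt measurable_const hmi).inter (measurableSet_lt hmi measurable_fst)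
    · refine StronglyMeasurable.mul (StronglyMeasurable.mul ?_ stronglyMeasurable_const) ?_
      · exact (continuous_flow B).comp_stronglyMeasurable
          (measurable_fst.sub hmi).stronglyMeasurable
      · have := ih (S.erase i) (by rw [Finset.card_erase_of_mem hi, h]; rfl)
        exact this.comp_measurable (hmi.prodMk measurable_snd)

theorem integral_flow (B D : 𝔨 →L[ℂ] 𝔨) (x t : ℝ) :
    ∫ q in x..t, B * flow B (q - x) * D = flow B (t - x) * D - D := by
  have hd : ∀ q ∈ Set.uIcc x t, HasDerivAt (fun q => flow B (q - x) * D)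
      (B * flow B (q - x) * D) q := fun q _ => by
    have := (hasDerivAt_flow B (q - x)).comp_sub_const q x
    exact this.mul_const D
  rw [intervalIntegral.integral_eq_sub_of_hasDerivAt hd]
  · simp
  · refine Continuous.intervalIntegrable ?_ _ _
    exact (continuous_const.mul ((continuous_flow B).comp (continuous_id.sub continuous_const))).mul
      continuous_const

/-- The integrand is zero up to time `x` and the derivative of `e^{(q-x)B} D` afterwards. This
handles the contribution of one candidate last point in `chainKernel_integral_eq`. -/
theorem intervalIntegrable_ite_flow_and_integral_eq (B D : 𝔨 →L[ℂ] 𝔨) {s t : ℝ} (hst : s ≤ t)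
    (x : ℝ) :
    IntervalIntegrable (fun q => if s < x ∧ x < q then B * flow B (q - x) * D else 0) volume s t ∧
    ∫ q in s..t, (if s < x ∧ x < q then B * flow B (q - x) * D else 0)
      = if s < x ∧ x < t then flow B (t - x) * D - D else 0 := by
  have hcont : Continuous fun q => B * flow B (q - x) * D :=
    (continuous_const.mul ((continuous_flow B).comp (continuous_id.sub continuous_const))).mul
      continuous_const
  by_cases h : s < x ∧ x < t
  · have h1 : Set.EqOn (fun _ => (0 : 𝔨 →L[ℂ] 𝔨))
        (fun q => if s < x ∧ x < q then B * flow B (q - x) * D else 0) (Set.uIoc s x) := by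
      intro q hq
      rw [Set.uIoc_of_le h.1.le] at hq
      simp only
      rw [if_neg fun h' => absurd h'.2 (not_lt.2 hq.2)]
    have h2 : Set.EqOn (fun q => B * flow B (q - x) * D)
        (fun q => if s < x ∧ x < q then B * flow B (q - x) * D else 0) (Set.uIoc x t) := by
      intro q hq
      rw [Set.uIoc_of_le h.2.le] at hq
      simp only
      rw [if_pos ⟨h.1, hq.1⟩]
    have i1 := (intervalIntegrable_const (μ := volume) (a := s) (b := x)
      (c := (0 : 𝔨 →L[ℂ] 𝔨))).congr h1
    have i2 := (hcont.intervalIntegrable (μ := volume) x t).congr h2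
    refine ⟨i1.trans i2, ?_⟩
    rw [if_pos h, ← intervalIntegral.integral_add_adjacent_intervals i1 i2, ← integral_flow,
      intervalIntegral.integral_congr_ae (g := fun _ => 0) (ae_of_all _ fun q hq => (h1 hq).symm),
      intervalIntegral.integral_congr_ae (g := fun q => B * flow B (q - x) * D)
        (ae_of_all _ fun q hq => (h2 hq).symm)]
    simp
  · have h1 : Set.EqOn (fun _ => (0 : 𝔨 →L[ℂ] 𝔨))
        (fun q => if s < x ∧ x < q then B * flow B (q - x) * D else 0) (Set.uIoc s t) := by
      intro q hq
      rw [Set.uIoc_of_le hst] at hq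
      simp only
      rw [if_neg fun h' => h ⟨h'.1, h'.2.trans_le hq.2⟩]
    refine ⟨(intervalIntegrable_const (μ := volume) (c := (0 : 𝔨 →L[ℂ] 𝔨))).congr h1, ?_⟩
    rw [if_neg h, intervalIntegral.integral_congr_ae (g := fun _ => 0)
      (ae_of_all _ fun q hq => (h1 hq).symm)]
    simp

open Classical in
/-- The integrated form of the recursion for the kernel. -/
theorem chainKernel_integral_eq (B : 𝔨 →L[ℂ] 𝔨) {t s : ℝ} (hst : s ≤ t)
    (M : Multiset (ℝ × (𝔨 →L[ℂ] 𝔨))) :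
    chainKernel B t s M = (if M = 0 then 1 else 0)
      + (M.map fun x => if s < x.1 ∧ x.1 < t then x.2 * chainKernel B x.1 s (M.erase x) else 0).sum
      + ∫ q in s..t, B * chainKernel B q s M := by
  have key : ∀ (N : Multiset (ℝ × (𝔨 →L[ℂ] 𝔨))) (D : ℝ × (𝔨 →L[ℂ] 𝔨) → 𝔨 →L[ℂ] 𝔨),
      IntervalIntegrable (fun q => (N.map fun x => if s < x.1 ∧ x.1 < q then
        B * flow B (q - x.1) * D x else 0).sum) volume s t ∧
      ∫ q in s..t, (N.map fun x => if s < x.1 ∧ x.1 < q then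
        B * flow B (q - x.1) * D x else 0).sum
      = (N.map fun x => if s < x.1 ∧ x.1 < t then flow B (t - x.1) * D x - D x else 0).sum := by
    intro N D
    induction N using Multiset.induction_on with
    | empty => simp
    | cons x N ih =>
      obtain ⟨h1, h2⟩ := intervalIntegrable_ite_flow_and_integral_eq B (D x) hst x.1
      simp only [Multiset.map_cons, Multiset.sum_cons]
      exact ⟨h1.add ih.1, by rw [intervalIntegral.integral_add h1 ih.1, h2, ih.2]⟩
  -- After the recursion is inserted, `q` enters only through the cutoff `x.1 < q` and the factor
  -- `e^{(q-x.1)B}` (or `e^{(q-s)B}` if there are no points), so the integral is elementary and no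
  -- derivative of the kernel itself is needed.
  have hrec : ∀ q, B * chainKernel B q s M = (if M = 0 then B * flow B (q - s) * 1 else 0)
      + (M.map fun x => if s < x.1 ∧ x.1 < q then
        B * flow B (q - x.1) * (x.2 * chainKernel B x.1 s (M.erase x)) else 0).sum := fun q => by
    rw [chainKernel_rec, mul_add, mul_ite, mul_zero, mul_one, ← Multiset.sum_map_mul_left]
    congr 3
    funext x
    rw [mul_ite, mul_zero]
    simp only [mul_assoc]
  obtain ⟨k1, k2⟩ := key M fun x => x.2 * chainKernel B x.1 s (M.erase x)
  have hi : IntervalIntegrable (fun q => if M = 0 then B * flow B (q - s) * 1 else 0)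
      volume s t := by
    split_ifs
    · refine Continuous.intervalIntegrable ?_ _ _
      exact (continuous_const.mul ((continuous_flow B).comp
        (continuous_id.sub continuous_const))).mul continuous_const
    · exact intervalIntegrable_const
  have h0 : ∫ q in s..t, (if M = 0 then B * flow B (q - s) * 1 else 0)
      = if M = 0 then flow B (t - s) - 1 else 0 := by
    split_ifs
    · rw [integral_flow]; simp
    · simp
  simp only [hrec]
  rw [intervalIntegral.integral_add hi k1, h0, k2, chainKernel_rec, add_add_add_comm]
  congr 1
  · split_ifs <;> simp
  · rw [← Multiset.sum_map_add]
    congr 2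
    funext x
    split_ifs
    · rw [mul_assoc, add_sub_cancel]
    · simp

/-- Taking adjoints reverses the order of the factors; reflecting the times makes the reversed list
increasing again. -/
theorem star_chainProduct (B : 𝔨 →L[ℂ] 𝔨) (t s : ℝ) (l : List (ℝ × (𝔨 →L[ℂ] 𝔨))) :
    star (chainProduct B t s l)
      = chainProduct (star B) (-s) (-t) (l.map fun x => (-x.1, star x.2)).reverse := by
  induction l generalizing s with
  | nil =>
    have := star_flow B (t - s)
    simp only [flow] at this
    simp only [chainProduct, List.map_nil, List.reverse_nil, this]
    congr 3
    ring
  | cons x l ih =>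
    obtain ⟨r, C⟩ := x
    rw [List.map_cons, List.reverse_cons, chainProduct_append, chainProduct, star_mul, star_mul,
      ih, mul_assoc]
    have := star_flow B (r - s)
    rw [flow] at this
    rw [this]
    congr 2
    ring

/-- The adjoint of the kernel is the kernel of the reflected points with the adjoint marks. -/
theorem star_chainKernel (B : 𝔨 →L[ℂ] 𝔨) (t s : ℝ) (M : Multiset (ℝ × (𝔨 →L[ℂ] 𝔨))) :
    star (chainKernel B t s M)
      = chainKernel (star B) (-s) (-t) (M.map fun x => (-x.1, star x.2)) := by
  by_cases h : (M.map Prod.fst).Nodup ∧ ∀ x ∈ M, s < x.1 ∧ x.1 < t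
  · obtain ⟨l, rfl, hl⟩ := exists_pairwise_lt M h.1
    rw [chainKernel_coe_of_pairwise B hl fun x hx => h.2 x (Multiset.mem_coe.2 hx),
      star_chainProduct, Multiset.map_coe, ← Multiset.coe_reverse, chainKernel_coe_of_pairwise]
    · rw [List.pairwise_reverse, List.pairwise_map]
      exact hl.imp fun h => neg_lt_neg h
    · intro x hx
      rw [List.mem_reverse, List.mem_map] at hx
      obtain ⟨y, hy, rfl⟩ := hx
      have := h.2 y (Multiset.mem_coe.2 hy)
      exact ⟨neg_lt_neg this.2, neg_lt_neg this.1⟩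
  · rw [chainKernel, if_neg h, star_zero, chainKernel, if_neg]
    refine fun h' => h ⟨?_, fun x hx => ?_⟩
    · have h1 := h'.1
      rw [Multiset.map_map] at h1
      have h2 : ((M.map Prod.fst).map Neg.neg).Nodup := by
        rw [Multiset.map_map]
        exact h1
      exact h2.of_map _
    · have := h'.2 _ (Multiset.mem_map_of_mem _ hx)
      exact ⟨neg_lt_neg_iff.1 this.2, neg_lt_neg_iff.1 this.1⟩

end ChainKernel

theorem norm_sum_map_le {ι E : Type*} [SeminormedAddCommGroup E] (X : Multiset ι) {g : ι → E}
    {h : ι → ℝ} (H : ∀ x ∈ X, ‖g x‖ ≤ h x) : ‖(X.map g).sum‖ ≤ (X.map h).sum := by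
  refine (norm_multiset_sum_le _).trans ?_
  rw [Multiset.map_map]
  exact Multiset.sum_map_le_sum_map _ _ H

/-! ### Functions of exponential type with bounded letters -/

/-- Functions of finite sets of letters that are measurable on words, of exponential type and
supported in sets of letters in `[-R, R]`. -/
structure Dominated {E : Type*} [NormedAddCommGroup E] (f : Multiset ℝ → E) (C q R : ℝ) :
    Prop where
  meas : StronglyMeasurable fun w => f (letters w)
  nonneg : 0 ≤ q
  bound : ∀ M, ‖f M‖ ≤ C * env q R M

namespace Dominated

variable {E : Type*} [NormedAddCommGroup E] {f g : Multiset ℝ → E} {C q R C' q' R' : ℝ}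

theorem const_nonneg (hf : Dominated f C q R) : 0 ≤ C := by
  simpa using (norm_nonneg _).trans (hf.bound 0)

theorem mono (hf : Dominated f C q R) (hC : C ≤ C') (hq : q ≤ q') (hR : R ≤ R') :
    Dominated f C' q' R' where
  meas := hf.meas
  nonneg := hf.nonneg.trans hq
  bound M := (hf.bound M).trans (mul_le_mul hC (env_mono hf.nonneg hq hR M)
    (env_nonneg hf.nonneg _ _) (hf.const_nonneg.trans hC))

/-- The annihilation of a letter `r`: `M ↦ f(M + r)`. -/
theorem cons (hf : Dominated f C q R) (r : ℝ) : Dominated (fun M => f (r ::ₘ M)) (C * q) q R where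
  meas := by
    have := hf.meas.comp_measurable
      (measurable_consWord.comp (measurable_const.prodMk measurable_id : Measurable
        fun w : Word => (r, w)))
    simpa only [Function.comp_def, letters_consWord] using this
  nonneg := hf.nonneg
  bound M := by
    refine (hf.bound _).trans ?_
    rw [env_cons, ← mul_assoc]
    refine mul_le_mul_of_nonneg_right (mul_le_mul_of_nonneg_left ?_ hf.const_nonneg)
      (env_nonneg hf.nonneg _ _)
    split_ifs
    · exact le_rfl
    · exact hf.nonneg

theorem measurable_cons (hf : Dominated f C q R) :
    StronglyMeasurable fun p : ℝ × Word => f (p.1 ::ₘ letters p.2) := by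
  simpa only [Function.comp_def, letters_consWord] using hf.meas.comp_measurable measurable_consWord

end Dominated

theorem stronglyMeasurable_of_comp_mkWord_three {X E : Type*} [MeasurableSpace X]
    [TopologicalSpace E] [TopologicalSpace.PseudoMetrizableSpace E]
    {g : X × Word × Word × Word → E}
    (h : ∀ l m n, StronglyMeasurable fun p : X × (Fin l → ℝ) × (Fin m → ℝ) × (Fin n → ℝ) =>
      g (p.1, mkWord l p.2.1, mkWord m p.2.2.1, mkWord n p.2.2.2)) : StronglyMeasurable g := by
  have h3 : StronglyMeasurable fun p : (X × Word × Word) × Word =>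
      g (p.1.1, p.1.2.1, p.1.2.2, p.2) := by
    refine stronglyMeasurable_of_comp_prod_mkWord fun n => ?_
    have h2 : StronglyMeasurable fun p : (X × Word × (Fin n → ℝ)) × Word =>
        g (p.1.1, p.1.2.1, p.2, mkWord n p.1.2.2) := by
      refine stronglyMeasurable_of_comp_prod_mkWord fun m => ?_
      have h1 : StronglyMeasurable fun p : (X × (Fin m → ℝ) × (Fin n → ℝ)) × Word =>
          g (p.1.1, p.2, mkWord m p.1.2.1, mkWord n p.1.2.2) := by
        refine stronglyMeasurable_of_comp_prod_mkWord fun l => ?_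
        exact (h l m n).comp_measurable (g := fun p : (X × (Fin m → ℝ) × (Fin n → ℝ)) ×
          (Fin l → ℝ) => (p.1.1, p.2, p.1.2.1, p.1.2.2)) (by fun_prop)
      exact h1.comp_measurable (g := fun p : (X × Word × (Fin n → ℝ)) × (Fin m → ℝ) =>
        ((p.1.1, p.2, p.1.2.2), p.1.2.1)) (by fun_prop)
    exact h2.comp_measurable (g := fun p : (X × Word × Word) × (Fin n → ℝ) =>
        ((p.1.1, p.1.2.1, p.2), p.1.2.2)) (by fun_prop)
  exact h3.comp_measurable (g := fun p : X × Word × Word × Word =>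
    ((p.1, p.2.1, p.2.2.1), p.2.2.2)) (by fun_prop)

theorem map_univ_sum {A A' β : Type*} [Fintype A] [Fintype A'] (g : A ⊕ A' → β) :
    (Finset.univ : Finset (A ⊕ A')).val.map g
      = Finset.univ.val.map (fun i => g (Sum.inl i)) + Finset.univ.val.map fun i => g (Sum.inr i) := by
  have : (Finset.univ : Finset (A ⊕ A')).val
      = Finset.univ.val.map Sum.inl + Finset.univ.val.map Sum.inr := rfl
  rw [this, Multiset.map_add, Multiset.map_map, Multiset.map_map]
  rfl

/-- Measurability makes sense only for words, so multiset parameters are replaced by words that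
represent them. -/
theorem letters_surjective : Function.Surjective letters := fun M => by
  refine ⟨mkWord M.toList.length fun i => M.toList.get i, ?_⟩
  rw [letters_eq_ofFn]
  simp [mkWord]

/-! ### The operator with kernel `u^t_s` on functions of multisets, and its exponential bounds. -/

/-- The coefficients of a quantum stochastic differential equation. -/
structure Coeff (𝔨 : Type*) [NormedAddCommGroup 𝔨] [InnerProductSpace ℂ 𝔨] where
  create : 𝔨 →L[ℂ] 𝔨
  number : 𝔨 →L[ℂ] 𝔨
  annih : 𝔨 →L[ℂ] 𝔨
  drift : 𝔨 →L[ℂ] 𝔨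

namespace Coeff

variable {𝔨 : Type*} [NormedAddCommGroup 𝔨] [InnerProductSpace ℂ 𝔨] (a : Coeff 𝔨)

/-- The points of three sets, marked with the coefficients. -/
def marked (σ τ υ : Multiset ℝ) : Multiset (ℝ × (𝔨 →L[ℂ] 𝔨)) :=
  σ.map (fun r => (r, a.create)) + τ.map (fun r => (r, a.number)) + υ.map (fun r => (r, a.annih))

/-- The kernel, as a function of the sets of letters. -/
def ker (t s : ℝ) (σ τ υ : Multiset ℝ) : 𝔨 →L[ℂ] 𝔨 :=
  chainKernel a.drift t s (a.marked σ τ υ)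

theorem kernel_eq_ker (t s : ℝ) (σ τ υ : Word) :
    kernel a.create a.number a.annih a.drift t s σ τ υ
      = a.ker t s (letters σ) (letters τ) (letters υ) := by
  classical
  have hm : a.marked (letters σ) (letters τ) (letters υ)
      = (markedPoints a.create a.number a.annih σ τ υ : Multiset (ℝ × (𝔨 →L[ℂ] 𝔨))) := by
    simp only [marked, markedPoints, letters_eq_ofFn, ← Multiset.coe_add, Multiset.map_coe,
      List.map_ofFn]
    rfl
  rw [ker, hm, chainKernel_coe]
  rfl

/-- The contribution to the evolution from creation on `α`, number on `β`, and no action on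
`γ`. -/
def core (t s : ℝ) (f : Multiset ℝ → 𝔨) (α β γ : Multiset ℝ) : 𝔨 :=
  ∫ υ, a.ker t s α β (letters υ) (f (β + γ + letters υ)) ∂wordMeasure

/-- The contribution to the evolution from creation on `α` and no creation on `δ`. -/
def innerSum (t s : ℝ) (f : Multiset ℝ → 𝔨) (α δ : Multiset ℝ) : 𝔨 :=
  (δ.antidiagonal.map fun q => a.core t s f α q.1 q.2).sum

/-- The operator with the kernel `u^t_s`, on functions of sets of letters. -/
def evolve (t s : ℝ) (f : Multiset ℝ → 𝔨) (X : Multiset ℝ) : 𝔨 :=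
  (X.antidiagonal.map fun p => a.innerSum t s f p.1 p.2).sum

/-- The link between the definition by subsets of positions and the calculus of multisets in which
everything below is done. -/
theorem kernelOp_eq_evolve (t s : ℝ) (f : Multiset ℝ → 𝔨) (ω : Word) :
    kernelOp (kernel a.create a.number a.annih a.drift t s) (fun w => f (letters w)) ω
      = a.evolve t s f (letters ω) := by
  rw [evolve, letters, sum_antidiagonal_map, kernelOp, Finset.powerset_univ]
  refine Finset.sum_congr rfl fun α _ => ?_
  rw [innerSum, sum_antidiagonal_map, Finset.compl_eq_univ_sdiff]
  refine Finset.sum_congr rfl fun β hβ => ?_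
  rw [core]
  simp only [kernel_eq_ker, letters_subword, letters_concat]
  congr 1
  funext υ
  rw [← Multiset.map_add, Finset.sdiff_val _ β,
    add_tsub_cancel_of_le (Finset.val_le_iff.2 (Finset.mem_powerset.1 hβ))]

theorem map_fst_marked (σ τ υ : Multiset ℝ) :
    (a.marked σ τ υ).map Prod.fst = σ + τ + υ := by
  simp [marked, Multiset.map_map]

theorem marked_eq_zero_iff {σ τ υ : Multiset ℝ} :
    a.marked σ τ υ = 0 ↔ (σ = 0 ∧ τ = 0) ∧ υ = 0 := by
  simp [marked]

/-- A bound for the jump coefficients. -/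
def size : ℝ := ‖a.create‖ + ‖a.number‖ + ‖a.annih‖

theorem size_nonneg : 0 ≤ a.size := by unfold size; positivity

theorem norm_marked_le {σ τ υ : Multiset ℝ} {x : ℝ × (𝔨 →L[ℂ] 𝔨)} (hx : x ∈ a.marked σ τ υ) :
    ‖x.2‖ ≤ a.size := by
  have h1 := norm_nonneg a.create
  have h2 := norm_nonneg a.number
  have h3 := norm_nonneg a.annih
  simp only [marked, Multiset.mem_add, Multiset.mem_map] at hx
  unfold size
  rcases hx with (⟨r, _, rfl⟩ | ⟨r, _, rfl⟩) | ⟨r, _, rfl⟩ <;> simp only <;> linarith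

theorem ker_eq_zero_of_mem {t s r : ℝ} {σ τ υ : Multiset ℝ} (hr : r ∈ σ + τ + υ)
    (h : ¬ (s < r ∧ r < t)) : a.ker t s σ τ υ = 0 := by
  rw [← map_fst_marked a, Multiset.mem_map] at hr
  obtain ⟨x, hx, rfl⟩ := hr
  exact chainKernel_eq_zero_of_mem _ hx h

variable [CompleteSpace 𝔨]

theorem norm_ker_le {t s R : ℝ} (hst : s ≤ t) (hs : |s| ≤ R) (ht : |t| ≤ R)
    (σ τ υ : Multiset ℝ) : ‖a.ker t s σ τ υ‖ ≤ Real.exp (‖a.drift‖ * (2 * R))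
      * (env a.size R σ * env a.size R τ * env a.size R υ) := by
  rw [← env_add, ← env_add, ← map_fst_marked a]
  refine (norm_chainKernel_le a.drift a.size_nonneg hst hs ht _ fun x hx =>
    a.norm_marked_le hx).trans (mul_le_mul_of_nonneg_right (Real.exp_le_exp.2
      (mul_le_mul_of_nonneg_left ?_ (norm_nonneg _))) (env_nonneg a.size_nonneg _ _))
  rw [abs_le] at hs ht
  linarith

theorem stronglyMeasurable_ker (s : ℝ) : StronglyMeasurable fun p : ℝ × Word × Word × Word =>
    a.ker p.1 s (letters p.2.1) (letters p.2.2.1) (letters p.2.2.2) := by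
  refine stronglyMeasurable_of_comp_mkWord_three fun l m n => ?_
  have h := stronglyMeasurable_chainKernel a.drift s
    (Sum.elim (fun _ => a.create) (Sum.elim (fun _ => a.number) fun _ => a.annih) :
      Fin l ⊕ Fin m ⊕ Fin n → 𝔨 →L[ℂ] 𝔨) Finset.univ
  have h' := h.comp_measurable (g := fun p : ℝ × (Fin l → ℝ) × (Fin m → ℝ) × (Fin n → ℝ) =>
    (p.1, Sum.elim p.2.1 (Sum.elim p.2.2.1 p.2.2.2))) (by
      refine measurable_fst.prodMk (measurable_pi_iff.2 fun i => ?_)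
      rcases i with i | i | i <;> simp only [Sum.elim_inl, Sum.elim_inr] <;> fun_prop)
  convert h' using 2 with p
  simp only [ker, marked, letters_mkWord, Function.comp_def, map_univ_sum, Sum.elim_inl,
    Sum.elim_inr, Multiset.map_map, add_assoc]

section Core

variable {X : Type*} [MeasurableSpace X] {τ : X → ℝ} {f : X → Multiset ℝ → 𝔨}

theorem stronglyMeasurable_core_integrand (hτ : Measurable τ)
    (hf : StronglyMeasurable fun p : X × Word => f p.1 (letters p.2)) (s : ℝ) :
    StronglyMeasurable fun p : (X × Word × Word × Word) × Word =>
      a.ker (τ p.1.1) s (letters p.1.2.1) (letters p.1.2.2.1) (letters p.2)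
        (f p.1.1 (letters p.1.2.2.1 + letters p.1.2.2.2 + letters p.2)) := by
  have h1 := (a.stronglyMeasurable_ker s).comp_measurable
    (g := fun p : (X × Word × Word × Word) × Word => (τ p.1.1, p.1.2.1, p.1.2.2.1, p.2))
    (by fun_prop)
  have h2 := hf.comp_measurable
    (g := fun p : (X × Word × Word × Word) × Word =>
      (p.1.1, concat (concat p.1.2.2.1 p.1.2.2.2) p.2)) (by
        refine Measurable.prodMk (by fun_prop) (measurable_concat.comp (Measurable.prodMk
          (measurable_concat.comp (Measurable.prodMk ?_ ?_)) ?_)) <;> fun_prop)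
  simp only [Function.comp_def, letters_concat] at h1 h2
  exact isBoundedBilinearMap_apply.continuous.comp_stronglyMeasurable (h1.prodMk h2)

theorem stronglyMeasurable_core (hτ : Measurable τ)
    (hf : StronglyMeasurable fun p : X × Word => f p.1 (letters p.2)) (s : ℝ) :
    StronglyMeasurable fun p : X × Word × Word × Word =>
      a.core (τ p.1) s (f p.1) (letters p.2.1) (letters p.2.2.1) (letters p.2.2.2) :=
  (a.stronglyMeasurable_core_integrand hτ hf s).integral_prod_right'

theorem stronglyMeasurable_innerSum (hτ : Measurable τ)
    (hf : StronglyMeasurable fun p : X × Word => f p.1 (letters p.2)) (s : ℝ) :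
    StronglyMeasurable fun p : X × Word × Word =>
      a.innerSum (τ p.1) s (f p.1) (letters p.2.1) (letters p.2.2) := by
  have hcore := a.stronglyMeasurable_core hτ hf s
  have h0 : StronglyMeasurable fun p : (X × Word) × Word × Word =>
      a.core (τ p.1.1) s (f p.1.1) (letters p.1.2) (letters p.2.1) (letters p.2.2) :=
    hcore.comp_measurable (g := fun p : (X × Word) × Word × Word =>
        (p.1.1, p.1.2, p.2.1, p.2.2)) (by fun_prop)
  have h1 := stronglyMeasurable_sum_antidiagonal_prod
      (H := fun (x : X × Word) M N => a.core (τ x.1) s (f x.1) (letters x.2) M N) h0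
  exact h1.comp_measurable (g := fun p : X × Word × Word => ((p.1, p.2.1), p.2.2)) (by fun_prop)

theorem stronglyMeasurable_evolve (hτ : Measurable τ)
    (hf : StronglyMeasurable fun p : X × Word => f p.1 (letters p.2)) (s : ℝ) :
    StronglyMeasurable fun p : X × Word => a.evolve (τ p.1) s (f p.1) (letters p.2) :=
  stronglyMeasurable_sum_antidiagonal_prod
    (H := fun x M N => a.innerSum (τ x) s (f x) M N) (a.stronglyMeasurable_innerSum hτ hf s)

end Core

section Bound

variable {a} {f : Multiset ℝ → 𝔨} {C q R t s : ℝ} (hf : Dominated f C q R) (hst : s ≤ t)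
  (hs : |s| ≤ R) (ht : |t| ≤ R)
include hf hst hs ht

/-- Letters of `β` and `υ` enter both the kernel and `f` and cost `a.size * q`; those of `α` enter
only the kernel, those of `γ` only `f`. -/
theorem norm_core_integrand_le (α β γ υ : Multiset ℝ) :
    ‖a.ker t s α β υ (f (β + γ + υ))‖ ≤ Real.exp (‖a.drift‖ * (2 * R)) * C
      * (env a.size R α * env (a.size * q) R β * env q R γ) * env (a.size * q) R υ := by
  refine ((a.ker t s α β υ).le_of_opNorm_le_of_le (a.norm_ker_le hst hs ht α β υ)
    (hf.bound _)).trans (le_of_eq ?_)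
  rw [env_add, env_add, ← env_mul, ← env_mul]
  ring

theorem integrable_core_integrand (α β γ : Multiset ℝ) :
    Integrable (fun υ => a.ker t s α β (letters υ) (f (β + γ + letters υ))) wordMeasure := by
  obtain ⟨wα, rfl⟩ := letters_surjective α
  obtain ⟨wβ, rfl⟩ := letters_surjective β
  obtain ⟨wγ, rfl⟩ := letters_surjective γ
  have hm := (a.stronglyMeasurable_core_integrand (X := Unit) (τ := fun _ => t)
    (f := fun _ => f) measurable_const (hf.meas.comp_measurable measurable_snd) s).comp_measurable
    (g := fun υ : Word => (((), wα, wβ, wγ), υ)) (by fun_prop)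
  exact ((integrable_env (mul_nonneg a.size_nonneg hf.nonneg) R).const_mul _).mono'
    hm.aestronglyMeasurable (ae_of_all _ fun υ => norm_core_integrand_le hf hst hs ht _ _ _ _)

end Bound

/-- The constant in the bound for the evolution. -/
def evolveConst (C q R : ℝ) : ℝ :=
  Real.exp (‖a.drift‖ * (2 * R)) * C * ∫ υ, env (a.size * q) R (letters υ) ∂wordMeasure

section Bound

variable {a} {f : Multiset ℝ → 𝔨} {C q R t s : ℝ} (hf : Dominated f C q R) (hst : s ≤ t)
  (hs : |s| ≤ R) (ht : |t| ≤ R)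
include hf hst hs ht

theorem norm_core_le (α β γ : Multiset ℝ) :
    ‖a.core t s f α β γ‖ ≤ a.evolveConst C q R
      * (env a.size R α * (env (a.size * q) R β * env q R γ)) := by
  refine (norm_integral_le_of_norm_le ((integrable_env (mul_nonneg a.size_nonneg hf.nonneg)
    R).const_mul _) (ae_of_all _ fun υ => norm_core_integrand_le hf hst hs ht _ _ _ _)).trans
    (le_of_eq ?_)
  rw [integral_const_mul, evolveConst]
  ring

theorem norm_innerSum_le (α δ : Multiset ℝ) :
    ‖a.innerSum t s f α δ‖ ≤ a.evolveConst C q R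
      * (env a.size R α * env (a.size * q + q) R δ) := by
  refine (norm_sum_map_le δ.antidiagonal fun r _ => norm_core_le hf hst hs ht α r.1 r.2).trans
    (le_of_eq ?_)
  simp only [Multiset.sum_map_mul_left, sum_antidiagonal_env]

/-- The new rate adds up the possible fates of a letter: created (`a.size`), acted on by the number
coefficient (`a.size * q`), or left alone (`q`). The radius is unchanged, so domination is stable
under the evolution. -/
theorem dominated_evolve :
    Dominated (a.evolve t s f) (a.evolveConst C q R) (a.size + (a.size * q + q)) R where
  meas := (a.stronglyMeasurable_evolve (X := Unit) (τ := fun _ => t) (f := fun _ => f)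
    measurable_const (hf.meas.comp_measurable measurable_snd) s).comp_measurable
    (g := fun w : Word => ((), w)) (by fun_prop)
  nonneg := add_nonneg a.size_nonneg (add_nonneg (mul_nonneg a.size_nonneg hf.nonneg) hf.nonneg)
  bound M := by
    refine (norm_sum_map_le M.antidiagonal fun p _ =>
      norm_innerSum_le hf hst hs ht p.1 p.2).trans (le_of_eq ?_)
    simp only [Multiset.sum_map_mul_left, sum_antidiagonal_env]

end Bound

end Coeff

/-! ### The integral equation for the evolution. -/

theorem integrable_and_integral_sum_map {ι Ω E : Type*} [MeasurableSpace Ω] {μ : Measure Ω}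
    [NormedAddCommGroup E] [NormedSpace ℝ E] (X : Multiset ι) {g : ι → Ω → E}
    (h : ∀ x ∈ X, Integrable (g x) μ) :
    Integrable (fun w => (X.map fun x => g x w).sum) μ ∧
      ∫ w, (X.map fun x => g x w).sum ∂μ = (X.map fun x => ∫ w, g x w ∂μ).sum := by
  induction X using Multiset.induction_on with
  | empty => simp
  | cons a X ih =>
    obtain ⟨h1, h2⟩ := ih fun x hx => h x (Multiset.mem_cons_of_mem hx)
    have h3 := h a (Multiset.mem_cons_self a X)
    simp only [Multiset.map_cons, Multiset.sum_cons]
    exact ⟨h3.add h1, by rw [integral_add h3 h1, h2]⟩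

theorem sum_map_ite {ι E : Type*} [AddCommMonoid E] (X : Multiset ι) (p : Prop) [Decidable p]
    (g : ι → E) : (X.map fun x => if p then g x else 0).sum = if p then (X.map g).sum else 0 := by
  split_ifs <;> simp

/-- The empty word is an atom of mass one. -/
theorem integral_ite_letters_eq_zero {E : Type*} [NormedAddCommGroup E] [NormedSpace ℝ E]
    [CompleteSpace E] (g : Multiset ℝ → E) :
    Integrable (fun υ => if letters υ = 0 then g (letters υ) else 0) wordMeasure ∧
      ∫ υ, (if letters υ = 0 then g (letters υ) else 0) ∂wordMeasure = g 0 := by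
  have hS : MeasurableSet {w : Word | w.1 = 0} := measurable_length (measurableSet_singleton 0)
  have hμ : wordMeasure {w : Word | w.1 = 0} = 1 := by
    rw [wordMeasure_eq_sum, Measure.sum_apply _ hS, tsum_eq_single 0, Measure.smul_apply,
      Measure.map_apply (measurable_mkWord 0) hS]
    · have : mkWord 0 ⁻¹' {w : Word | w.1 = 0} = Set.univ := by ext; simp [mkWord]
      rw [this, volume_pi, Measure.pi_of_empty]
      simp
    · intro n hn
      rw [Measure.smul_apply, Measure.map_apply (measurable_mkWord n) hS]
      have : mkWord n ⁻¹' {w : Word | w.1 = 0} = ∅ := by ext; simp [mkWord, hn]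
      simp [this]
  have he : (fun υ => if letters υ = 0 then g (letters υ) else 0)
      = Set.indicator {w : Word | w.1 = 0} fun _ => g 0 := by
    funext υ
    by_cases h : υ.1 = 0
    · have h' : letters υ = 0 := by rw [← Multiset.card_eq_zero, card_letters, h]
      rw [Set.indicator_of_mem (by simpa using h), if_pos h', h']
    · rw [Set.indicator_of_notMem (by simpa using h), if_neg]
      rwa [← Multiset.card_eq_zero, card_letters]
  rw [he]
  constructor
  · rw [integrable_indicator_iff hS]
    exact integrableOn_const (hs := by simp [hμ])
  · rw [integral_indicator_const _ hS, measureReal_def, hμ]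
    simp

theorem Dominated.measurable_family {X E : Type*} [MeasurableSpace X] [NormedAddCommGroup E]
    {f : Multiset ℝ → E} {C q R : ℝ} (hf : Dominated f C q R) :
    StronglyMeasurable fun p : X × Word => f (letters p.2) :=
  hf.meas.comp_measurable measurable_snd

namespace Coeff

variable {𝔨 : Type*} [NormedAddCommGroup 𝔨] [InnerProductSpace ℂ 𝔨] (a : Coeff 𝔨)

open Classical in
theorem marked_erase_fst {α β υ : Multiset ℝ} {r : ℝ} (hr : r ∈ α) :
    (a.marked α β υ).erase (r, a.create) = a.marked (α.erase r) β υ := by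
  have hm : (r, a.create) ∈ α.map fun r => (r, a.create) := Multiset.mem_map_of_mem _ hr
  rw [marked, add_assoc, Multiset.erase_add_left_pos _ hm,
    ← Multiset.map_erase_of_mem (fun r => (r, a.create)) _ hr, ← add_assoc]
  rfl

open Classical in
theorem marked_erase_snd {α β υ : Multiset ℝ} {r : ℝ} (hr : r ∈ β) :
    (a.marked α β υ).erase (r, a.number) = a.marked α (β.erase r) υ := by
  have hm : (r, a.number) ∈ β.map fun r => (r, a.number) := Multiset.mem_map_of_mem _ hr
  rw [marked, add_assoc, Multiset.erase_add_right_pos _ (Multiset.mem_add.2 (Or.inl hm)),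
    Multiset.erase_add_left_pos _ hm,
    ← Multiset.map_erase_of_mem (fun r => (r, a.number)) _ hr, ← add_assoc]
  rfl

open Classical in
theorem marked_erase_thd {α β υ : Multiset ℝ} {r : ℝ} (hr : r ∈ υ) :
    (a.marked α β υ).erase (r, a.annih) = a.marked α β (υ.erase r) := by
  have hm : (r, a.annih) ∈ υ.map fun r => (r, a.annih) := Multiset.mem_map_of_mem _ hr
  rw [marked, Multiset.erase_add_right_pos _ hm,
    ← Multiset.map_erase_of_mem (fun r => (r, a.annih)) _ hr]
  rfl

variable [CompleteSpace 𝔨]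

theorem intervalIntegrable_ker {t s : ℝ} (hst : s ≤ t) (α β υ : Multiset ℝ) :
    IntervalIntegrable (fun q => a.ker q s α β υ) volume s t := by
  obtain ⟨wα, rfl⟩ := letters_surjective α
  obtain ⟨wβ, rfl⟩ := letters_surjective β
  obtain ⟨wυ, rfl⟩ := letters_surjective υ
  have hm := (a.stronglyMeasurable_ker s).comp_measurable
    (g := fun q : ℝ => (q, wα, wβ, wυ)) (by fun_prop)
  rw [intervalIntegrable_iff_integrableOn_Ioc_of_le hst]
  refine Integrable.mono' (g := fun _ => Real.exp (‖a.drift‖ * (2 * max |s| |t|))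
      * (env a.size (max |s| |t|) (letters wα) * env a.size (max |s| |t|) (letters wβ)
        * env a.size (max |s| |t|) (letters wυ)))
    (integrableOn_const (hs := by simp)) hm.aestronglyMeasurable ?_
  refine (ae_restrict_iff' measurableSet_Ioc).2 (ae_of_all _ fun q hq => ?_)
  refine a.norm_ker_le hq.1.le (le_max_left _ _) ?_ _ _ _
  rw [abs_le]
  have h1 := le_max_left |s| |t|
  have h2 := le_max_right |s| |t|
  constructor
  · linarith [neg_abs_le s, hq.1]
  · linarith [le_abs_self t, hq.2]

-- This is `chainKernel_integral_eq` applied to a vector, with the sum over the candidate last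
-- points sorted by their mark: creation, number or annihilation.
open Classical in
theorem ker_apply_eq {t s : ℝ} (hst : s ≤ t) (α β υ : Multiset ℝ) (v : 𝔨) :
    a.ker t s α β υ v = (if (α = 0 ∧ β = 0) ∧ υ = 0 then v else 0)
      + (α.map fun r => if s < r ∧ r < t then
          a.create (a.ker r s (α.erase r) β υ v) else 0).sum
      + (β.map fun r => if s < r ∧ r < t then
          a.number (a.ker r s α (β.erase r) υ v) else 0).sum
      + (υ.map fun r => if s < r ∧ r < t then
          a.annih (a.ker r s α β (υ.erase r) v) else 0).sum
      + ∫ q in s..t, a.drift (a.ker q s α β υ v) := by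
  have hsum : ∀ {ι : Type} (N : Multiset ι) (g : ι → 𝔨 →L[ℂ] 𝔨),
      (N.map g).sum v = (N.map fun x => g x v).sum := fun N g => by
    have := map_multiset_sum (ContinuousLinearMap.apply ℂ 𝔨 v) (N.map g)
    rw [Multiset.map_map] at this
    exact this
  have hint : (∫ q in s..t, a.drift * a.ker q s α β υ) v
      = ∫ q in s..t, a.drift (a.ker q s α β υ v) := by
    rw [ContinuousLinearMap.intervalIntegral_apply
      ((a.intervalIntegrable_ker hst α β υ).const_mul a.drift)]
    rfl
  rw [← hint, ker, chainKernel_integral_eq _ hst]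
  simp only [add_apply]
  congr 1
  rw [add_assoc, add_assoc]
  congr 1
  · simp only [marked_eq_zero_iff]
    split_ifs <;> simp
  · conv_lhs => rw [marked]
    rw [Multiset.map_add, Multiset.map_add, Multiset.sum_add, Multiset.sum_add,
      Multiset.map_map, Multiset.map_map, Multiset.map_map, add_apply,
      add_apply, hsum, hsum, hsum, add_assoc]
    congr 1
    · refine congrArg _ (Multiset.map_congr rfl fun r hr => ?_)
      simp only [Function.comp_def]
      rw [ker, ← a.marked_erase_fst hr, marked]
      split_ifs <;> rfl
    congr 1
    · refine congrArg _ (Multiset.map_congr rfl fun r hr => ?_)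
      simp only [Function.comp_def]
      rw [ker, ← a.marked_erase_snd hr, marked]
      split_ifs <;> rfl
    · refine congrArg _ (Multiset.map_congr rfl fun r hr => ?_)
      simp only [Function.comp_def]
      rw [ker, ← a.marked_erase_thd hr, marked]
      split_ifs <;> rfl

section Family

variable {a} {F : ℝ → Multiset ℝ → 𝔨} {C q R t s : ℝ}
  (hF : StronglyMeasurable fun p : ℝ × Word => F p.1 (letters p.2))
  (hD : ∀ r, Dominated (F r) C q R) (hs : |s| ≤ R) (ht : |t| ≤ R)
include hF

theorem stronglyMeasurable_core_integrand_family (α β γ : Multiset ℝ) :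
    StronglyMeasurable fun p : ℝ × Word =>
      a.ker p.1 s α β (letters p.2) (F p.1 (β + γ + letters p.2)) := by
  obtain ⟨wα, rfl⟩ := letters_surjective α
  obtain ⟨wβ, rfl⟩ := letters_surjective β
  obtain ⟨wγ, rfl⟩ := letters_surjective γ
  exact (a.stronglyMeasurable_core_integrand measurable_id hF s).comp_measurable
    (g := fun p : ℝ × Word => ((p.1, wα, wβ, wγ), p.2)) (by fun_prop)

include hD hs ht

theorem integrable_core_integrand_family (α β γ : Multiset ℝ) :
    Integrable (fun p : ℝ × Word => a.ker p.1 s α β (letters p.2) (F p.1 (β + γ + letters p.2)))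
      ((volume.restrict (Set.Ioo s t)).prod wordMeasure) := by
  have hm := stronglyMeasurable_core_integrand_family (a := a) (s := s) hF α β γ
  have hq := (hD 0).nonneg
  have hb : Integrable (fun p : ℝ × Word => (Real.exp (‖a.drift‖ * (2 * R)) * C
      * (env a.size R α * (env (a.size * q) R β) * env q R γ)) * env (a.size * q) R (letters p.2))
      ((volume.restrict (Set.Ioo s t)).prod wordMeasure) :=
    Integrable.mul_prod (f := fun _ : ℝ => Real.exp (‖a.drift‖ * (2 * R)) * C
      * (env a.size R α * (env (a.size * q) R β) * env q R γ))
      (integrable_const _) (integrable_env (mul_nonneg a.size_nonneg hq) R)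
  refine hb.mono' hm.aestronglyMeasurable ?_
  have : ∀ᵐ p : ℝ × Word ∂((volume.restrict (Set.Ioo s t)).prod wordMeasure), p.1 ∈ Set.Ioo s t :=
    Measure.quasiMeasurePreserving_fst.ae (ae_restrict_mem measurableSet_Ioo)
  filter_upwards [this] with p hp
  refine norm_core_integrand_le (hD p.1) hp.1.le hs ?_ _ _ _ _
  rw [abs_le] at hs ht ⊢
  constructor <;> linarith [hp.1, hp.2]

theorem integrableOn_core_family (α β γ : Multiset ℝ) :
    IntegrableOn (fun r => a.core r s (F r) α β γ) (Set.Ioo s t) :=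
  (integrable_core_integrand_family (a := a) hF hD hs ht α β γ).integral_prod_left

/-- Fubini for the time integral; used for the drift term. -/
theorem integral_setIntegral_core (L : 𝔨 →L[ℂ] 𝔨) (α β γ : Multiset ℝ) :
    Integrable (fun υ => ∫ r in Set.Ioo s t,
      L (a.ker r s α β (letters υ) (F r (β + γ + letters υ)))) wordMeasure ∧
    ∫ υ, (∫ r in Set.Ioo s t, L (a.ker r s α β (letters υ) (F r (β + γ + letters υ))))
        ∂wordMeasure
      = ∫ r in Set.Ioo s t, L (a.core r s (F r) α β γ) := by
  have hi := L.integrable_comp (integrable_core_integrand_family (a := a) hF hD hs ht α β γ)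
  refine ⟨hi.integral_prod_right, ?_⟩
  rw [integral_integral_swap (f := fun υ r =>
    L (a.ker r s α β (letters υ) (F r (β + γ + letters υ)))) hi.swap]
  refine setIntegral_congr_fun measurableSet_Ioo fun r hr => ?_
  have hr' : |r| ≤ R := by
    rw [abs_le] at hs ht ⊢
    constructor <;> linarith [hr.1, hr.2]
  exact L.integral_comp_comm (integrable_core_integrand (hD r) hr.1.le hs hr' α β γ)

/-- The Mecke formula applied to the integrated word `υ`: the annihilated letter leaves `υ` and
becomes a time variable. With `F r M = f (r ::ₘ M)` it then appears only as an extra letter in the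
argument of `f`. -/
theorem integral_sum_annih (L : 𝔨 →L[ℂ] 𝔨) (α β γ : Multiset ℝ) :
    Integrable (fun υ => ((letters υ).map fun r => if s < r ∧ r < t then
      L (a.ker r s α β ((letters υ).erase r) (F r (β + γ + (letters υ).erase r))) else 0).sum)
      wordMeasure ∧
    ∫ υ, ((letters υ).map fun r => if s < r ∧ r < t then
      L (a.ker r s α β ((letters υ).erase r) (F r (β + γ + (letters υ).erase r))) else 0).sum
      ∂wordMeasure = ∫ r in Set.Ioo s t, L (a.core r s (F r) α β γ) := by
  have hm := stronglyMeasurable_core_integrand_family (a := a) (s := s) hF α β γ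
  have hi := L.integrable_comp (integrable_core_integrand_family (a := a) hF hD hs ht α β γ)
  obtain ⟨h1, h2⟩ := integrable_and_integral_sum_erase_Ioo (s := s) (t := t)
    (G := fun r M => L (a.ker r s α β M (F r (β + γ + M))))
    (L.continuous.comp_stronglyMeasurable hm) hi
  refine ⟨h1, h2.trans ?_⟩
  refine setIntegral_congr_fun measurableSet_Ioo fun r hr => ?_
  have hr' : |r| ≤ R := by
    rw [abs_le] at hs ht ⊢
    constructor <;> linarith [hr.1, hr.2]
  exact L.integral_comp_comm (integrable_core_integrand (hD r) hr.1.le hs hr' α β γ)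

end Family

section IntegralEquation

variable {a} {f : Multiset ℝ → 𝔨} {C q R t s : ℝ} (hf : Dominated f C q R)
include hf

variable (hst : s ≤ t) (hs : |s| ≤ R) (ht : |t| ≤ R)
include hst hs ht

-- `ker_apply_eq` integrated over `υ`. A last point with the number mark lies in `β` and so also in
-- the argument of `f`; removing it from `β` therefore replaces `f` by `f (r ::ₘ ·)`. A last
-- annihilation point turns into a time integral.
open Classical in
theorem core_integral_eq (α β γ : Multiset ℝ) :
    a.core t s f α β γ = (if α = 0 ∧ β = 0 then f γ else 0)
      + (α.map fun r => if s < r ∧ r < t then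
          a.create (a.core r s f (α.erase r) β γ) else 0).sum
      + (β.map fun r => if s < r ∧ r < t then
          a.number (a.core r s (fun M => f (r ::ₘ M)) α (β.erase r) γ) else 0).sum
      + (∫ r in Set.Ioo s t, a.annih (a.core r s (fun M => f (r ::ₘ M)) α β γ))
      + ∫ r in Set.Ioo s t, a.drift (a.core r s f α β γ) := by
  have hmem : ∀ {r}, s < r ∧ r < t → |r| ≤ R := fun {r} hr => by
    rw [abs_le] at hs ht ⊢
    constructor <;> linarith [hr.1, hr.2]
  have h0 : Integrable (fun υ => if (α = 0 ∧ β = 0) ∧ letters υ = 0 then f (β + γ + letters υ)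
      else 0) wordMeasure ∧ ∫ υ, (if (α = 0 ∧ β = 0) ∧ letters υ = 0 then f (β + γ + letters υ)
      else 0) ∂wordMeasure = if α = 0 ∧ β = 0 then f γ else 0 := by
    by_cases h : α = 0 ∧ β = 0
    · have := integral_ite_letters_eq_zero fun M => f (β + γ + M)
      simpa only [h, true_and, and_self, if_true, add_zero, zero_add] using this
    · simp [h]
  have h1 := integrable_and_integral_sum_map (μ := wordMeasure) α
    (g := fun r υ => if s < r ∧ r < t then a.create (a.ker r s (α.erase r) β (letters υ)
      (f (β + γ + letters υ))) else 0) (fun r _ => by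
        by_cases h : s < r ∧ r < t
        · simp only [h, and_self, if_true]
          exact a.create.integrable_comp (integrable_core_integrand hf h.1.le hs (hmem h) _ _ _)
        · simp [h])
  have h2 := integrable_and_integral_sum_map (μ := wordMeasure) β
    (g := fun r υ => if s < r ∧ r < t then a.number (a.ker r s α (β.erase r) (letters υ)
      (f (β + γ + letters υ))) else 0) (fun r hr => by
        by_cases h : s < r ∧ r < t
        · simp only [h, and_self, if_true]
          have := a.number.integrable_comp
            (integrable_core_integrand (a := a) (hf.cons r) h.1.le hs (hmem h) α (β.erase r) γ)
          simpa only [← Multiset.cons_add, Multiset.cons_erase hr] using this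
        · simp [h])
  have hfc : ∀ r, Dominated (fun M => f (r ::ₘ M)) (C * q) q R := hf.cons
  have h3 := integral_sum_annih (a := a) (F := fun r M => f (r ::ₘ M)) hf.measurable_cons hfc
    hs ht a.annih α β γ
  have h3' : ∀ υ, ((letters υ).map fun r => if s < r ∧ r < t then
      a.annih (a.ker r s α β ((letters υ).erase r) (f (r ::ₘ (β + γ + (letters υ).erase r))))
        else 0) = (letters υ).map fun r => if s < r ∧ r < t then
      a.annih (a.ker r s α β ((letters υ).erase r) (f (β + γ + letters υ))) else 0 := fun υ => by
    refine Multiset.map_congr rfl fun r hr => ?_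
    rw [← Multiset.add_cons, Multiset.cons_erase hr]
  simp only [h3'] at h3
  have h4 := integral_setIntegral_core (a := a) (F := fun _ => f) hf.measurable_family
    (fun _ => hf) hs ht a.drift α β γ
  have e1 : (α.map fun r => ∫ υ, (if s < r ∧ r < t then a.create (a.ker r s (α.erase r) β
      (letters υ) (f (β + γ + letters υ))) else 0) ∂wordMeasure)
      = α.map fun r => if s < r ∧ r < t then a.create (a.core r s f (α.erase r) β γ) else 0 := by
    refine Multiset.map_congr rfl fun r _ => ?_
    by_cases h : s < r ∧ r < t
    · simp only [h, and_self, if_true]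
      exact a.create.integral_comp_comm (integrable_core_integrand hf h.1.le hs (hmem h) _ _ _)
    · simp [h]
  have e2 : (β.map fun r => ∫ υ, (if s < r ∧ r < t then a.number (a.ker r s α (β.erase r)
      (letters υ) (f (β + γ + letters υ))) else 0) ∂wordMeasure)
      = β.map fun r => if s < r ∧ r < t then
        a.number (a.core r s (fun M => f (r ::ₘ M)) α (β.erase r) γ) else 0 := by
    refine Multiset.map_congr rfl fun r hr => ?_
    by_cases h : s < r ∧ r < t
    · simp only [h, and_self, if_true]
      have := a.number.integral_comp_comm
        (integrable_core_integrand (a := a) (hf.cons r) h.1.le hs (hmem h) α (β.erase r) γ)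
      simp only [← Multiset.cons_add, Multiset.cons_erase hr] at this
      rw [this, core]
      simp only [← Multiset.cons_add, Multiset.cons_erase hr]
    · simp [h]
  have hpt : ∀ υ, a.ker t s α β (letters υ) (f (β + γ + letters υ)) = _ :=
    fun υ => a.ker_apply_eq hst α β (letters υ) (f (β + γ + letters υ))
  simp only [intervalIntegral.integral_of_le hst, integral_Ioc_eq_integral_Ioo] at hpt
  rw [core]
  simp only [hpt]
  refine (integral_add (((h0.1.add h1.1).add h2.1).add h3.1) h4.1).trans ?_
  refine congrArg₂ _ ((integral_add ((h0.1.add h1.1).add h2.1) h3.1).trans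
    (congrArg₂ _ ((integral_add (h0.1.add h1.1) h2.1).trans
    (congrArg₂ _ ((integral_add h0.1 h1.1).trans (congrArg₂ _ h0.2 ?_)) ?_)) h3.2)) h4.2
  · rw [h1.2, e1]
  · rw [h2.2, e2]

-- Sums `core_integral_eq` over the splittings of `δ`; choosing the number letter after the
-- splitting is the same as removing it from `δ` first.
open Classical in
theorem innerSum_integral_eq (α δ : Multiset ℝ) :
    a.innerSum t s f α δ = (if α = 0 then f δ else 0)
      + (α.map fun r => if s < r ∧ r < t then
          a.create (a.innerSum r s f (α.erase r) δ) else 0).sum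
      + (δ.map fun r => if s < r ∧ r < t then
          a.number (a.innerSum r s (fun M => f (r ::ₘ M)) α (δ.erase r)) else 0).sum
      + (∫ r in Set.Ioo s t, a.annih (a.innerSum r s (fun M => f (r ::ₘ M)) α δ))
      + ∫ r in Set.Ioo s t, a.drift (a.innerSum r s f α δ) := by
  have hL : ∀ (L : 𝔨 →L[ℂ] 𝔨) (g : Multiset ℝ → 𝔨) (r : ℝ) (α δ : Multiset ℝ),
      L (a.innerSum r s g α δ)
        = (δ.antidiagonal.map fun p => L (a.core r s g α p.1 p.2)).sum := fun L g r α δ => by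
    rw [innerSum, map_multiset_sum, Multiset.map_map]
    rfl
  have h0 : (δ.antidiagonal.map fun p => if α = 0 ∧ p.1 = 0 then f p.2 else 0).sum
      = if α = 0 then f δ else 0 := by
    by_cases h : α = 0
    · simp only [h, true_and, if_true]
      exact sum_antidiagonal_ite_fst_eq_zero δ f
    · simp [h]
  have h1 : (δ.antidiagonal.map fun p => (α.map fun r => if s < r ∧ r < t then
      a.create (a.core r s f (α.erase r) p.1 p.2) else 0).sum).sum
      = (α.map fun r => if s < r ∧ r < t then
          a.create (a.innerSum r s f (α.erase r) δ) else 0).sum := by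
    rw [Multiset.sum_map_sum_map]
    simp only [sum_map_ite, hL]
  have h2 : (δ.antidiagonal.map fun p => (p.1.map fun r => if s < r ∧ r < t then
      a.number (a.core r s (fun M => f (r ::ₘ M)) α (p.1.erase r) p.2) else 0).sum).sum
      = (δ.map fun r => if s < r ∧ r < t then
          a.number (a.innerSum r s (fun M => f (r ::ₘ M)) α (δ.erase r)) else 0).sum := by
    rw [sum_antidiagonal_sum_fst δ fun r M N => if s < r ∧ r < t then
      a.number (a.core r s (fun M => f (r ::ₘ M)) α M N) else 0]
    simp only [sum_map_ite, hL]
  have h3 := integrable_and_integral_sum_map (μ := volume.restrict (Set.Ioo s t)) δ.antidiagonal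
    (g := fun p r => a.annih (a.core r s (fun M => f (r ::ₘ M)) α p.1 p.2)) fun p _ =>
      a.annih.integrable_comp (integrableOn_core_family (F := fun r M => f (r ::ₘ M))
        hf.measurable_cons hf.cons hs ht α p.1 p.2)
  have h4 := integrable_and_integral_sum_map (μ := volume.restrict (Set.Ioo s t)) δ.antidiagonal
    (g := fun p r => a.drift (a.core r s f α p.1 p.2)) fun p _ =>
      a.drift.integrable_comp (integrableOn_core_family (F := fun _ => f)
        hf.measurable_family (fun _ => hf) hs ht α p.1 p.2)
  simp only [hL, h3.2, h4.2]
  rw [innerSum, Multiset.map_congr rfl fun p _ => core_integral_eq hf hst hs ht α p.1 p.2]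
  simp only [Multiset.sum_map_add, h0, h1, h2, hL]

omit hf hst in
theorem integrableOn_innerSum_family {F : ℝ → Multiset ℝ → 𝔨} {C : ℝ}
    (hF : StronglyMeasurable fun p : ℝ × Word => F p.1 (letters p.2))
    (hD : ∀ r, Dominated (F r) C q R) (α δ : Multiset ℝ) :
    IntegrableOn (fun r => a.innerSum r s (F r) α δ) (Set.Ioo s t) :=
  (integrable_and_integral_sum_map (μ := volume.restrict (Set.Ioo s t)) δ.antidiagonal
    (g := fun p r => a.core r s (F r) α p.1 p.2) fun p _ =>
      integrableOn_core_family hF hD hs ht α p.1 p.2).1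

omit hf hst in
theorem integrableOn_evolve_family {F : ℝ → Multiset ℝ → 𝔨} {C : ℝ}
    (hF : StronglyMeasurable fun p : ℝ × Word => F p.1 (letters p.2))
    (hD : ∀ r, Dominated (F r) C q R) (X : Multiset ℝ) :
    IntegrableOn (fun r => a.evolve r s (F r) X) (Set.Ioo s t) :=
  (integrable_and_integral_sum_map (μ := volume.restrict (Set.Ioo s t)) X.antidiagonal
    (g := fun p r => a.innerSum r s (F r) p.1 p.2) fun p _ =>
      integrableOn_innerSum_family hs ht hF hD p.1 p.2).1

open Classical in
/-- The integral equation for the evolution. -/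
theorem evolve_integral_eq (X : Multiset ℝ) :
    a.evolve t s f X = f X
      + (X.map fun r => if s < r ∧ r < t then a.create (a.evolve r s f (X.erase r))
          + a.number (a.evolve r s (fun M => f (r ::ₘ M)) (X.erase r)) else 0).sum
      + ∫ r in Set.Ioo s t, (a.annih (a.evolve r s (fun M => f (r ::ₘ M)) X)
          + a.drift (a.evolve r s f X)) := by
  have hL : ∀ (L : 𝔨 →L[ℂ] 𝔨) (g : Multiset ℝ → 𝔨) (r : ℝ) (X : Multiset ℝ),
      L (a.evolve r s g X)
        = (X.antidiagonal.map fun p => L (a.innerSum r s g p.1 p.2)).sum := fun L g r X => by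
    rw [evolve, map_multiset_sum, Multiset.map_map]
    rfl
  have h0 : (X.antidiagonal.map fun p => if p.1 = 0 then f p.2 else 0).sum = f X :=
    sum_antidiagonal_ite_fst_eq_zero X f
  -- A creation letter is taken from the first part of the splitting and a number letter (`h2`) from
  -- the second; both orders of choosing are exchanged, so that the letter is removed from `X`
  -- before splitting.
  have h1 : (X.antidiagonal.map fun p => (p.1.map fun r => if s < r ∧ r < t then
      a.create (a.innerSum r s f (p.1.erase r) p.2) else 0).sum).sum
      = (X.map fun r => if s < r ∧ r < t then a.create (a.evolve r s f (X.erase r)) else 0).sum := by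
    rw [sum_antidiagonal_sum_fst X fun r M N => if s < r ∧ r < t then
      a.create (a.innerSum r s f M N) else 0]
    simp only [sum_map_ite, hL]
  have h2 : (X.antidiagonal.map fun p => (p.2.map fun r => if s < r ∧ r < t then
      a.number (a.innerSum r s (fun M => f (r ::ₘ M)) p.1 (p.2.erase r)) else 0).sum).sum
      = (X.map fun r => if s < r ∧ r < t then
          a.number (a.evolve r s (fun M => f (r ::ₘ M)) (X.erase r)) else 0).sum := by
    rw [sum_antidiagonal_sum_snd X fun r M N => if s < r ∧ r < t then
      a.number (a.innerSum r s (fun M => f (r ::ₘ M)) M N) else 0]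
    simp only [sum_map_ite, hL]
  have h3 := integrable_and_integral_sum_map (μ := volume.restrict (Set.Ioo s t)) X.antidiagonal
    (g := fun p r => a.annih (a.innerSum r s (fun M => f (r ::ₘ M)) p.1 p.2)) fun p _ =>
      a.annih.integrable_comp (integrableOn_innerSum_family (F := fun r M => f (r ::ₘ M)) hs ht
        hf.measurable_cons hf.cons p.1 p.2)
  have h4 := integrable_and_integral_sum_map (μ := volume.restrict (Set.Ioo s t)) X.antidiagonal
    (g := fun p r => a.drift (a.innerSum r s f p.1 p.2)) fun p _ =>
      a.drift.integrable_comp (integrableOn_innerSum_family (F := fun _ => f) hs ht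
        hf.measurable_family (fun _ => hf) p.1 p.2)
  have h5 : (X.map fun r => if s < r ∧ r < t then a.create (a.evolve r s f (X.erase r))
      + a.number (a.evolve r s (fun M => f (r ::ₘ M)) (X.erase r)) else 0)
      = X.map fun r => (if s < r ∧ r < t then a.create (a.evolve r s f (X.erase r)) else 0)
        + if s < r ∧ r < t then
          a.number (a.evolve r s (fun M => f (r ::ₘ M)) (X.erase r)) else 0 := by
    refine Multiset.map_congr rfl fun r _ => ?_
    split_ifs <;> simp
  have h6 : ∫ r in Set.Ioo s t, (a.annih (a.evolve r s (fun M => f (r ::ₘ M)) X)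
      + a.drift (a.evolve r s f X))
      = (∫ r in Set.Ioo s t, a.annih (a.evolve r s (fun M => f (r ::ₘ M)) X))
        + ∫ r in Set.Ioo s t, a.drift (a.evolve r s f X) := by
    simp only [hL]
    exact integral_add h3.1 h4.1
  rw [h5, h6]
  simp only [hL a.annih, hL a.drift, h3.2, h4.2]
  rw [evolve, Multiset.map_congr rfl fun p _ => innerSum_integral_eq hf hst hs ht p.1 p.2]
  simp only [Multiset.sum_map_add, h0, h1, h2, add_assoc]

end IntegralEquation

/-! ### Adaptedness. -/

section Adapted

variable (f : Multiset ℝ → 𝔨)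

-- The kernel is supported on points strictly before `t`.
omit [CompleteSpace 𝔨] in
theorem core_eq_zero_of_mem {t s r : ℝ} {α β γ : Multiset ℝ} (hr : r ∈ α + β) (h : t ≤ r) :
    a.core t s f α β γ = 0 := by
  rw [core]
  simp only [a.ker_eq_zero_of_mem (Multiset.mem_add.2 (Or.inl hr))
    (fun h' => absurd h'.2 (not_lt.2 h)), zero_apply, integral_zero]

omit [CompleteSpace 𝔨] in
/-- The evolution up to time `t` does not act on the letters that come later. -/
theorem evolve_cons_of_le {t s r : ℝ} (h : t ≤ r) (X : Multiset ℝ) :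
    a.evolve t s f (r ::ₘ X) = a.evolve t s (fun M => f (r ::ₘ M)) X := by
  rw [evolve, Multiset.antidiagonal_cons, Multiset.map_add, Multiset.sum_add, Multiset.map_map,
    Multiset.map_map]
  have h2 : ∀ p ∈ X.antidiagonal,
      ((fun p : Multiset ℝ × Multiset ℝ => a.innerSum t s f p.1 p.2) ∘ Prod.map (r ::ₘ ·) id) p
        = 0 := fun p _ => by
    simp only [Function.comp_def, Prod.map_fst, Prod.map_snd, id, innerSum]
    refine Multiset.sum_eq_zero fun z hz => ?_
    obtain ⟨w, _, rfl⟩ := Multiset.mem_map.1 hz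
    exact a.core_eq_zero_of_mem f (Multiset.mem_add.2 (Or.inl (Multiset.mem_cons_self r _))) h
  have h1 : ∀ p ∈ X.antidiagonal,
      ((fun p : Multiset ℝ × Multiset ℝ => a.innerSum t s f p.1 p.2) ∘ Prod.map id (r ::ₘ ·)) p
        = a.innerSum t s (fun M => f (r ::ₘ M)) p.1 p.2 := fun p _ => by
    simp only [Function.comp_def, Prod.map_fst, Prod.map_snd, id, innerSum]
    rw [Multiset.antidiagonal_cons, Multiset.map_add, Multiset.sum_add, Multiset.map_map,
      Multiset.map_map, Multiset.map_congr rfl (g := fun _ => 0) (f := (fun p : Multiset ℝ ×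
        Multiset ℝ => a.core t s f _ p.1 p.2) ∘ Prod.map (r ::ₘ ·) id)]
    · simp only [Multiset.map_const', Multiset.sum_replicate, smul_zero, add_zero]
      refine congrArg _ (Multiset.map_congr rfl fun w _ => ?_)
      simp only [Function.comp_def, Prod.map_fst, Prod.map_snd, id, core, Multiset.add_cons,
        Multiset.cons_add]
    · intro w _
      exact a.core_eq_zero_of_mem f (Multiset.mem_add.2 (Or.inr (Multiset.mem_cons_self r _))) h
  rw [Multiset.map_congr rfl h1, Multiset.map_congr rfl h2, evolve]
  simp

end Adapted


end Coeff

/-! ### The squared norm along a path with drift and jumps. -/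

theorem integrableOn_and_setIntegral_Ioo_union {E : Type*} [NormedAddCommGroup E]
    [NormedSpace ℝ E] {φ : ℝ → E} {s m u : ℝ} (hm : s ≤ m) (hu : m ≤ u)
    (ha : IntegrableOn φ (Set.Ioo s m)) (hb : IntegrableOn φ (Set.Ioo m u)) :
    IntegrableOn φ (Set.Ioo s u) ∧
      ∫ r in Set.Ioo s u, φ r = (∫ r in Set.Ioo s m, φ r) + ∫ r in Set.Ioo m u, φ r := by
  rw [← integrableOn_Ioc_iff_integrableOn_Ioo] at ha hb ⊢
  simp only [← integral_Ioc_eq_integral_Ioo]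
  rw [← Set.Ioc_union_Ioc_eq_Ioc hm hu]
  exact ⟨ha.union hb, setIntegral_union (Set.Ioc_disjoint_Ioc_of_le le_rfl)
    measurableSet_Ioc ha hb⟩

section Path

variable {E : Type*} [NormedAddCommGroup E] [InnerProductSpace ℝ E] [CompleteSpace E]
  {k : ℝ → E} {s t : ℝ}

/-- The squared norm is a double integral of `⟨k q, k r⟩`, and the two triangles `q < r` and `r ≤ q`
contribute equally. This replaces differentiation of the squared norm, since `k` is only integrable.
-/
theorem norm_sq_setIntegral (hk : IntegrableOn k (Set.Ioo s t)) :
    IntegrableOn (fun r => inner ℝ (∫ q in Set.Ioo s r, k q) (k r)) (Set.Ioo s t) ∧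
      ‖∫ r in Set.Ioo s t, k r‖ ^ 2
        = ∫ r in Set.Ioo s t, 2 * inner ℝ (∫ q in Set.Ioo s r, k q) (k r) := by
  set μ := (volume : Measure ℝ).restrict (Set.Ioo s t) with hμ
  have hk' : Integrable k μ := hk
  have hg : Integrable (fun p : ℝ × ℝ => inner ℝ (k p.1) (k p.2)) (μ.prod μ) := by
    refine (hk'.norm.mul_prod hk'.norm).mono
      (hk'.aestronglyMeasurable.comp_fst.inner hk'.aestronglyMeasurable.comp_snd)
      (ae_of_all _ fun p => ?_)
    rw [norm_mul, norm_norm, norm_norm]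
    exact norm_inner_le_norm _ _
  have hS : MeasurableSet {p : ℝ × ℝ | p.1 < p.2} := measurableSet_lt measurable_fst measurable_snd
  have hS' : MeasurableSet {p : ℝ × ℝ | p.2 ≤ p.1} := measurableSet_le measurable_snd measurable_fst
  have h1 := hg.indicator hS
  have h2 := hg.indicator hS'
  have keyA : ∀ r ∈ Set.Ioo s t,
      ∫ q, {p : ℝ × ℝ | p.1 < p.2}.indicator (fun p => inner ℝ (k p.1) (k p.2)) (q, r) ∂μ
        = inner ℝ (∫ q in Set.Ioo s r, k q) (k r) := by
    intro r hr
    have h : (fun q => {p : ℝ × ℝ | p.1 < p.2}.indicator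
        (fun p => inner ℝ (k p.1) (k p.2)) (q, r))
        = (Set.Iio r).indicator fun q => inner ℝ (k r) (k q) := by
      funext q
      simp only [Set.indicator_apply, Set.mem_ofPred_eq, Set.mem_Iio, real_inner_comm]
    have hS : Set.Iio r ∩ Set.Ioo s t = Set.Ioo s r := by
      ext q
      simp only [Set.mem_inter_iff, Set.mem_Iio, Set.mem_Ioo]
      exact ⟨fun h => ⟨h.2.1, h.1⟩, fun h => ⟨h.2, h.1, h.2.trans hr.2⟩⟩
    rw [h, integral_indicator measurableSet_Iio, hμ, Measure.restrict_restrict measurableSet_Iio,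
      hS, real_inner_comm, integral_inner (hk.mono_set (Set.Ioo_subset_Ioo_right hr.2.le))]
  have keyB : ∀ r ∈ Set.Ioo s t,
      ∫ q, {p : ℝ × ℝ | p.2 ≤ p.1}.indicator (fun p => inner ℝ (k p.1) (k p.2)) (r, q) ∂μ
        = inner ℝ (∫ q in Set.Ioo s r, k q) (k r) := by
    intro r hr
    have h : (fun q => {p : ℝ × ℝ | p.2 ≤ p.1}.indicator
        (fun p => inner ℝ (k p.1) (k p.2)) (r, q))
        = (Set.Iic r).indicator fun q => inner ℝ (k r) (k q) := by
      funext q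
      simp only [Set.indicator_apply, Set.mem_ofPred_eq, Set.mem_Iic]
    have hS : Set.Iic r ∩ Set.Ioo s t = Set.Ioc s r := by
      ext q
      simp only [Set.mem_inter_iff, Set.mem_Iic, Set.mem_Ioo, Set.mem_Ioc]
      exact ⟨fun h => ⟨h.2.1, h.1⟩, fun h => ⟨h.2, h.1, h.2.trans_lt hr.2⟩⟩
    rw [h, integral_indicator measurableSet_Iic, hμ, Measure.restrict_restrict measurableSet_Iic,
      hS, integral_Ioc_eq_integral_Ioo, real_inner_comm,
      integral_inner (hk.mono_set (Set.Ioo_subset_Ioo_right hr.2.le))]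
  have hiA := h1.integral_prod_right
  have haeA : (fun r => ∫ q, {p : ℝ × ℝ | p.1 < p.2}.indicator
      (fun p => inner ℝ (k p.1) (k p.2)) (q, r) ∂μ)
      =ᵐ[μ] fun r => inner ℝ (∫ q in Set.Ioo s r, k q) (k r) := by
    filter_upwards [ae_restrict_mem measurableSet_Ioo] with r hr using keyA r hr
  have haeB : (fun r => ∫ q, {p : ℝ × ℝ | p.2 ≤ p.1}.indicator
      (fun p => inner ℝ (k p.1) (k p.2)) (r, q) ∂μ)
      =ᵐ[μ] fun r => inner ℝ (∫ q in Set.Ioo s r, k q) (k r) := by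
    filter_upwards [ae_restrict_mem measurableSet_Ioo] with r hr using keyB r hr
  have hi : Integrable (fun r => inner ℝ (∫ q in Set.Ioo s r, k q) (k r)) μ := hiA.congr haeA
  refine ⟨hi, ?_⟩
  have hsum : (fun p : ℝ × ℝ => inner ℝ (k p.1) (k p.2))
      = fun p => {p : ℝ × ℝ | p.1 < p.2}.indicator (fun p => inner ℝ (k p.1) (k p.2)) p
        + {p : ℝ × ℝ | p.2 ≤ p.1}.indicator (fun p => inner ℝ (k p.1) (k p.2)) p := by
    funext p
    by_cases h : p.1 < p.2
    · simp [h]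
    · simp [h, not_lt.1 h]
  have hfull : ∫ p, inner ℝ (k p.1) (k p.2) ∂μ.prod μ = ‖∫ r, k r ∂μ‖ ^ 2 := by
    rw [integral_prod _ hg, ← real_inner_self_eq_norm_sq, ← integral_inner hk']
    refine integral_congr_ae (ae_of_all _ fun r => ?_)
    simp only
    rw [integral_inner hk', real_inner_comm]
  rw [← hfull, hsum, integral_add h1 h2, integral_prod_symm _ h1, integral_prod _ h2,
    integral_congr_ae haeA, integral_congr_ae haeB, integral_const_mul, two_mul]

theorem norm_sq_add_setIntegral (hk : IntegrableOn k (Set.Ioo s t)) (z : E) :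
    IntegrableOn (fun r => inner ℝ (z + ∫ q in Set.Ioo s r, k q) (k r)) (Set.Ioo s t) ∧
      ‖z + ∫ r in Set.Ioo s t, k r‖ ^ 2 = ‖z‖ ^ 2
        + ∫ r in Set.Ioo s t, 2 * inner ℝ (z + ∫ q in Set.Ioo s r, k q) (k r) := by
  obtain ⟨h1, h2⟩ := norm_sq_setIntegral hk
  have h3 : IntegrableOn (fun r => inner ℝ z (k r)) (Set.Ioo s t) := Integrable.const_inner z hk
  simp only [inner_add_left]
  refine ⟨h3.add h1, ?_⟩
  simp only [mul_add]
  rw [integral_add (h3.const_mul 2) (h1.const_mul 2), ← h2, integral_const_mul, integral_inner hk,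
    norm_add_sq_real, add_assoc]

/-- The change of the squared norm along a path with drift `k` and jumps `J`. -/
theorem norm_sq_jump_path (S : Finset ℝ) {y J : ℝ → E} {z : E} (hst : s ≤ t)
    (hk : IntegrableOn k (Set.Ioo s t)) (hy : ∀ u ∈ Set.Icc s t,
      y u = z + ∑ r ∈ S, (if s < r ∧ r < u then J r else 0) + ∫ q in Set.Ioo s u, k q) :
    IntegrableOn (fun r => inner ℝ (y r) (k r)) (Set.Ioo s t) ∧
      ‖y t‖ ^ 2 = ‖z‖ ^ 2 + ∑ r ∈ S, (if s < r ∧ r < t then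
        2 * inner ℝ (y r) (J r) + ‖J r‖ ^ 2 else 0) + ∫ r in Set.Ioo s t, 2 * inner ℝ (y r) (k r) := by
  induction S using Finset.induction_on_max generalizing t with
  | empty =>
    simp only [Finset.sum_empty, add_zero] at hy ⊢
    obtain ⟨h1, h2⟩ := norm_sq_add_setIntegral hk z
    rw [hy t ⟨hst, le_rfl⟩, h2]
    have he : ∀ r ∈ Set.Ioo s t, y r = z + ∫ q in Set.Ioo s r, k q := fun r hr =>
      hy r ⟨hr.1.le, hr.2.le⟩
    refine ⟨h1.congr_fun (fun r hr => by rw [he r hr]) measurableSet_Ioo, ?_⟩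
    rw [setIntegral_congr_fun measurableSet_Ioo fun r hr => by rw [← he r hr]]
  | insert m S hS ih =>
    have hm : m ∉ S := fun h => lt_irrefl m (hS m h)
    simp only [Finset.sum_insert hm] at hy ⊢
    by_cases hmt : s < m ∧ m < t
    -- `m` is the last jump. Up to `m` the induction hypothesis applies; `y m` is the value before
    -- the jump, as only jumps with `r < u` are counted at time `u`. After `m` the path restarts
    -- from `y m + J m` and has no jumps.
    · have hkm := hk.mono_set (Set.Ioo_subset_Ioo_right hmt.2.le)
      have hkt := hk.mono_set (Set.Ioo_subset_Ioo_left hmt.1.le)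
      obtain ⟨h1, h2⟩ := ih hmt.1.le hkm fun u hu => by
        rw [hy u ⟨hu.1, hu.2.trans hmt.2.le⟩, if_neg fun h => absurd h.2 (not_lt.2 hu.2), zero_add]
      have hyu : ∀ u ∈ Set.Ioc m t, y u = (y m + J m) + ∫ q in Set.Ioo m u, k q := fun u hu => by
        rw [hy u ⟨(hmt.1.trans hu.1).le, hu.2⟩, hy m ⟨hmt.1.le, hmt.2.le⟩, if_pos ⟨hmt.1, hu.1⟩,
          if_neg (fun h => lt_irrefl m h.2), (integrableOn_and_setIntegral_Ioo_union hmt.1.le hu.1.le hkm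
            (hkt.mono_set (Set.Ioo_subset_Ioo_right hu.2))).2,
          Finset.sum_congr rfl fun r hr => if_congr (P := s < r ∧ r < u) (Q := s < r ∧ r < m)
            (by simp [hS r hr, (hS r hr).trans hu.1]) rfl rfl]
        abel
      obtain ⟨h3, h4⟩ := norm_sq_add_setIntegral hkt (y m + J m)
      have he : ∀ r ∈ Set.Ioo m t, y r = (y m + J m) + ∫ q in Set.Ioo m r, k q := fun r hr =>
        hyu r ⟨hr.1, hr.2.le⟩
      have h3' : IntegrableOn (fun r => inner ℝ (y r) (k r)) (Set.Ioo m t) :=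
        h3.congr_fun (fun r hr => by rw [he r hr]) measurableSet_Ioo
      have h5 : ∫ r in Set.Ioo m t, 2 * inner ℝ ((y m + J m) + ∫ q in Set.Ioo m r, k q) (k r)
          = ∫ r in Set.Ioo m t, 2 * inner ℝ (y r) (k r) :=
        setIntegral_congr_fun measurableSet_Ioo fun r hr => by simp only [← he r hr]
      refine ⟨(integrableOn_and_setIntegral_Ioo_union hmt.1.le hmt.2.le h1 h3').1, ?_⟩
      rw [(integrableOn_and_setIntegral_Ioo_union hmt.1.le hmt.2.le (h1.const_mul 2) (h3'.const_mul 2)).2, hyu t ⟨hmt.2, le_rfl⟩, h4,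
        if_pos hmt, norm_add_sq_real, h2, Finset.sum_congr rfl fun r hr =>
          if_congr (P := s < r ∧ r < t) (Q := s < r ∧ r < m)
            (by simp [hS r hr, (hS r hr).trans hmt.2]) rfl rfl,
        h5]
      ring
    · have hz : ∀ u ∈ Set.Icc s t, ¬ (s < m ∧ m < u) := fun u hu h =>
        hmt ⟨h.1, h.2.trans_le hu.2⟩
      obtain ⟨h1, h2⟩ := ih hst hk fun u hu => by rw [hy u hu, if_neg (hz u hu), zero_add]
      exact ⟨h1, by rw [h2, if_neg hmt, zero_add]⟩

end Path

/-! ### The pathwise energy balance. -/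

section Energy

variable {𝔨 : Type*} [NormedAddCommGroup 𝔨] [InnerProductSpace ℂ 𝔨]

/-- A complex inner product space as a real one. -/
abbrev realInnerProductSpace : InnerProductSpace ℝ 𝔨 := InnerProductSpace.rclikeToReal ℂ 𝔨

attribute [local instance] realInnerProductSpace

namespace Coeff

variable (a : Coeff 𝔨)

/-- The conditions under which the evolution preserves the norm. -/
structure Isometric : Prop where
  norm_number : ∀ v, ‖v + a.number v‖ = ‖v‖
  inner_annih : ∀ y v, inner ℝ y (a.annih v) = -inner ℝ (a.create y) (v + a.number v)
  inner_drift : ∀ y, 2 * inner ℝ y (a.drift y) = -‖a.create y‖ ^ 2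

/-- The rate of the flow of squared norm from `n` to `n + 1` letters. -/
def gain (y v : 𝔨) : ℝ := ‖a.create y‖ ^ 2 + 2 * inner ℝ (a.create y) (v + a.number v)

/-- The rate of the flow of squared norm for the evolution at time `r`. -/
def flux (s : ℝ) (f : Multiset ℝ → 𝔨) (r : ℝ) (M : Multiset ℝ) : ℝ :=
  a.gain (a.evolve r s f M) (a.evolve r s (fun M => f (r ::ₘ M)) M)

variable {a}

/-- The left side is `‖v + J‖² - ‖v‖²` for the jump `J = A₁y + A₀v`. Since `v + A₀v` has the norm of
`v`, only the terms with `A₁y` survive. -/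
theorem Isometric.jump (ha : a.Isometric) (y v : 𝔨) :
    2 * inner ℝ v (a.create y + a.number v) + ‖a.create y + a.number v‖ ^ 2 = a.gain y v := by
  have h1 : ‖v + (a.create y + a.number v)‖ ^ 2 = ‖a.create y + (v + a.number v)‖ ^ 2 := by
    congr 2
    abel
  rw [norm_add_sq_real v, norm_add_sq_real _ (v + a.number v), ha.norm_number] at h1
  rw [gain]
  linarith

/-- The conditions on `A₋₁` and `B` are exactly such that the drift loses at the rate at which a
jump with the same `y` and `v` gains. -/
theorem Isometric.drift (ha : a.Isometric) (y v : 𝔨) :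
    2 * inner ℝ y (a.annih v + a.drift y) = -a.gain y v := by
  rw [inner_add_right, mul_add, ha.inner_annih, ha.inner_drift, gain]
  ring

/-- From `2‖A₁y‖‖v‖ ≤ ‖A₁y‖² + ‖v‖²`, using that `v + A₀v` has the norm of `v`. -/
theorem Isometric.gain_le (ha : a.Isometric) (y v : 𝔨) :
    |a.gain y v| ≤ 2 * ‖a.create‖ ^ 2 * ‖y‖ ^ 2 + ‖v‖ ^ 2 := by
  have h1 := abs_real_inner_le_norm (a.create y) (v + a.number v)
  rw [ha.norm_number] at h1
  have h2 : ‖a.create y‖ ^ 2 ≤ ‖a.create‖ ^ 2 * ‖y‖ ^ 2 := by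
    rw [← mul_pow]
    exact pow_le_pow_left₀ (norm_nonneg _) (a.create.le_opNorm y) 2
  rw [abs_le] at h1
  rw [gain, abs_le]
  constructor <;> nlinarith [sq_nonneg (‖a.create y‖ - ‖v‖), sq_nonneg ‖a.create y‖]

variable [CompleteSpace 𝔨]

section PathwiseEnergy

variable {f : Multiset ℝ → 𝔨} {C q R t s : ℝ} (ha : a.Isometric) (hf : Dominated f C q R)
  (hst : s ≤ t) (hs : |s| ≤ R) (ht : |t| ≤ R)
include ha hf hst hs ht

/-- For distinct letters the integral equation is a path of the kind treated in `norm_sq_jump_path`.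
Jumps and drift involve the same `flux`, at `X` without `r` and at `X`, which is what later makes
them cancel up to the change of the weight. -/
theorem norm_sq_evolve {X : Multiset ℝ} (hX : X.Nodup) :
    IntegrableOn (fun r => a.flux s f r X) (Set.Ioo s t) ∧
      ‖a.evolve t s f X‖ ^ 2 = ‖f X‖ ^ 2
        + (X.map fun r => if s < r ∧ r < t then a.flux s f r (X.erase r) else 0).sum
        - ∫ r in Set.Ioo s t, a.flux s f r X := by
  have hk : IntegrableOn (fun r => a.annih (a.evolve r s (fun M => f (r ::ₘ M)) X)
      + a.drift (a.evolve r s f X)) (Set.Ioo s t) :=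
    (a.annih.integrable_comp (integrableOn_evolve_family (F := fun r M => f (r ::ₘ M)) hs ht
      hf.measurable_cons hf.cons X)).add
    (a.drift.integrable_comp (integrableOn_evolve_family (F := fun _ => f) hs ht
      hf.measurable_family (fun _ => hf) X))
  obtain ⟨h1, h2⟩ := norm_sq_jump_path ⟨X, hX⟩ hst hk (y := fun r => a.evolve r s f X) (z := f X)
    (J := fun r => a.create (a.evolve r s f (X.erase r))
      + a.number (a.evolve r s (fun M => f (r ::ₘ M)) (X.erase r))) fun u hu => by
        refine evolve_integral_eq hf hu.1 hs ?_ X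
        rw [abs_le] at hs ht ⊢
        constructor <;> linarith [hu.1, hu.2]
  have h3 : ∀ r, 2 * inner ℝ (a.evolve r s f X) (a.annih (a.evolve r s (fun M => f (r ::ₘ M)) X)
      + a.drift (a.evolve r s f X)) = -a.flux s f r X := fun r => ha.drift _ _
  refine ⟨?_, ?_⟩
  · have := (h1.const_mul 2).neg
    refine this.congr (ae_of_all _ fun r => ?_)
    simp only [Pi.neg_apply, h3, neg_neg]
  · rw [h2]
    simp only [h3, integral_neg]
    rw [← sub_eq_add_neg]
    congr 2
    refine congrArg Multiset.sum (Multiset.map_congr rfl fun r hr => ?_)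
    congr 1
    -- By adaptedness the evolution up to time `r` does not see the letter `r`, so the value before
    -- the jump is the vector on which `A₀` acts in the jump.
    have : a.evolve r s f X = a.evolve r s (fun M => f (r ::ₘ M)) (X.erase r) := by
      conv_lhs => rw [← Multiset.cons_erase hr]
      exact a.evolve_cons_of_le f le_rfl _
    rw [this]
    exact ha.jump _ _

end PathwiseEnergy

end Coeff

end Energy

/-! ### Weighted norms and their balance. -/

theorem card_letters_erase_add_one {w : Word} {r : ℝ} (hr : r ∈ letters w) :
    ((letters w).erase r).card + 1 = w.1 := by
  rw [Multiset.card_erase_add_one hr, card_letters]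

theorem pow_card_mul_env (b q R : ℝ) (M : Multiset ℝ) :
    b ^ M.card * env q R M = env (b * q) R M := by
  induction M using Multiset.induction_on with
  | empty => simp
  | cons r M ih =>
    rw [env_cons, env_cons, ← ih, Multiset.card_cons]
    split_ifs <;> ring

theorem measurable_weight (W : ℕ → ℝ) : Measurable fun w : Word => W w.1 :=
  (measurable_of_countable W).comp measurable_length

section Weighted

variable {E : Type*} [NormedAddCommGroup E] {W : ℕ → ℝ} {D b : ℝ}
  (hW : ∀ n, |W n| ≤ D * b ^ n)
include hW

/-- A weight of exponential growth is absorbed by enlarging the rate of the majorant. -/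
theorem abs_weight_mul_norm_sq_le {C q R : ℝ} {v : E} {w : Word}
    (hv : ‖v‖ ≤ C * env q R (letters w)) :
    ‖W w.1 * ‖v‖ ^ 2‖ ≤ D * C ^ 2 * env (b * (q * q)) R (letters w) := by
  rw [norm_mul, norm_pow, norm_norm, Real.norm_eq_abs]
  refine (mul_le_mul (hW _) (pow_le_pow_left₀ (norm_nonneg _) hv 2) (by positivity)
    ((abs_nonneg _).trans (hW _))).trans (le_of_eq ?_)
  rw [← pow_card_mul_env, ← env_mul, card_letters]
  ring

theorem Dominated.integrable_weight_mul_norm_sq {f : Multiset ℝ → E} {C q R : ℝ} (hb : 0 ≤ b)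
    (hf : Dominated f C q R) :
    Integrable (fun w : Word => W w.1 * ‖f (letters w)‖ ^ 2) wordMeasure := by
  have hm := (measurable_weight W).mul (hf.meas.norm.measurable.pow_const 2)
  exact ((integrable_env (mul_nonneg hb (mul_nonneg hf.nonneg hf.nonneg)) R).const_mul
    (D * C ^ 2)).mono' hm.aestronglyMeasurable
    (ae_of_all _ fun w => abs_weight_mul_norm_sq_le hW (hf.bound _))

theorem integrable_weight_mul_norm_sq_prod {y : ℝ → Multiset ℝ → E} {C q R s t : ℝ} (hb : 0 ≤ b)
    (hq : 0 ≤ q) (hm : StronglyMeasurable fun p : ℝ × Word => y p.1 (letters p.2))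
    (hy : ∀ r ∈ Set.Ioo s t, ∀ M, ‖y r M‖ ≤ C * env q R M) :
    Integrable (fun p : ℝ × Word => W p.2.1 * ‖y p.1 (letters p.2)‖ ^ 2)
      ((volume.restrict (Set.Ioo s t)).prod wordMeasure) := by
  have hm' := ((measurable_weight W).comp measurable_snd).mul (hm.norm.measurable.pow_const 2)
  have hi : Integrable (fun p : ℝ × Word => D * C ^ 2 * env (b * (q * q)) R (letters p.2))
      ((volume.restrict (Set.Ioo s t)).prod wordMeasure) :=
    Integrable.mul_prod (f := fun _ : ℝ => D * C ^ 2) (integrable_const _)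
      (integrable_env (mul_nonneg hb (mul_nonneg hq hq)) R)
  refine hi.mono' hm'.aestronglyMeasurable ?_
  have : ∀ᵐ p : ℝ × Word ∂((volume.restrict (Set.Ioo s t)).prod wordMeasure), p.1 ∈ Set.Ioo s t :=
    Measure.quasiMeasurePreserving_fst.ae (ae_restrict_mem measurableSet_Ioo)
  filter_upwards [this] with p hp
  exact abs_weight_mul_norm_sq_le hW (hy p.1 hp _)

end Weighted

/-- The weighted squared norm of a function of sets of letters. -/
def wnorm {E : Type*} [NormedAddCommGroup E] (W : ℕ → ℝ) (f : Multiset ℝ → E) : ℝ :=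
  ∫ w, W w.1 * ‖f (letters w)‖ ^ 2 ∂wordMeasure

section Energy

variable {𝔨 : Type*} [NormedAddCommGroup 𝔨] [InnerProductSpace ℂ 𝔨]

namespace Coeff

theorem continuous_gain (a : Coeff 𝔨) : Continuous fun p : 𝔨 × 𝔨 => a.gain p.1 p.2 := by
  let _ : InnerProductSpace ℝ 𝔨 := realInnerProductSpace
  unfold gain
  fun_prop

variable [CompleteSpace 𝔨] {a : Coeff 𝔨}

section

variable {f : Multiset ℝ → 𝔨} {C q R t s : ℝ} (hf : Dominated f C q R)
  (hs : |s| ≤ R) (ht : |t| ≤ R)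
include hf

theorem stronglyMeasurable_evolve_fixed :
    StronglyMeasurable fun p : ℝ × Word => a.evolve p.1 s f (letters p.2) :=
  a.stronglyMeasurable_evolve (f := fun _ => f) measurable_id hf.measurable_family s

theorem stronglyMeasurable_evolve_cons :
    StronglyMeasurable fun p : ℝ × Word =>
      a.evolve p.1 s (fun M => f (p.1 ::ₘ M)) (letters p.2) :=
  a.stronglyMeasurable_evolve (f := fun r M => f (r ::ₘ M)) measurable_id hf.measurable_cons s

theorem stronglyMeasurable_flux :
    StronglyMeasurable fun p : ℝ × Word => a.flux s f p.1 (letters p.2) := by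
  have h1 := stronglyMeasurable_evolve_fixed (a := a) (s := s) hf
  have h2 := stronglyMeasurable_evolve_cons (a := a) (s := s) hf
  have h3 := h1.prodMk h2
  have h4 := a.continuous_gain.comp_stronglyMeasurable h3
  exact h4

variable {W : ℕ → ℝ} {D b : ℝ} (hb : 0 ≤ b) (hW : ∀ n, |W n| ≤ D * b ^ n)
include hs ht hb hW

theorem integrable_weight_mul_evolve :
    Integrable (fun p : ℝ × Word => W p.2.1 * ‖a.evolve p.1 s f (letters p.2)‖ ^ 2)
      ((volume.restrict (Set.Ioo s t)).prod wordMeasure) := by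
  refine integrable_weight_mul_norm_sq_prod (y := fun r => a.evolve r s f) hW hb
    (C := a.evolveConst C q R) (R := R)
    (q := a.size + (a.size * q + q)) ?_ (stronglyMeasurable_evolve_fixed hf) fun r hr => ?_
  · exact (dominated_evolve hf le_rfl hs hs).nonneg
  · refine (dominated_evolve hf hr.1.le hs ?_).bound
    rw [abs_le] at hs ht ⊢
    constructor <;> linarith [hr.1, hr.2]

theorem integrable_weight_mul_evolve_cons :
    Integrable (fun p : ℝ × Word => W p.2.1
      * ‖a.evolve p.1 s (fun M => f (p.1 ::ₘ M)) (letters p.2)‖ ^ 2)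
      ((volume.restrict (Set.Ioo s t)).prod wordMeasure) := by
  refine integrable_weight_mul_norm_sq_prod hW hb
    (y := fun r => a.evolve r s fun M => f (r ::ₘ M)) (C := a.evolveConst (C * q) q R) (R := R)
    (q := a.size + (a.size * q + q)) ?_ (stronglyMeasurable_evolve_cons hf)
    fun r hr => ?_
  · exact (dominated_evolve hf le_rfl hs hs).nonneg
  · refine (dominated_evolve (hf.cons r) hr.1.le hs ?_).bound
    rw [abs_le] at hs ht ⊢
    constructor <;> linarith [hr.1, hr.2]

variable (ha : a.Isometric)
include ha

theorem integrable_weight_mul_flux :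
    Integrable (fun p : ℝ × Word => W p.2.1 * a.flux s f p.1 (letters p.2))
      ((volume.restrict (Set.Ioo s t)).prod wordMeasure) := by
  have hm := ((measurable_weight W).comp measurable_snd).mul
    (stronglyMeasurable_flux (a := a) (s := s) hf).measurable
  refine (((integrable_weight_mul_evolve (a := a) hf hs ht hb hW).norm.const_mul
    (2 * ‖a.create‖ ^ 2)).add (integrable_weight_mul_evolve_cons (a := a) hf hs ht hb
      hW).norm).mono' hm.aestronglyMeasurable (ae_of_all _ fun p => ?_)
  have h := ha.gain_le (a.evolve p.1 s f (letters p.2))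
    (a.evolve p.1 s (fun M => f (p.1 ::ₘ M)) (letters p.2))
  simp only [Pi.add_apply, norm_mul, norm_pow,
    Real.norm_eq_abs, abs_norm]
  refine (mul_le_mul_of_nonneg_left h (abs_nonneg _)).trans (le_of_eq ?_)
  ring

/-- The balance of the weighted squared norm. -/
theorem wnorm_evolve (hst : s ≤ t) :
    wnorm W (a.evolve t s f) = wnorm W f + ∫ r in Set.Ioo s t,
      ∫ w : Word, (W (w.1 + 1) - W w.1) * a.flux s f r (letters w) ∂wordMeasure := by
  have hW' : ∀ n, |W (n + 1)| ≤ D * b * b ^ n := fun n => by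
    refine (hW (n + 1)).trans (le_of_eq ?_)
    ring
  have hi := integrable_weight_mul_flux hf hs ht hb hW ha
  have hi' := integrable_weight_mul_flux (W := fun n => W (n + 1)) hf hs ht hb hW' ha
  have hm' : StronglyMeasurable fun p : ℝ × Word =>
      W ((letters p.2).card + 1) * a.flux s f p.1 (letters p.2) := by
    simp only [card_letters]
    exact (((measurable_weight fun n => W (n + 1)).comp measurable_snd).mul
      (stronglyMeasurable_flux (a := a) (s := s) hf).measurable).stronglyMeasurable
  -- In the Mecke formula the word loses the letter `r`, so its old weight becomes `W (n + 1)` in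
  -- terms of the new length `n`.
  obtain ⟨h1, h2⟩ := integrable_and_integral_sum_erase_Ioo (s := s) (t := t)
    (G := fun r M => W (M.card + 1) * a.flux s f r M) hm' (by simpa only [card_letters] using hi')
  have h0 := hf.integrable_weight_mul_norm_sq hW hb
  have h3 := hi.integral_prod_right
  -- The pathwise balance needs distinct letters, hence holds almost everywhere.
  have hpt : ∀ᵐ w ∂wordMeasure, W w.1 * ‖a.evolve t s f (letters w)‖ ^ 2
      = W w.1 * ‖f (letters w)‖ ^ 2 + ((letters w).map fun r => if s < r ∧ r < t then
        W (((letters w).erase r).card + 1) * a.flux s f r ((letters w).erase r) else 0).sum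
      - ∫ r in Set.Ioo s t, W w.1 * a.flux s f r (letters w) := by
    filter_upwards [ae_nodup_letters] with w hw
    rw [(norm_sq_evolve ha hf hst hs ht hw).2, integral_const_mul, mul_sub, mul_add,
      ← Multiset.sum_map_mul_left]
    congr 3
    refine Multiset.map_congr rfl fun r hr => ?_
    rw [card_letters_erase_add_one hr, mul_ite, mul_zero]
  have h4 : ∫ w : Word, (∫ r in Set.Ioo s t, W w.1 * a.flux s f r (letters w)) ∂wordMeasure
      = ∫ r in Set.Ioo s t, ∫ w : Word, W w.1 * a.flux s f r (letters w) ∂wordMeasure :=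
    integral_integral_swap (f := fun w r => W w.1 * a.flux s f r (letters w)) hi.swap
  rw [wnorm, integral_congr_ae hpt]
  refine (integral_sub (h0.add h1) h3).trans ?_
  refine (congrArg₂ _ (integral_add h0 h1) h4).trans ?_
  rw [h2, ← wnorm, add_sub_assoc]
  congr 1
  simp only [card_letters]
  rw [← integral_sub hi'.integral_prod_left hi.integral_prod_left]
  refine integral_congr_ae ?_
  filter_upwards [hi'.prod_right_ae, hi.prod_right_ae] with r hr' hr
  rw [← integral_sub hr' hr]
  simp only [sub_mul]

end

end Coeff

end Energy

/-! ### Polynomial growth of the weighted norms. -/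

/-- The weights of the scale of spaces `Γ_k`. -/
def weight (k n : ℕ) : ℝ := ((n : ℝ) + 1) ^ k

theorem weight_nonneg (k n : ℕ) : 0 ≤ weight k n := by unfold weight; positivity

theorem abs_weight_le (k n : ℕ) : |weight k n| ≤ 1 * (2 ^ k) ^ n := by
  rw [abs_of_nonneg (weight_nonneg k n), weight, one_mul, ← pow_mul, mul_comm k n, pow_mul]
  refine pow_le_pow_left₀ (by positivity) ?_ k
  exact_mod_cast Nat.lt_two_pow_self

theorem weight_le_succ (k n : ℕ) : weight k n ≤ weight (k + 1) n :=
  pow_le_pow_right₀ (by linarith [Nat.cast_nonneg (α := ℝ) n]) (Nat.le_succ k)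

/-- The mean value type bound `(x+1)^{k+1} - x^{k+1} ≤ (k+1)(x+1)^k` at `x = n + 1`; the factor
`2^k` comes from `n + 2 ≤ 2(n + 1)`. -/
theorem weight_succ_sub_le (k n : ℕ) :
    weight (k + 1) (n + 1) - weight (k + 1) n ≤ (k + 1) * 2 ^ k * weight k n := by
  have h : ∀ x : ℝ, 1 ≤ x → ∀ k : ℕ, (x + 1) ^ (k + 1) - x ^ (k + 1) ≤ (k + 1) * (x + 1) ^ k := by
    intro x hx k
    induction k with
    | zero => simp
    | succ k ih =>
      have h1 : x ^ (k + 1) ≤ (x + 1) ^ (k + 1) :=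
        pow_le_pow_left₀ (by linarith) (by linarith) _
      have h2 := mul_le_mul_of_nonneg_left ih (by linarith : 0 ≤ x + 1)
      push_cast
      calc (x + 1) ^ (k + 1 + 1) - x ^ (k + 1 + 1)
          = (x + 1) * ((x + 1) ^ (k + 1) - x ^ (k + 1)) + x ^ (k + 1) := by ring
        _ ≤ (x + 1) * ((k + 1) * (x + 1) ^ k) + (x + 1) ^ (k + 1) := add_le_add h2 h1
        _ = (k + 1 + 1) * (x + 1) ^ (k + 1) := by ring
  have hx : (1 : ℝ) ≤ (n : ℝ) + 1 := by linarith [Nat.cast_nonneg (α := ℝ) n]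
  simp only [weight]
  push_cast
  refine (h _ hx k).trans ?_
  rw [mul_assoc, ← mul_pow]
  exact mul_le_mul_of_nonneg_left (pow_le_pow_left₀ (by linarith) (by linarith) k) (by positivity)

theorem weight_succ_sub_nonneg (k n : ℕ) : 0 ≤ weight k (n + 1) - weight k n := by
  refine sub_nonneg.2 (pow_le_pow_left₀ (by positivity) ?_ k)
  push_cast
  linarith

/-- The polynomials that bound the growth of the weighted norms. -/
def growth (A : ℝ) : ℕ → Polynomial ℝ
  | 0 => 1
  | k + 1 => 1 + Polynomial.C (((k : ℝ) + 1) * 2 ^ k) * growth A k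
      * (Polynomial.C (2 * A ^ 2) * Polynomial.X + 1)

theorem natDegree_growth_le (A : ℝ) (k : ℕ) : (growth A k).natDegree ≤ k := by
  induction k with
  | zero => simp [growth]
  | succ k ih =>
    rw [growth]
    refine (Polynomial.natDegree_add_le _ _).trans (max_le (by simp) ?_)
    refine Polynomial.natDegree_mul_le.trans (add_le_add
      ((Polynomial.natDegree_C_mul_le _ _).trans ih) ?_)
    refine (Polynomial.natDegree_add_le _ _).trans (max_le ?_ (by simp))
    exact (Polynomial.natDegree_C_mul_le _ _).trans Polynomial.natDegree_X_le

theorem eval_growth_succ (A u : ℝ) (k : ℕ) : (growth A (k + 1)).eval u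
    = 1 + (k + 1) * 2 ^ k * (growth A k).eval u * (2 * A ^ 2 * u + 1) := by
  simp [growth]

theorem eval_growth_nonneg (A : ℝ) (k : ℕ) {u : ℝ} (hu : 0 ≤ u) : 0 ≤ (growth A k).eval u := by
  induction k with
  | zero => simp [growth]
  | succ k ih => rw [eval_growth_succ]; positivity

theorem eval_growth_mono (A : ℝ) (k : ℕ) {u v : ℝ} (hu : 0 ≤ u) (huv : u ≤ v) :
    (growth A k).eval u ≤ (growth A k).eval v := by
  induction k with
  | zero => simp [growth]
  | succ k ih =>
    have := eval_growth_nonneg A k hu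
    have := eval_growth_nonneg A k (hu.trans huv)
    rw [eval_growth_succ, eval_growth_succ]
    gcongr

theorem wnorm_nonneg {E : Type*} [NormedAddCommGroup E] (k : ℕ) (f : Multiset ℝ → E) :
    0 ≤ wnorm (weight k) f :=
  integral_nonneg fun _ => mul_nonneg (weight_nonneg k _) (sq_nonneg _)

section Dominated

variable {E : Type*} [NormedAddCommGroup E] {f : Multiset ℝ → E} {C q R s t : ℝ}
  (hf : Dominated f C q R)
include hf

theorem integrable_weight_mul_cons (k : ℕ) :
    Integrable (fun p : ℝ × Word => weight k p.2.1 * ‖f (p.1 ::ₘ letters p.2)‖ ^ 2)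
      ((volume.restrict (Set.Ioo s t)).prod wordMeasure) :=
  integrable_weight_mul_norm_sq_prod (y := fun r M => f (r ::ₘ M)) (C := C * q) (q := q) (R := R)
    (abs_weight_le k) (by positivity) hf.nonneg hf.measurable_cons
    fun r _ M => (hf.cons r).bound M

theorem wnorm_weight_le_succ (k : ℕ) : wnorm (weight k) f ≤ wnorm (weight (k + 1)) f :=
  integral_mono (hf.integrable_weight_mul_norm_sq (abs_weight_le k) (by positivity))
    (hf.integrable_weight_mul_norm_sq (abs_weight_le (k + 1)) (by positivity))
    fun _ => mul_le_mul_of_nonneg_right (weight_le_succ k _) (sq_nonneg _)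

/-- Read backwards, the Mecke formula counts each word of length `n` at most once for each of its
`n` letters, with weight `n^k`, and `n · n^k ≤ (n+1)^{k+1}`. -/
theorem integral_wnorm_cons_le (k : ℕ) :
    ∫ r in Set.Ioo s t, wnorm (weight k) (fun M => f (r ::ₘ M)) ≤ wnorm (weight (k + 1)) f := by
  have hi := integrable_weight_mul_cons (s := s) (t := t) hf k
  have hm : StronglyMeasurable fun p : ℝ × Word =>
      weight k (letters p.2).card * ‖f (p.1 ::ₘ letters p.2)‖ ^ 2 := by
    simp only [card_letters]
    exact (((measurable_weight (weight k)).comp measurable_snd).mul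
      (hf.measurable_cons.norm.measurable.pow_const 2)).stronglyMeasurable
  obtain ⟨h1, h2⟩ := integrable_and_integral_sum_erase_Ioo (s := s) (t := t)
    (G := fun r M => weight k M.card * ‖f (r ::ₘ M)‖ ^ 2) hm (by simpa only [card_letters] using hi)
  simp only [card_letters] at h2
  simp only [wnorm]
  rw [← h2]
  refine integral_mono h1
    (hf.integrable_weight_mul_norm_sq (abs_weight_le (k + 1)) (by positivity)) fun w => ?_
  have hle : ((letters w).map fun r => if s < r ∧ r < t then
      weight k ((letters w).erase r).card * ‖f (r ::ₘ (letters w).erase r)‖ ^ 2 else 0).sum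
      ≤ ((letters w).map fun _ => weight k w.1 * ‖f (letters w)‖ ^ 2).sum := by
    refine Multiset.sum_map_le_sum_map _ _ fun r hr => ?_
    have h0 : 0 ≤ weight k w.1 * ‖f (letters w)‖ ^ 2 :=
      mul_nonneg (weight_nonneg _ _) (sq_nonneg _)
    split_ifs
    · rw [Multiset.cons_erase hr]
      refine mul_le_mul_of_nonneg_right (pow_le_pow_left₀ (by positivity) ?_ k) (sq_nonneg _)
      rw [← card_letters_erase_add_one hr]
      push_cast
      linarith
    · exact h0
  refine hle.trans ?_
  simp only [Multiset.map_const', Multiset.sum_replicate, card_letters, nsmul_eq_mul]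
  rw [← mul_assoc]
  refine mul_le_mul_of_nonneg_right ?_ (sq_nonneg _)
  rw [weight, weight, pow_succ']
  have : 0 ≤ ((w.1 : ℝ) + 1) ^ k := by positivity
  nlinarith

end Dominated

namespace Coeff

variable {𝔨 : Type*} [NormedAddCommGroup 𝔨] [InnerProductSpace ℂ 𝔨] [CompleteSpace 𝔨]
  {a : Coeff 𝔨} (ha : a.Isometric)
include ha

/-- For the constant weight the gains of the words with one more letter exactly balance the losses.
-/
theorem wnorm_evolve_zero {f : Multiset ℝ → 𝔨} {C q R t s : ℝ} (hf : Dominated f C q R)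
    (hs : |s| ≤ R) (ht : |t| ≤ R) (hst : s ≤ t) :
    wnorm (weight 0) (a.evolve t s f) = wnorm (weight 0) f := by
  rw [wnorm_evolve hf hs ht (by positivity) (abs_weight_le 0) ha hst]
  simp [weight]

/-- The polynomial growth of the weighted norms. -/
theorem wnorm_evolve_le {A : ℝ} (hA : ‖a.create‖ ≤ A) (k : ℕ) {f : Multiset ℝ → 𝔨}
    {C q R t s : ℝ} (hf : Dominated f C q R) (hs : |s| ≤ R) (ht : |t| ≤ R) (hst : s ≤ t) :
    wnorm (weight k) (a.evolve t s f) ≤ (growth A k).eval (t - s) * wnorm (weight k) f := by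
  -- The induction hypothesis is needed at intermediate times and also for `f (r ::ₘ ·)`, whose
  -- constant is `C * q`. The bound `A` stays free so that the evolution and its adjoint can share
  -- one polynomial.
  induction k generalizing f C t with
  | zero =>
    rw [wnorm_evolve_zero ha hf hs ht hst]
    simp [growth]
  | succ k ih =>
    have hmem : ∀ r ∈ Set.Ioo s t, |r| ≤ R := fun r hr => by
      rw [abs_le] at hs ht ⊢
      constructor <;> linarith [hr.1, hr.2]
    set c : ℝ := (k + 1) * 2 ^ k with hc
    have hc0 : 0 ≤ c := by positivity
    set P : ℝ := (growth A k).eval (t - s) with hP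
    have hP0 : 0 ≤ P := eval_growth_nonneg A k (sub_nonneg.2 hst)
    have hi1 := integrable_weight_mul_evolve (a := a) hf hs ht (by positivity) (abs_weight_le k)
    have hi2 := integrable_weight_mul_evolve_cons (a := a) hf hs ht (by positivity)
      (abs_weight_le k)
    have hi3 := integrable_weight_mul_cons (s := s) (t := t) hf k
    have hi4 := integrable_weight_mul_flux (a := a) (W := fun n => weight (k + 1) (n + 1)
      - weight (k + 1) n) (D := c) (b := 2 ^ k) hf hs ht (by positivity) (fun n => by
        rw [abs_of_nonneg (weight_succ_sub_nonneg _ _)]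
        refine (weight_succ_sub_le k n).trans (mul_le_mul_of_nonneg_left ?_ hc0)
        exact (le_abs_self _).trans ((abs_weight_le k n).trans_eq (one_mul _))) ha
    -- The increment of the weight of order `k + 1` is at most `c` times the weight of order `k`, so
    -- the flux is controlled by norms of order `k`.
    have hinner : ∀ᵐ r ∂volume.restrict (Set.Ioo s t),
        ∫ w : Word, (weight (k + 1) (w.1 + 1) - weight (k + 1) w.1)
          * a.flux s f r (letters w) ∂wordMeasure
        ≤ c * (2 * A ^ 2 * wnorm (weight k) (a.evolve r s f)
          + wnorm (weight k) (a.evolve r s fun M => f (r ::ₘ M))) := by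
      filter_upwards [hi1.prod_right_ae, hi2.prod_right_ae, hi4.prod_right_ae] with r h1 h2 h4
      rw [wnorm, wnorm, ← integral_const_mul, ← integral_add (h1.const_mul _) h2,
        ← integral_const_mul]
      refine integral_mono h4 (((h1.const_mul _).add h2).const_mul _) fun w => ?_
      have h5 := (le_abs_self _).trans (ha.gain_le (a.evolve r s f (letters w))
        (a.evolve r s (fun M => f (r ::ₘ M)) (letters w)))
      have h6 : ‖a.create‖ ^ 2 ≤ A ^ 2 := pow_le_pow_left₀ (norm_nonneg _) hA 2
      have h7 : a.flux s f r (letters w) ≤ 2 * A ^ 2 * ‖a.evolve r s f (letters w)‖ ^ 2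
          + ‖a.evolve r s (fun M => f (r ::ₘ M)) (letters w)‖ ^ 2 := by
        refine h5.trans (add_le_add ?_ le_rfl)
        exact mul_le_mul_of_nonneg_right (by linarith) (sq_nonneg _)
      calc (weight (k + 1) (w.1 + 1) - weight (k + 1) w.1) * a.flux s f r (letters w)
          ≤ (weight (k + 1) (w.1 + 1) - weight (k + 1) w.1)
            * (2 * A ^ 2 * ‖a.evolve r s f (letters w)‖ ^ 2
            + ‖a.evolve r s (fun M => f (r ::ₘ M)) (letters w)‖ ^ 2) :=
            mul_le_mul_of_nonneg_left h7 (weight_succ_sub_nonneg _ _)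
        _ ≤ c * weight k w.1 * (2 * A ^ 2 * ‖a.evolve r s f (letters w)‖ ^ 2
            + ‖a.evolve r s (fun M => f (r ::ₘ M)) (letters w)‖ ^ 2) :=
            mul_le_mul_of_nonneg_right (weight_succ_sub_le k _) (by positivity)
        _ = _ := by ring
    have hJ1 : IntegrableOn (fun r => wnorm (weight k) (a.evolve r s f)) (Set.Ioo s t) :=
      hi1.integral_prod_left
    have hJ2 : IntegrableOn (fun r => wnorm (weight k) (a.evolve r s fun M => f (r ::ₘ M)))
      (Set.Ioo s t) := hi2.integral_prod_left
    have hJ3 : IntegrableOn (fun r => wnorm (weight k) fun M => f (r ::ₘ M)) (Set.Ioo s t) :=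
      hi3.integral_prod_left
    have hJ4 : IntegrableOn (fun r => ∫ w : Word, (weight (k + 1) (w.1 + 1)
      - weight (k + 1) w.1) * a.flux s f r (letters w) ∂wordMeasure) (Set.Ioo s t) :=
      hi4.integral_prod_left
    have hW0 := wnorm_nonneg k f
    have hstep1 := integral_mono_ae hJ4 (((hJ1.const_mul (2 * A ^ 2)).add hJ2).const_mul c) hinner
    -- The induction hypothesis bounds both norms at time `r`; monotonicity of the polynomial
    -- replaces `r - s` by `t - s`.
    have hstep2 : ∫ r in Set.Ioo s t, c * (2 * A ^ 2 * wnorm (weight k) (a.evolve r s f)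
          + wnorm (weight k) (a.evolve r s fun M => f (r ::ₘ M)))
        ≤ ∫ r in Set.Ioo s t, c * P * (2 * A ^ 2 * wnorm (weight k) f
          + wnorm (weight k) fun M => f (r ::ₘ M)) := by
      refine setIntegral_mono_on (((hJ1.const_mul (2 * A ^ 2)).add hJ2).const_mul c)
        (((integrable_const _).add hJ3).const_mul (c * P)) measurableSet_Ioo fun r hr => ?_
      have hmono : (growth A k).eval (r - s) ≤ P :=
        eval_growth_mono A k (sub_nonneg.2 hr.1.le) (by linarith [hr.2])
      have e1 := (ih hf (hmem r hr) hr.1.le).trans (mul_le_mul_of_nonneg_right hmono hW0)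
      have e2 := (ih (hf.cons r) (hmem r hr) hr.1.le).trans
        (mul_le_mul_of_nonneg_right hmono (wnorm_nonneg k _))
      rw [mul_assoc c P]
      refine mul_le_mul_of_nonneg_left ?_ hc0
      have e3 := mul_le_mul_of_nonneg_left e1 (by positivity : 0 ≤ 2 * A ^ 2)
      linarith
    have hstep3 : ∫ r in Set.Ioo s t, c * P * (2 * A ^ 2 * wnorm (weight k) f
          + wnorm (weight k) fun M => f (r ::ₘ M))
        = c * P * (2 * A ^ 2 * (t - s) * wnorm (weight k) f
          + ∫ r in Set.Ioo s t, wnorm (weight k) fun M => f (r ::ₘ M)) := by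
      rw [integral_const_mul, integral_add (integrable_const _) hJ3, setIntegral_const,
        measureReal_def, Real.volume_Ioo, ENNReal.toReal_ofReal (sub_nonneg.2 hst), smul_eq_mul]
      ring
    have hle1 := wnorm_weight_le_succ hf k
    have hle2 := integral_wnorm_cons_le (s := s) (t := t) hf k
    rw [wnorm_evolve hf hs ht (by positivity) (abs_weight_le (k + 1)) ha hst, eval_growth_succ]
    refine (add_le_add le_rfl (hstep1.trans (hstep2.trans_eq hstep3))).trans ?_
    have hst' : 0 ≤ t - s := sub_nonneg.2 hst
    -- The term from `f` integrates to a factor `t - s`, which raises the degree by one; the term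
    -- from `f (r ::ₘ ·)` integrates to a norm of order `k + 1`. The result is the recursion that
    -- defines `growth`.
    calc wnorm (weight (k + 1)) f + c * P * (2 * A ^ 2 * (t - s) * wnorm (weight k) f
          + ∫ r in Set.Ioo s t, wnorm (weight k) fun M => f (r ::ₘ M))
        ≤ wnorm (weight (k + 1)) f + c * P * (2 * A ^ 2 * (t - s) * wnorm (weight (k + 1)) f
          + wnorm (weight (k + 1)) f) := by gcongr
      _ = _ := by ring

end Coeff

/-! ### The adjoint evolution through reflection of time. -/

theorem Dominated.comp_neg {E : Type*} [NormedAddCommGroup E] {f : Multiset ℝ → E} {C q R : ℝ}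
    (hf : Dominated f C q R) : Dominated (fun M => f (M.map Neg.neg)) C q R where
  meas := by
    simpa only [Function.comp_def, letters_negWord] using
      hf.meas.comp_measurable measurePreserving_negWord.measurable
  nonneg := hf.nonneg
  bound M := by
    refine (hf.bound _).trans (le_of_eq ?_)
    simp only [env, Multiset.map_map, Function.comp_def, abs_neg]

theorem inner_multiset_sum {ι 𝔨 : Type*} [NormedAddCommGroup 𝔨] [InnerProductSpace ℂ 𝔨] (v : 𝔨)
    (X : Multiset ι) (g : ι → 𝔨) :
    inner ℂ v (X.map g).sum = (X.map fun x => inner ℂ v (g x)).sum := by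
  have := map_multiset_sum (innerSL ℂ v) (X.map g)
  rw [Multiset.map_map] at this
  exact this

namespace Coeff

variable {𝔨 : Type*} [NormedAddCommGroup 𝔨] [InnerProductSpace ℂ 𝔨]

/-- The integrand in the matrix element of the evolution. -/
def pairing (a : Coeff 𝔨) (t s : ℝ) (g f : Multiset ℝ → 𝔨) (α β γ υ : Multiset ℝ) : ℂ :=
  inner ℂ (g (α + (β + γ))) (a.ker t s α β υ (f (β + γ + υ)))

variable [CompleteSpace 𝔨]

/-- The coefficients of the adjoint evolution. -/
def dual (a : Coeff 𝔨) : Coeff 𝔨 := ⟨star a.annih, star a.number, star a.create, star a.drift⟩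

/-- Creation and annihilation points change places, because `dual` exchanges their coefficients. -/
theorem star_ker (a : Coeff 𝔨) (t s : ℝ) (α β υ : Multiset ℝ) :
    star (a.ker t s α β υ)
      = a.dual.ker (-s) (-t) (υ.map Neg.neg) (β.map Neg.neg) (α.map Neg.neg) := by
  rw [ker, star_chainKernel, ker]
  congr 1
  simp only [marked, dual, Multiset.map_add, Multiset.map_map, Function.comp_def]
  abel

variable {a : Coeff 𝔨} {f g : Multiset ℝ → 𝔨} {C q R C' q' t s : ℝ} (hf : Dominated f C q R)
  (hg : Dominated g C' q' R)

section Measurable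

include hf hg

theorem stronglyMeasurable_pairing :
    StronglyMeasurable fun p : Word × Word × Word × Word =>
      a.pairing t s g f (letters p.1) (letters p.2.1) (letters p.2.2.1) (letters p.2.2.2) := by
  have h1 := (a.stronglyMeasurable_core_integrand (X := Unit) (τ := fun _ => t)
    (f := fun _ => f) measurable_const (hf.meas.comp_measurable measurable_snd) s).comp_measurable
    (g := fun p : Word × Word × Word × Word => (((), p.1, p.2.1, p.2.2.1), p.2.2.2)) (by fun_prop)
  have h2 := hg.meas.comp_measurable (g := fun p : Word × Word × Word × Word =>
    concat p.1 (concat p.2.1 p.2.2.1)) (measurable_concat.comp (measurable_fst.prodMk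
      (measurable_concat.comp (Measurable.prodMk (by fun_prop) (by fun_prop)))))
  simp only [Function.comp_def, letters_concat] at h1 h2
  exact h2.inner h1

variable (hst : s ≤ t) (hs : |s| ≤ R) (ht : |t| ≤ R)
include hst hs ht

theorem norm_pairing_le (α β γ υ : Multiset ℝ) : ‖a.pairing t s g f α β γ υ‖
    ≤ Real.exp (‖a.drift‖ * (2 * R)) * C * C' * (env (a.size * q') R α
      * (env (a.size * q * q') R β * env (q * q') R γ) * env (a.size * q) R υ) := by
  refine (norm_inner_le_norm _ _).trans ((mul_le_mul (hg.bound _)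
    (norm_core_integrand_le hf hst hs ht α β γ υ) (norm_nonneg _)
    (mul_nonneg hg.const_nonneg (env_nonneg hg.nonneg _ _))).trans (le_of_eq ?_))
  simp only [env_add, ← env_mul]
  ring

theorem integrable_pairing : Integrable (fun p : (Word × Word) × Word × Word =>
    a.pairing t s g f (letters p.1.1) (letters p.2.1) (letters p.2.2) (letters p.1.2))
    ((wordMeasure.prod wordMeasure).prod (wordMeasure.prod wordMeasure)) := by
  have hm := (stronglyMeasurable_pairing (a := a) (s := s) (t := t) hf hg).comp_measurable
    (g := fun p : (Word × Word) × Word × Word => (p.1.1, p.2.1, p.2.2, p.1.2)) (by fun_prop)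
  have hs0 := a.size_nonneg
  have hq := hf.nonneg
  have hq' := hg.nonneg
  have hi := (((integrable_env (q := a.size * q') (by positivity) R).mul_prod
    (integrable_env (q := a.size * q) (by positivity) R)).mul_prod
    ((integrable_env (q := a.size * q * q') (by positivity) R).mul_prod
    (integrable_env (q := q * q') (by positivity) R))).const_mul
    (Real.exp (‖a.drift‖ * (2 * R)) * C * C')
  refine hi.mono' hm.aestronglyMeasurable (ae_of_all _ fun p =>
    (norm_pairing_le hf hg hst hs ht _ _ _ _).trans (le_of_eq ?_))
  ring

theorem integrable_pairing_left (α : Multiset ℝ) : Integrable (fun p : (Word × Word) × Word =>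
    a.pairing t s g f α (letters p.1.1) (letters p.1.2) (letters p.2))
    ((wordMeasure.prod wordMeasure).prod wordMeasure) := by
  obtain ⟨w, rfl⟩ := letters_surjective α
  have hm := (stronglyMeasurable_pairing (a := a) (s := s) (t := t) hf hg).comp_measurable
    (g := fun p : (Word × Word) × Word => (w, p.1.1, p.1.2, p.2)) (by fun_prop)
  have hs0 := a.size_nonneg
  have hq := hf.nonneg
  have hq' := hg.nonneg
  have hi := (((integrable_env (q := a.size * q * q') (by positivity) R).mul_prod
    (integrable_env (q := q * q') (by positivity) R)).mul_prod
    (integrable_env (q := a.size * q) (by positivity) R)).const_mul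
    (Real.exp (‖a.drift‖ * (2 * R)) * C * C' * env (a.size * q') R (letters w))
  refine hi.mono' hm.aestronglyMeasurable (ae_of_all _ fun p =>
    (norm_pairing_le hf hg hst hs ht _ _ _ _).trans (le_of_eq ?_))
  ring

omit hg in
theorem inner_core (α β γ : Multiset ℝ) : inner ℂ (g (α + (β + γ))) (a.core t s f α β γ)
    = ∫ υ, a.pairing t s g f α β γ (letters υ) ∂wordMeasure :=
  (integral_inner (integrable_core_integrand hf hst hs ht α β γ) _).symm

/-- The matrix elements of the evolution. -/
theorem integral_inner_evolve :
    ∫ ω, inner ℂ (g (letters ω)) (a.evolve t s f (letters ω)) ∂wordMeasure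
      = ∫ p : (Word × Word) × Word × Word,
        a.pairing t s g f (letters p.1.1) (letters p.2.1) (letters p.2.2) (letters p.1.2)
          ∂(wordMeasure.prod wordMeasure).prod (wordMeasure.prod wordMeasure) := by
  have hs0 := a.size_nonneg
  have hq := hf.nonneg
  have hq' := hg.nonneg
  have hm1 : StronglyMeasurable fun p : Word × Word =>
      inner ℂ (g (letters p.1 + letters p.2)) (a.innerSum t s f (letters p.1) (letters p.2)) := by
    have h1 := (a.stronglyMeasurable_innerSum (X := Unit) (τ := fun _ => t) (f := fun _ => f)
      measurable_const (hf.meas.comp_measurable measurable_snd) s).comp_measurable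
      (g := fun p : Word × Word => ((), p)) (by fun_prop)
    have h2 := hg.meas.comp_measurable measurable_concat
    simp only [Function.comp_def, letters_concat] at h1 h2
    exact h2.inner h1
  have hi1 : Integrable (fun p : Word × Word => inner ℂ (g (letters p.1 + letters p.2))
      (a.innerSum t s f (letters p.1) (letters p.2))) (wordMeasure.prod wordMeasure) := by
    have hi := ((integrable_env (q := a.size * q') (by positivity) R).mul_prod
      (integrable_env (q := (a.size * q + q) * q') (by positivity) R)).const_mul
      (C' * a.evolveConst C q R)
    refine hi.mono' hm1.aestronglyMeasurable (ae_of_all _ fun p => ?_)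
    refine (norm_inner_le_norm _ _).trans ((mul_le_mul (hg.bound _)
      (norm_innerSum_le hf hst hs ht _ _) (norm_nonneg _)
      (mul_nonneg hg.const_nonneg (env_nonneg hg.nonneg _ _))).trans (le_of_eq ?_))
    simp only [env_add, ← env_mul]
    ring
  -- The two sums over splittings are removed by two applications of the sum-integral formula, here
  -- for `ω = α + δ` and in `e2` for `δ = β + γ`. What remains is an integral over four independent
  -- words.
  have e1 : ∀ ω, inner ℂ (g (letters ω)) (a.evolve t s f (letters ω))
      = ((letters ω).antidiagonal.map fun p =>
        inner ℂ (g (p.1 + p.2)) (a.innerSum t s f p.1 p.2)).sum := fun ω => by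
    rw [evolve, inner_multiset_sum]
    refine congrArg _ (Multiset.map_congr rfl fun p hp => ?_)
    rw [Multiset.mem_antidiagonal.1 hp]
  have e2 : ∀ α, ∫ δ, inner ℂ (g (α + letters δ)) (a.innerSum t s f α (letters δ)) ∂wordMeasure
      = ∫ υ, ∫ p : Word × Word, a.pairing t s g f α (letters p.1) (letters p.2) (letters υ)
        ∂(wordMeasure.prod wordMeasure) ∂wordMeasure := fun α => by
    have hi2 := integrable_pairing_left (a := a) hf hg hst hs ht α
    have e3 : ∀ δ, inner ℂ (g (α + letters δ)) (a.innerSum t s f α (letters δ))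
        = ((letters δ).antidiagonal.map fun p =>
          inner ℂ (g (α + (p.1 + p.2))) (a.core t s f α p.1 p.2)).sum := fun δ => by
      rw [innerSum, inner_multiset_sum]
      refine congrArg _ (Multiset.map_congr rfl fun p hp => ?_)
      rw [Multiset.mem_antidiagonal.1 hp]
    have hm4 : StronglyMeasurable fun p : Word × Word => ∫ υ, a.pairing t s g f α (letters p.1)
        (letters p.2) (letters υ) ∂wordMeasure := by
      obtain ⟨w, rfl⟩ := letters_surjective α
      exact ((stronglyMeasurable_pairing (a := a) (s := s) (t := t) hf hg).comp_measurable
        (g := fun p : (Word × Word) × Word => (w, p.1.1, p.1.2, p.2))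
        (by fun_prop)).integral_prod_right'
    simp only [e3, inner_core hf hst hs ht]
    rw [integral_sum_antidiagonal (H := fun β γ => ∫ υ, a.pairing t s g f α β γ (letters υ)
      ∂wordMeasure) hm4 hi2.integral_prod_left]
    exact integral_integral_swap (f := fun (p : Word × Word) υ =>
      a.pairing t s g f α (letters p.1) (letters p.2) (letters υ)) hi2
  have hi := integrable_pairing (a := a) hf hg hst hs ht
  simp only [e1]
  rw [integral_sum_antidiagonal (H := fun α δ => inner ℂ (g (α + δ)) (a.innerSum t s f α δ)) hm1
    hi1, integral_prod _ hi1]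
  simp only [e2]
  rw [integral_prod _ hi, integral_prod _ hi.integral_prod_left]

end Measurable

/-- Moving the kernel to the other side of the inner product exchanges `f` with `g` and `α` with
`υ`; the letters of `β` and `γ` occur in the arguments of both functions and keep their roles. -/
theorem pairing_dual (a : Coeff 𝔨) (f g : Multiset ℝ → 𝔨) (t s : ℝ) (α β γ υ : Multiset ℝ) :
    (starRingEnd ℂ) (a.dual.pairing (-s) (-t) (fun M => f (M.map Neg.neg))
      (fun M => g (M.map Neg.neg)) (υ.map Neg.neg) (β.map Neg.neg) (γ.map Neg.neg)
      (α.map Neg.neg)) = a.pairing t s g f α β γ υ := by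
  have hn : ∀ M : Multiset ℝ, (M.map Neg.neg).map Neg.neg = M := fun M => by
    simp [Multiset.map_map]
  rw [pairing, pairing, inner_conj_symm, ← star_ker, ContinuousLinearMap.star_eq_adjoint,
    ContinuousLinearMap.adjoint_inner_left]
  simp only [Multiset.map_add, hn]
  congr 2
  · abel_nf
  · congr 1
    abel_nf

include hf hg in
/-- The evolution with the dual coefficients is the adjoint, up to reversal of time. -/
theorem integral_inner_evolve_dual (hst : s ≤ t) (hs : |s| ≤ R) (ht : |t| ≤ R) :
    ∫ ω, inner ℂ (g (letters ω)) (a.evolve t s f (letters ω)) ∂wordMeasure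
      = ∫ ω, inner ℂ (a.dual.evolve (-s) (-t) (fun M => g (M.map Neg.neg))
        ((letters ω).map Neg.neg)) (f (letters ω)) ∂wordMeasure := by
  have hst' : -t ≤ -s := neg_le_neg hst
  have hs' : |-s| ≤ R := by rwa [abs_neg]
  have ht' : |-t| ≤ R := by rwa [abs_neg]
  have hn := measurePreserving_negWord
  have hnn : ∀ M : Multiset ℝ, (M.map Neg.neg).map Neg.neg = M := fun M => by
    simp [Multiset.map_map]
  have hmΨ := ((dominated_evolve (a := a.dual) hg.comp_neg hst' ht' hs').meas.inner
    hf.comp_neg.meas (𝕜 := ℂ))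
  have e1 : ∫ ω, inner ℂ (a.dual.evolve (-s) (-t) (fun M => g (M.map Neg.neg))
        ((letters ω).map Neg.neg)) (f (letters ω)) ∂wordMeasure
      = ∫ ω, inner ℂ (a.dual.evolve (-s) (-t) (fun M => g (M.map Neg.neg))
        (letters ω)) (f ((letters ω).map Neg.neg)) ∂wordMeasure := by
    conv_rhs => rw [← hn.map_eq]
    rw [integral_map hn.aemeasurable hmΨ.aestronglyMeasurable]
    simp only [letters_negWord, hnn]
  -- The change of variables behind the adjoint: reflect all letters and exchange created and
  -- annihilated words.
  have hΦ : MeasurePreserving (fun p : (Word × Word) × Word × Word =>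
      ((negWord p.1.2, negWord p.1.1), (negWord p.2.1, negWord p.2.2)))
      ((wordMeasure.prod wordMeasure).prod (wordMeasure.prod wordMeasure))
      ((wordMeasure.prod wordMeasure).prod (wordMeasure.prod wordMeasure)) :=
    ((hn.prod hn).comp Measure.measurePreserving_swap).prod (hn.prod hn)
  have e2 := integral_inner_evolve (a := a.dual) hg.comp_neg hf.comp_neg hst' ht' hs'
  have e3 : ∫ ω, inner ℂ (a.dual.evolve (-s) (-t) (fun M => g (M.map Neg.neg))
        (letters ω)) (f ((letters ω).map Neg.neg)) ∂wordMeasure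
      = (starRingEnd ℂ) (∫ ω, inner ℂ (f ((letters ω).map Neg.neg)) (a.dual.evolve (-s) (-t)
        (fun M => g (M.map Neg.neg)) (letters ω)) ∂wordMeasure) := by
    rw [← integral_conj]
    simp only [inner_conj_symm]
  have hm := (integrable_pairing (a := a.dual) hg.comp_neg hf.comp_neg hst' ht' hs').1
  rw [e1, e3, e2, ← hΦ.map_eq, integral_map hΦ.aemeasurable (by rwa [hΦ.map_eq]), ← integral_conj,
    integral_inner_evolve hf hg hst hs ht]
  refine integral_congr_ae (ae_of_all _ fun p => ?_)
  simp only [letters_negWord]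
  exact (pairing_dual a f g t s _ _ _ _).symm

end Coeff

/-! ### Consequences of the unitarity conditions. -/

namespace Coeff

variable {𝔨 : Type*} [NormedAddCommGroup 𝔨] [InnerProductSpace ℂ 𝔨] [CompleteSpace 𝔨]

/-- The unitarity conditions on the coefficients. -/
def IsUnitary (a : Coeff 𝔨) : Prop := UnitarityConditions a.create a.number a.annih a.drift

/-- `Υ` is replaced by its adjoint, and the two expressions for `B + B⁺` change places. -/
theorem IsUnitary.dual {a : Coeff 𝔨} (h : a.IsUnitary) : a.dual.IsUnitary := by
  obtain ⟨Υ, hΥ, h0, h1, h2, h3⟩ := h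
  have hΥ1 : star Υ * Υ = 1 := (Unitary.mem_iff.1 hΥ).1
  refine ⟨star Υ, Unitary.star_mem hΥ, ?_, ?_, ?_, ?_⟩
  · simp only [Coeff.dual, h0, star_sub, star_one]
  · simp only [Coeff.dual, h1, star_star, mul_neg, neg_neg, ← mul_assoc, hΥ1, one_mul]
  · simp only [Coeff.dual, star_star]
    rw [add_comm, h3]
  · simp only [Coeff.dual, star_star]
    rw [add_comm, h2]

/-- `1 + A₀ = Υ` is an isometry, `A₋₁ = -A₁⁺Υ` follows from the relation for `A₁`, and the real part
of `⟨y, By⟩` is half of `⟨y, (B + B⁺)y⟩ = -‖A₁y‖²`. -/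
theorem IsUnitary.isometric {a : Coeff 𝔨} (h : a.IsUnitary) : a.Isometric := by
  obtain ⟨Υ, hΥ, h0, h1, h2, h3⟩ := h
  have hn : ∀ v, v + a.number v = Υ v := fun v => by simp [h0]
  have hΥ1 : star Υ * Υ = 1 := (Unitary.mem_iff.1 hΥ).1
  have hm : a.annih = -(star a.create * Υ) := by
    rw [h1]
    simp only [star_neg, star_mul, star_star, neg_mul, neg_neg, mul_assoc, hΥ1, mul_one]
  have hre : ∀ x y : 𝔨, @inner ℝ 𝔨 realInnerProductSpace.toInner x y = RCLike.re (inner ℂ x y) :=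
    fun x y => rfl
  refine ⟨fun v => ?_, fun y v => ?_, fun y => ?_⟩
  · rw [hn]
    exact (Unitary.norm_map (⟨Υ, hΥ⟩ : unitary (𝔨 →L[ℂ] 𝔨)) v)
  · rw [hre, hre, hn, hm]
    simp only [neg_apply, inner_neg_right, map_neg, ContinuousLinearMap.star_eq_adjoint,
      mul_apply_eq_comp, ContinuousLinearMap.adjoint_inner_right]
  · have e : inner ℂ y ((a.drift + star a.drift) y) = inner ℂ y ((-(star a.create * a.create)) y) := by
      rw [h2]
    have e1 := congrArg RCLike.re e
    simp only [add_apply, neg_apply, inner_neg_right, inner_add_right, map_add, map_neg,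
      ContinuousLinearMap.star_eq_adjoint, mul_apply_eq_comp,
      ContinuousLinearMap.adjoint_inner_right] at e1
    rw [inner_re_symm (a.drift y) y, inner_self_eq_norm_sq] at e1
    rw [hre, two_mul]
    exact e1

end Coeff

/-! ### Tame functions and their classes in the Fock space. -/

section Tame

variable {E : Type*} [NormedAddCommGroup E] {f g : Multiset ℝ → E} {C q R C' q' R' : ℝ}

theorem Dominated.add (hf : Dominated f C q R) (hg : Dominated g C' q' R') :
    Dominated (f + g) (C + C') (max q q') (max R R') where
  meas := hf.meas.add hg.meas
  nonneg := hf.nonneg.trans (le_max_left _ _)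
  bound M := by
    rw [add_mul]
    exact (norm_add_le _ _).trans (add_le_add
      ((hf.mono le_rfl (le_max_left _ _) (le_max_left _ _)).bound M)
      ((hg.mono le_rfl (le_max_right _ _) (le_max_right _ _)).bound M))

theorem Dominated.const_smul [NormedSpace ℂ E] (hf : Dominated f C q R) (c : ℂ) :
    Dominated (c • f) (‖c‖ * C) q R where
  meas := hf.meas.const_smul c
  nonneg := hf.nonneg
  bound M := by
    rw [Pi.smul_apply, norm_smul, mul_assoc]
    exact mul_le_mul_of_nonneg_left (hf.bound M) (norm_nonneg c)

theorem Dominated.memLp (hf : Dominated f C q R) :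
    MemLp (fun w => f (letters w)) 2 wordMeasure := by
  rw [memLp_two_iff_integrable_sq_norm hf.meas.aestronglyMeasurable]
  simpa [weight] using hf.integrable_weight_mul_norm_sq (abs_weight_le 0) (by positivity)

variable (E) in
/-- The measurable functions of sets of letters that are of exponential type and vanish unless all
letters are in a bounded set. -/
def tame [NormedSpace ℂ E] : Submodule ℂ (Multiset ℝ → E) where
  carrier := {f | ∃ C q R, Dominated f C q R}
  zero_mem' := ⟨0, 0, 0, stronglyMeasurable_const, le_rfl, fun M => by simp⟩
  add_mem' := by
    rintro f g ⟨C, q, R, hf⟩ ⟨C', q', R', hg⟩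
    exact ⟨_, _, _, hf.add hg⟩
  smul_mem' := by
    rintro c f ⟨C, q, R, hf⟩
    exact ⟨_, _, _, hf.const_smul c⟩

variable {𝔨 : Type*} [NormedAddCommGroup 𝔨] [InnerProductSpace ℂ 𝔨]

theorem memLp_of_mem_tame (f : tame 𝔨) : MemLp (fun w => (f : Multiset ℝ → 𝔨) (letters w)) 2
    wordMeasure := by
  obtain ⟨C, q, R, hf⟩ := f.2
  exact hf.memLp

variable (𝔨) in
/-- The class of a function of sets of letters in the Fock space. -/
def toFock : tame 𝔨 →ₗ[ℂ] Fock 𝔨 where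
  toFun f := ⟨(memLp_of_mem_tame f).toLp _, fun p => by
    have h := (memLp_of_mem_tame f).coeFn_toLp
    have h' := (measurePreserving_permWord p).quasiMeasurePreserving.ae_eq_comp h
    refine h'.trans (Filter.EventuallyEq.trans (ae_of_all _ fun w => ?_) h.symm)
    simp [letters_permWord]⟩
  map_add' f g := Subtype.ext ((memLp_of_mem_tame f).toLp_add (memLp_of_mem_tame g))
  map_smul' c f := Subtype.ext ((memLp_of_mem_tame f).toLp_const_smul c)

theorem rep_toFock (f : tame 𝔨) :
    rep (toFock 𝔨 f) =ᵐ[wordMeasure] fun w => (f : Multiset ℝ → 𝔨) (letters w) :=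
  (memLp_of_mem_tame f).coeFn_toLp

theorem Fock_ext {f g : Fock 𝔨} (h : rep f =ᵐ[wordMeasure] rep g) : f = g :=
  Subtype.ext (Lp.ext h)

theorem toFock_eq_iff {f : tame 𝔨} {g : Fock 𝔨} :
    toFock 𝔨 f = g ↔ rep g =ᵐ[wordMeasure] fun w => (f : Multiset ℝ → 𝔨) (letters w) :=
  ⟨fun h => h ▸ rep_toFock f, fun h => Fock_ext ((rep_toFock f).trans h.symm)⟩

theorem inner_toFock (f g : tame 𝔨) : inner ℂ (toFock 𝔨 f) (toFock 𝔨 g)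
    = ∫ w, inner ℂ ((f : Multiset ℝ → 𝔨) (letters w)) ((g : Multiset ℝ → 𝔨) (letters w))
      ∂wordMeasure := by
  rw [Submodule.coe_inner, L2.inner_def]
  refine integral_congr_ae ?_
  filter_upwards [rep_toFock f, rep_toFock g] with w h1 h2
  rw [← h1, ← h2]
  rfl

theorem norm_sq_Fock (f : Fock 𝔨) : ‖f‖ ^ 2 = ∫ w, ‖rep f w‖ ^ 2 ∂wordMeasure := by
  have h : (RCLike.re (inner ℂ f f) : ℝ) = ‖f‖ ^ 2 := inner_self_eq_norm_sq f
  rw [← h, Submodule.coe_inner, L2.inner_def, ← integral_re (L2.integrable_inner _ _)]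
  refine integral_congr_ae (ae_of_all _ fun w => ?_)
  exact inner_self_eq_norm_sq _

theorem norm_sq_toFock (f : tame 𝔨) : ‖toFock 𝔨 f‖ ^ 2 = wnorm (weight 0) (f : Multiset ℝ → 𝔨) := by
  rw [norm_sq_Fock, wnorm]
  refine integral_congr_ae ?_
  filter_upwards [rep_toFock f] with w h
  simp [weight, h]

end Tame

variable {𝔨 : Type*} [NormedAddCommGroup 𝔨] [InnerProductSpace ℂ 𝔨]

/-- The radius can be enlarged to contain the two times of the evolution and to be common to two
functions. -/
theorem exists_dominated_of_mem_tame (f : tame 𝔨) (r : ℝ) :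
    ∃ C q R, r ≤ R ∧ Dominated (f : Multiset ℝ → 𝔨) C q R := by
  obtain ⟨C, q, R, hf⟩ := f.2
  exact ⟨C, q, max r R, le_max_left _ _, hf.mono le_rfl le_rfl (le_max_right _ _)⟩

variable (𝔨) in
/-- The reflection of the letters. -/
def reflect : tame 𝔨 →ₗ[ℂ] tame 𝔨 where
  toFun f := ⟨fun M => (f : Multiset ℝ → 𝔨) (M.map Neg.neg), by
    obtain ⟨C, q, R, hf⟩ := f.2
    exact ⟨C, q, R, hf.comp_neg⟩⟩
  map_add' _ _ := rfl
  map_smul' _ _ := rfl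

theorem wnorm_reflect (k : ℕ) (f : tame 𝔨) :
    wnorm (weight k) (reflect 𝔨 f : Multiset ℝ → 𝔨) = wnorm (weight k) (f : Multiset ℝ → 𝔨) := by
  obtain ⟨C, q, R, hf⟩ := f.2
  have hn := measurePreserving_negWord
  have hm := (hf.integrable_weight_mul_norm_sq (abs_weight_le k) (by positivity)).1
  rw [wnorm, wnorm]
  conv_rhs => rw [← hn.map_eq]
  rw [integral_map hn.aemeasurable (by rwa [hn.map_eq])]
  simp only [letters_negWord]
  rfl

/-! ### The evolution and its adjoint as linear maps on tame functions. -/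

namespace Coeff

variable [CompleteSpace 𝔨] (a : Coeff 𝔨)

section Linear

variable {f g : Multiset ℝ → 𝔨} {C q C' q' R t s : ℝ}

theorem evolve_add (hf : Dominated f C q R) (hg : Dominated g C' q' R) (hst : s ≤ t)
    (hs : |s| ≤ R) (ht : |t| ≤ R) : a.evolve t s (f + g) = a.evolve t s f + a.evolve t s g := by
  have h : ∀ α β γ, a.core t s (f + g) α β γ = a.core t s f α β γ + a.core t s g α β γ :=
    fun α β γ => by
      simp only [core, Pi.add_apply, map_add]
      exact integral_add (integrable_core_integrand hf hst hs ht α β γ)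
        (integrable_core_integrand hg hst hs ht α β γ)
  funext X
  simp only [evolve, innerSum, h, Multiset.sum_map_add, Pi.add_apply]

omit [CompleteSpace 𝔨] in
theorem evolve_smul (c : ℂ) : a.evolve t s (c • f) = c • a.evolve t s f := by
  have h : ∀ α β γ, a.core t s (c • f) α β γ = c • a.core t s f α β γ := fun α β γ => by
    simp only [core, Pi.smul_apply, map_smul]
    exact integral_smul c _
  funext X
  simp only [evolve, innerSum, h, Multiset.smul_sum, Multiset.map_map, Pi.smul_apply,
    Function.comp_def]

end Linear

/-- The evolution as a linear map. -/
def evolution {t s : ℝ} (hst : s ≤ t) : tame 𝔨 →ₗ[ℂ] tame 𝔨 where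
  toFun f := ⟨a.evolve t s f, by
    obtain ⟨C, q, R, hR, hf⟩ := exists_dominated_of_mem_tame f (max |s| |t|)
    exact ⟨_, _, _, dominated_evolve hf hst ((le_max_left _ _).trans hR)
      ((le_max_right _ _).trans hR)⟩⟩
  map_add' f g := by
    obtain ⟨C, q, R, hR, hf⟩ := exists_dominated_of_mem_tame f (max |s| |t|)
    obtain ⟨C', q', R', hR', hg⟩ := exists_dominated_of_mem_tame g R
    exact Subtype.ext (a.evolve_add (hf.mono le_rfl le_rfl hR') hg hst
      ((le_max_left _ _).trans (hR.trans hR')) ((le_max_right _ _).trans (hR.trans hR')))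
  map_smul' c f := Subtype.ext (a.evolve_smul c)

/-- The adjoint of the evolution as a linear map. -/
def evolutionAdjoint {t s : ℝ} (hst : s ≤ t) : tame 𝔨 →ₗ[ℂ] tame 𝔨 :=
  reflect 𝔨 ∘ₗ a.dual.evolution (neg_le_neg hst) ∘ₗ reflect 𝔨

variable {a} (ha : a.IsUnitary) {t s : ℝ} (hst : s ≤ t)

theorem inner_toFock_evolution (f g : tame 𝔨) :
    inner ℂ (toFock 𝔨 g) (toFock 𝔨 (a.evolution hst f))
      = inner ℂ (toFock 𝔨 (a.evolutionAdjoint hst g)) (toFock 𝔨 f) := by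
  obtain ⟨C, q, R, hR, hf⟩ := exists_dominated_of_mem_tame f (max |s| |t|)
  obtain ⟨C', q', R', hR', hg⟩ := exists_dominated_of_mem_tame g R
  rw [inner_toFock, inner_toFock]
  exact integral_inner_evolve_dual (hf.mono le_rfl le_rfl hR') hg hst
    ((le_max_left _ _).trans (hR.trans hR')) ((le_max_right _ _).trans (hR.trans hR'))

include ha

theorem wnorm_evolution_le {A : ℝ} (hA : ‖a.create‖ ≤ A) (k : ℕ) (f : tame 𝔨) :
    wnorm (weight k) (a.evolution hst f : Multiset ℝ → 𝔨)
      ≤ (growth A k).eval (t - s) * wnorm (weight k) (f : Multiset ℝ → 𝔨) := by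
  obtain ⟨C, q, R, hR, hf⟩ := exists_dominated_of_mem_tame f (max |s| |t|)
  exact wnorm_evolve_le ha.isometric hA k hf ((le_max_left _ _).trans hR)
    ((le_max_right _ _).trans hR) hst

theorem wnorm_evolutionAdjoint_le {A : ℝ} (hA : ‖a.dual.create‖ ≤ A) (k : ℕ) (f : tame 𝔨) :
    wnorm (weight k) (a.evolutionAdjoint hst f : Multiset ℝ → 𝔨)
      ≤ (growth A k).eval (t - s) * wnorm (weight k) (f : Multiset ℝ → 𝔨) := by
  rw [evolutionAdjoint, LinearMap.comp_apply, wnorm_reflect]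
  refine (wnorm_evolution_le ha.dual (neg_le_neg hst) hA k _).trans (le_of_eq ?_)
  rw [wnorm_reflect]
  congr 2
  ring

theorem norm_toFock_evolution (f : tame 𝔨) : ‖toFock 𝔨 (a.evolution hst f)‖ = ‖toFock 𝔨 f‖ := by
  obtain ⟨C, q, R, hR, hf⟩ := exists_dominated_of_mem_tame f (max |s| |t|)
  rw [← sq_eq_sq₀ (norm_nonneg _) (norm_nonneg _), norm_sq_toFock, norm_sq_toFock]
  exact wnorm_evolve_zero ha.isometric hf ((le_max_left _ _).trans hR)
    ((le_max_right _ _).trans hR) hst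

/-- The adjoint is a dual evolution between two reflections, and all three preserve the norm. -/
theorem norm_toFock_evolutionAdjoint (f : tame 𝔨) :
    ‖toFock 𝔨 (a.evolutionAdjoint hst f)‖ = ‖toFock 𝔨 f‖ := by
  have h := norm_toFock_evolution ha.dual (neg_le_neg hst) (reflect 𝔨 f)
  rw [← sq_eq_sq₀ (norm_nonneg _) (norm_nonneg _), norm_sq_toFock, norm_sq_toFock] at h ⊢
  rw [evolutionAdjoint, LinearMap.comp_apply, wnorm_reflect, LinearMap.comp_apply, h,
    wnorm_reflect]

end Coeff

/-! ### Extension from a dense subspace to a unitary operator. -/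

section Extension

variable {V H : Type*} [AddCommGroup V] [Module ℂ V] [NormedAddCommGroup H] [InnerProductSpace ℂ H]
  [CompleteSpace H] {ι : V →ₗ[ℂ] H} {T T' : V →ₗ[ℂ] V}

/-- Two densely defined isometries that are adjoint to each other extend to a unitary operator
and its inverse. -/
theorem exists_unitary_extension (hι : DenseRange ι) (hT : ∀ v, ‖ι (T v)‖ = ‖ι v‖)
    (hT' : ∀ v, ‖ι (T' v)‖ = ‖ι v‖)
    (hadj : ∀ v w, inner ℂ (ι w) (ι (T v)) = inner ℂ (ι (T' w)) (ι v)) :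
    ∃ U : H ≃ₗᵢ[ℂ] H, (∀ v, U (ι v) = ι (T v)) ∧ ∀ v, U.symm (ι v) = ι (T' v) := by
  have hbd : ∀ {S : V →ₗ[ℂ] V}, (∀ v, ‖ι (S v)‖ = ‖ι v‖) →
      ∃ L : H →L[ℂ] H, (∀ v, L (ι v) = ι (S v)) ∧ ∀ x, ‖L x‖ = ‖x‖ := by
    intro S hS
    have hC : ∀ v, ‖(ι ∘ₗ S) v‖ ≤ 1 * ‖ι v‖ := fun v => by rw [one_mul]; exact (hS v).le
    have hL : ∀ v, (ι ∘ₗ S).extendOfNorm ι (ι v) = ι (S v) := fun v =>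
      LinearMap.extendOfNorm_eq hι ⟨1, hC⟩ v
    refine ⟨(ι ∘ₗ S).extendOfNorm ι, hL, fun x => ?_⟩
    refine hι.induction_on (p := fun x => ‖(ι ∘ₗ S).extendOfNorm ι x‖ = ‖x‖) x
      (isClosed_eq (by fun_prop) continuous_norm) fun v => ?_
    rw [hL, hS]
  obtain ⟨L, hL, hLn⟩ := hbd hT
  obtain ⟨L', hL', hLn'⟩ := hbd hT'
  have hLL : ∀ x y, inner ℂ y (L x) = inner ℂ (L' y) x := by
    intro x y
    refine hι.induction_on₂ (p := fun x y => inner ℂ y (L x) = inner ℂ (L' y) x)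
      (isClosed_eq (by fun_prop) (by fun_prop)) (fun v w => ?_) x y
    rw [hL, hL', hadj]
  -- `⟨L'Lx, y⟩ = ⟨Lx, Ly⟩ = ⟨x, y⟩`, since `L'` is the adjoint of the isometry `L`; the other
  -- composition is treated in the same way.
  have hinv : ∀ x, L' (L x) = x := fun x => by
    refine ext_inner_right ℂ fun y => ?_
    rw [← hLL]
    exact (⟨L.toLinearMap, hLn⟩ : H →ₗᵢ[ℂ] H).inner_map_map x y
  have hinv' : ∀ x, L (L' x) = x := fun x => by
    refine ext_inner_left ℂ fun y => ?_
    rw [hLL]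
    exact (⟨L'.toLinearMap, hLn'⟩ : H →ₗᵢ[ℂ] H).inner_map_map y x
  exact ⟨⟨LinearEquiv.ofLinearMap L.toLinearMap L'.toLinearMap (LinearMap.ext hinv')
    (LinearMap.ext hinv), hLn⟩, hL, hL'⟩

end Extension

/-! ### Test functions -/

section Test

variable {E : Type*} [NormedAddCommGroup E]

/-- The support is compact and covered by the increasing open sets of words with all letters less
than `m` in absolute value, so one of them contains it. -/
theorem exists_bound_letters_of_hasCompactSupport {f : Word → E} (hf : HasCompactSupport f) :
    ∃ R : ℝ, ∀ w, f w ≠ 0 → ∀ r ∈ letters w, |r| ≤ R := by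
  have hU : ∀ m : ℕ, IsOpen {w : Word | ‖w.2‖ < m} := fun m => by
    rw [isOpen_sigma_iff]
    intro n
    exact isOpen_lt (f := fun x : Fin n → ℝ => ‖x‖) continuous_norm continuous_const
  have hmono : Monotone fun m : ℕ => {w : Word | ‖w.2‖ < m} := by
    intro m n h w hw
    rw [Set.mem_ofPred_eq] at hw ⊢
    exact hw.trans_le (Nat.cast_le.2 h)
  obtain ⟨m, hm⟩ := hf.isCompact.elim_directed_cover (fun m : ℕ => {w : Word | ‖w.2‖ < m}) hU
    (fun w _ => by
      obtain ⟨m, hm⟩ := exists_nat_gt ‖w.2‖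
      exact Set.mem_iUnion.2 ⟨m, hm⟩)
    hmono.directed_le
  refine ⟨m, fun w hw r hr => ?_⟩
  have h1 : ‖w.2‖ < m := hm (subset_tsupport f hw)
  obtain ⟨i, rfl⟩ := mem_letters.1 hr
  exact (norm_le_pi_norm w.2 i).trans h1.le

/-- A symmetric function on words as a function of sets of letters. -/
def ofSymm (f : Word → E) (M : Multiset ℝ) : E := f (Function.surjInv letters_surjective M)

omit [NormedAddCommGroup E] in
theorem ofSymm_letters {f : Word → E} (hf : ∀ p w, f (permWord p w) = f w) (w : Word) :
    ofSymm f (letters w) = f w := by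
  obtain ⟨p, hp⟩ := exists_permWord_of_letters_eq
    (Function.surjInv_eq letters_surjective (letters w)).symm
  rw [ofSymm, hp, hf]

variable [NormedSpace ℂ E]

/-- A bounded function needs no growth in the number of letters, hence `q = 1`. -/
theorem ofSymm_mem_tame {f : Word → E} (hc : Continuous f) (hs : HasCompactSupport f)
    (hf : ∀ p w, f (permWord p w) = f w) : ofSymm f ∈ tame E := by
  obtain ⟨C, hC⟩ := hc.bounded_above_of_compact_support hs
  obtain ⟨R, hR⟩ := exists_bound_letters_of_hasCompactSupport hs
  refine ⟨C, 1, R, ?_, zero_le_one, fun M => ?_⟩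
  · simp only [ofSymm_letters hf]
    exact stronglyMeasurable_of_comp_mkWord fun n =>
      (hc.comp continuous_sigmaMk).stronglyMeasurable
  · obtain ⟨w, rfl⟩ := letters_surjective M
    rw [ofSymm_letters hf]
    by_cases h : f w = 0
    · rw [h, norm_zero]
      exact mul_nonneg ((norm_nonneg _).trans (hC w)) (env_nonneg zero_le_one _ _)
    · rw [env_eq_pow (hR w h), one_pow, mul_one]
      exact hC w

end Test

/-! ### Density of the test functions in the Fock space. -/

/-- The function on words that vanishes unless the length is `n`. -/
def sectorFun {E : Type*} [Zero E] (n : ℕ) (φ : (Fin n → ℝ) → E) (w : Word) : E :=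
  if h : w.1 = n then φ fun i => w.2 (Fin.cast h.symm i) else 0

section Sector

variable {E : Type*} [NormedAddCommGroup E] {n : ℕ} {φ : (Fin n → ℝ) → E}

theorem sectorFun_mkWord (φ : (Fin n → ℝ) → E) (x : Fin n → ℝ) :
    sectorFun n φ (mkWord n x) = φ x := by
  simp [sectorFun, mkWord]

theorem sectorFun_of_ne (φ : (Fin n → ℝ) → E) {w : Word} (h : w.1 ≠ n) : sectorFun n φ w = 0 := by
  simp [sectorFun, h]

/-- The symmetrization of a function on words of length `n`. -/
def symSectorFun (n : ℕ) (φ : (Fin n → ℝ) → E) (w : Word) : E :=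
  ∑ σ : Equiv.Perm (Fin n), sectorFun n φ (permWord (Function.update (fun _ => 1) n σ) w)

theorem permWord_update_mkWord (σ : Equiv.Perm (Fin n)) (x : Fin n → ℝ) :
    permWord (Function.update (fun _ => 1) n σ) (mkWord n x) = mkWord n (x ∘ σ) := by
  simp only [permWord, mkWord, Function.update_self]
  rfl

theorem symSectorFun_mkWord (φ : (Fin n → ℝ) → E) (x : Fin n → ℝ) :
    symSectorFun n φ (mkWord n x) = ∑ σ : Equiv.Perm (Fin n), φ (x ∘ σ) := by
  simp only [symSectorFun, permWord_update_mkWord, sectorFun_mkWord]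

theorem symSectorFun_of_ne (φ : (Fin n → ℝ) → E) {w : Word} (h : w.1 ≠ n) :
    symSectorFun n φ w = 0 :=
  Finset.sum_eq_zero fun _ _ => sectorFun_of_ne φ h

/-- Continuity is tested on each `ℝᵐ`; the support lies in the finite union of the permuted copies
of the support of `φ`. Composing with a permutation only reindexes the sum. -/
theorem symSectorFun_mem_testFunctions {𝔨 : Type*} [NormedAddCommGroup 𝔨] [InnerProductSpace ℂ 𝔨]
    {φ : (Fin n → ℝ) → 𝔨} (hc : Continuous φ) (hs : HasCompactSupport φ) :
    symSectorFun n φ ∈ testFunctions 𝔨 := by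
  refine ⟨?_, ?_, ?_⟩
  · rw [continuous_sigma_iff]
    intro m
    by_cases h : m = n
    · subst h
      refine (continuous_finsetSum _ fun σ _ => hc.comp ?_).congr fun x =>
        (symSectorFun_mkWord φ x).symm
      fun_prop
    · refine (continuous_const (y := 0)).congr fun x => (symSectorFun_of_ne φ ?_).symm
      exact h
  · have hK : IsCompact (⋃ σ : Equiv.Perm (Fin n),
        (fun z : Fin n → ℝ => mkWord n (z ∘ σ.symm)) '' tsupport φ) := by
      refine isCompact_iUnion fun σ => hs.isCompact.image ?_
      exact continuous_sigmaMk.comp (by fun_prop)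
    refine HasCompactSupport.intro hK fun w hw => ?_
    by_cases h : w.1 = n
    · obtain ⟨m, x⟩ := w
      obtain rfl : m = n := h
      refine (symSectorFun_mkWord φ x).trans (Finset.sum_eq_zero fun σ _ => ?_)
      refine image_eq_zero_of_notMem_tsupport fun hx => hw ?_
      refine Set.mem_iUnion.2 ⟨σ, x ∘ σ, hx, ?_⟩
      simp [mkWord, Function.comp_assoc]
    · exact symSectorFun_of_ne φ h
  · intro p w
    by_cases h : w.1 = n
    · obtain ⟨m, x⟩ := w
      obtain rfl : m = n := h
      refine (symSectorFun_mkWord φ (x ∘ p m)).trans (Eq.trans ?_ (symSectorFun_mkWord φ x).symm)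
      exact Equiv.sum_comp (Equiv.mulLeft (p m)) fun σ => φ (x ∘ σ)
    · rw [symSectorFun_of_ne φ h, symSectorFun_of_ne φ (w := permWord p w) h]

end Sector

section Density

variable {𝔨 : Type*} [NormedAddCommGroup 𝔨] [InnerProductSpace ℂ 𝔨]

variable (𝔨) in
/-- The classes of test functions. -/
def testFock : Submodule ℂ (Fock 𝔨) where
  carrier := {g | ∃ f ∈ testFunctions 𝔨, rep g =ᵐ[wordMeasure] f}
  zero_mem' := ⟨0, ⟨continuous_const, HasCompactSupport.zero, fun _ _ => rfl⟩,
    Lp.coeFn_zero 𝔨 2 wordMeasure⟩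
  add_mem' := by
    rintro g g' ⟨f, ⟨hf1, hf2, hf3⟩, hg⟩ ⟨f', ⟨hf1', hf2', hf3'⟩, hg'⟩
    refine ⟨f + f', ⟨hf1.add hf1', hf2.add hf2', fun p w => ?_⟩,
      (Lp.coeFn_add (g : Lp 𝔨 2 wordMeasure) g').trans (hg.add hg')⟩
    simp only [Pi.add_apply, hf3, hf3']
  smul_mem' := by
    rintro c g ⟨f, ⟨hf1, hf2, hf3⟩, hg⟩
    refine ⟨c • f, ⟨hf1.const_smul c, hf2.smul_left (f := fun _ => c), fun p w => ?_⟩,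
      (Lp.coeFn_smul c (g : Lp 𝔨 2 wordMeasure)).trans (hg.const_smul c)⟩
    simp only [Pi.smul_apply, hf3]

theorem exists_tame_of_mem_testFunctions {f : Word → 𝔨} (hf : f ∈ testFunctions 𝔨) :
    ∃ h : tame 𝔨, ∀ w, (h : Multiset ℝ → 𝔨) (letters w) = f w :=
  ⟨⟨ofSymm f, ofSymm_mem_tame hf.1 hf.2.1 hf.2.2⟩, ofSymm_letters hf.2.2⟩

theorem exists_fock_of_mem_testFunctions {f : Word → 𝔨} (hf : f ∈ testFunctions 𝔨) :
    ∃ g ∈ testFock 𝔨, rep g =ᵐ[wordMeasure] f := by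
  obtain ⟨h, hh⟩ := exists_tame_of_mem_testFunctions hf
  have h1 : rep (toFock 𝔨 h) =ᵐ[wordMeasure] f :=
    (rep_toFock h).trans (ae_of_all _ hh)
  exact ⟨toFock 𝔨 h, ⟨f, hf, h1⟩, h1⟩

theorem testFock_le_range : testFock 𝔨 ≤ LinearMap.range (toFock 𝔨) := by
  rintro g ⟨f, hf, hg⟩
  obtain ⟨h, hh⟩ := exists_tame_of_mem_testFunctions hf
  exact ⟨h, toFock_eq_iff.2 (hg.trans (ae_of_all _ fun w => (hh w).symm))⟩

theorem memLp_rep (g : Fock 𝔨) : MemLp (rep g) 2 wordMeasure := Lp.memLp _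

theorem memLp_rep_mkWord (g : Fock 𝔨) (n : ℕ) :
    MemLp (fun x => rep g (mkWord n x)) 2 (volume : Measure (Fin n → ℝ)) := by
  -- Lebesgue measure on `ℝⁿ` is one of the summands of the word measure, up to the factor `n!`.
  have h : (volume : Measure (Fin n → ℝ)).map (mkWord n) ≤ (n.factorial : ℝ≥0∞) • wordMeasure := by
    have h1 := Measure.le_sum (fun n : ℕ =>
      ((n.factorial : ℝ≥0∞)⁻¹) • (volume : Measure (Fin n → ℝ)).map (mkWord n)) n
    rw [← wordMeasure_eq_sum] at h1
    calc (volume : Measure (Fin n → ℝ)).map (mkWord n)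
        = (n.factorial : ℝ≥0∞) • ((n.factorial : ℝ≥0∞)⁻¹)
          • (volume : Measure (Fin n → ℝ)).map (mkWord n) := by
          rw [smul_smul, ENNReal.mul_inv_cancel (by simp [n.factorial_ne_zero]) (by simp), one_smul]
      _ ≤ _ := by gcongr
  exact ((memLp_rep g).of_measure_le_smul (by simp) h).comp_of_map (measurable_mkWord n).aemeasurable

omit [InnerProductSpace ℂ 𝔨] in
theorem stronglyMeasurable_sectorFun {n : ℕ} {φ : (Fin n → ℝ) → 𝔨} (hc : Continuous φ) :
    StronglyMeasurable (sectorFun n φ) := by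
  refine stronglyMeasurable_of_comp_mkWord fun m => ?_
  by_cases h : m = n
  · subst h
    simp only [sectorFun_mkWord]
    exact hc.stronglyMeasurable
  · have : (fun x => sectorFun n φ (mkWord m x)) = fun _ => 0 := funext fun x => sectorFun_of_ne φ h
    rw [this]
    exact stronglyMeasurable_const

omit [InnerProductSpace ℂ 𝔨] in
theorem memLp_sectorFun {n : ℕ} {φ : (Fin n → ℝ) → 𝔨} (hc : Continuous φ)
    (hs : HasCompactSupport φ) : MemLp (sectorFun n φ) 2 wordMeasure := by
  have hm := stronglyMeasurable_sectorFun hc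
  rw [memLp_two_iff_integrable_sq_norm hm.aestronglyMeasurable]
  have hm2 : StronglyMeasurable fun w => ‖sectorFun n φ w‖ ^ 2 :=
    (hm.norm.measurable.pow_const 2).stronglyMeasurable
  refine ⟨hm2.aestronglyMeasurable, ?_⟩
  rw [HasFiniteIntegral, lintegral_wordMeasure hm2.enorm, tsum_eq_single n]
  · simp only [sectorFun_mkWord]
    refine ENNReal.mul_lt_top (by simp [n.factorial_ne_zero, pos_iff_ne_zero]) ?_
    have hi : Integrable (fun x => ‖φ x‖ ^ 2) :=
      (memLp_two_iff_integrable_sq_norm hc.aestronglyMeasurable).1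
        (hc.memLp_of_hasCompactSupport hs)
    exact hi.2
  · intro m hm
    simp [sectorFun_of_ne φ (w := mkWord m _) hm]

theorem integral_inner_sectorFun {n : ℕ} {φ : (Fin n → ℝ) → 𝔨} (hc : Continuous φ)
    (hs : HasCompactSupport φ) (g : Fock 𝔨) :
    Integrable (fun w => inner ℂ (sectorFun n φ w) (rep g w)) wordMeasure ∧
    ∫ w, inner ℂ (sectorFun n φ w) (rep g w) ∂wordMeasure
      = (n.factorial : ℝ)⁻¹ • ∫ x, inner ℂ (φ x) (rep g (mkWord n x)) := by
  have hi : Integrable (fun w => inner ℂ (sectorFun n φ w) (rep g w)) wordMeasure := by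
    have := L2.integrable_inner (𝕜 := ℂ) ((memLp_sectorFun hc hs).toLp _) (g : Lp 𝔨 2 wordMeasure)
    refine this.congr ?_
    filter_upwards [(memLp_sectorFun hc hs).coeFn_toLp] with w hw
    rw [hw]
    rfl
  refine ⟨hi, ?_⟩
  have hm : StronglyMeasurable fun w => inner ℂ (sectorFun n φ w) (rep g w) :=
    (stronglyMeasurable_sectorFun hc).inner (Lp.stronglyMeasurable _)
  rw [integral_wordMeasure hi hm, tsum_eq_single n]
  · simp only [sectorFun_mkWord]
  · intro m hm
    simp [sectorFun_of_ne φ (w := mkWord m _) hm]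

/-- By symmetry of `g` all `n!` permuted terms have the same integral, which cancels the factor
`1/n!` of the word measure. -/
theorem integral_inner_symSectorFun {n : ℕ} {φ : (Fin n → ℝ) → 𝔨} (hc : Continuous φ)
    (hs : HasCompactSupport φ) (g : Fock 𝔨) :
    ∫ w, inner ℂ (symSectorFun n φ w) (rep g w) ∂wordMeasure
      = ∫ x, inner ℂ (φ x) (rep g (mkWord n x)) := by
  obtain ⟨hi, he⟩ := integral_inner_sectorFun hc hs g
  have key : ∀ σ : Equiv.Perm (Fin n),
      Integrable (fun w => inner ℂ (sectorFun n φ (permWord (Function.update (fun _ => 1) n σ) w))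
        (rep g w)) wordMeasure ∧
      ∫ w, inner ℂ (sectorFun n φ (permWord (Function.update (fun _ => 1) n σ) w)) (rep g w)
        ∂wordMeasure = (n.factorial : ℝ)⁻¹ • ∫ x, inner ℂ (φ x) (rep g (mkWord n x)) := by
    intro σ
    have hp := measurePreserving_permWord (Function.update (fun _ => 1) n σ)
    have hae : (fun w => inner ℂ (sectorFun n φ (permWord (Function.update (fun _ => 1) n σ) w))
        (rep g (permWord (Function.update (fun _ => 1) n σ) w)))
        =ᵐ[wordMeasure] fun w => inner ℂ
          (sectorFun n φ (permWord (Function.update (fun _ => 1) n σ) w)) (rep g w) := by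
      filter_upwards [g.2 (Function.update (fun _ => 1) n σ)] with w hw
      exact congrArg _ hw
    have hm := hi.1
    rw [← hp.map_eq] at hm
    refine ⟨(hp.integrable_comp_of_integrable hi).congr hae, ?_⟩
    rw [← integral_congr_ae hae, ← he]
    conv_rhs => rw [← hp.map_eq]
    rw [integral_map hp.aemeasurable hm]
  simp only [symSectorFun, sum_inner]
  rw [integral_finsetSum _ fun σ _ => (key σ).1, Finset.sum_congr rfl fun σ _ => (key σ).2]
  rw [Finset.sum_const, Finset.card_univ, Fintype.card_perm, Fintype.card_fin,
    ← Nat.cast_smul_eq_nsmul ℝ, smul_smul, mul_inv_cancel₀ (by exact_mod_cast n.factorial_ne_zero),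
    one_smul]

variable [CompleteSpace 𝔨]

/-- Since `g` is symmetric, pairing it with a symmetrized function is the same as pairing its
component on `ℝⁿ` with the function itself. So each component is orthogonal to all `φ v` with `φ`
smooth of compact support and `v` in `𝔨`, and vanishes. -/
theorem eq_zero_of_mem_testFock_orthogonal {g : Fock 𝔨} (hg : g ∈ (testFock 𝔨)ᗮ) : g = 0 := by
  have hm : MeasurableSet {w : Word | rep g w = 0} :=
    (Lp.stronglyMeasurable (g : Lp 𝔨 2 wordMeasure)).measurableSet_eq_fun stronglyMeasurable_const
  refine Fock_ext (Filter.EventuallyEq.trans ?_ (Lp.coeFn_zero 𝔨 2 wordMeasure).symm)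
  refine (ae_wordMeasure_iff hm).2 fun n => ?_
  have hloc := (memLp_rep_mkWord g n).locallyIntegrable (by norm_num)
  refine ae_eq_zero_of_integral_contDiff_smul_eq_zero hloc fun φ hφ hφs => ?_
  refine ext_inner_left ℂ fun v => ?_
  have hi := hloc.integrable_smul_left_of_hasCompactSupport hφ.continuous hφs
  rw [inner_zero_right, ← integral_inner hi]
  have hc : Continuous fun x => (φ x : ℂ) • v := by
    have := hφ.continuous
    fun_prop
  have hs : HasCompactSupport fun x => (φ x : ℂ) • v :=
    HasCompactSupport.smul_right (f := fun x => (φ x : ℂ)) (hφs.comp_left (g := Complex.ofReal)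
      Complex.ofReal_zero)
  obtain ⟨h, hh, hrep⟩ := exists_fock_of_mem_testFunctions (symSectorFun_mem_testFunctions hc hs)
  have h0 : inner ℂ h g = 0 := (Submodule.mem_orthogonal _ _).1 hg h hh
  rw [Submodule.coe_inner, L2.inner_def] at h0
  have h1 := integral_inner_symSectorFun hc hs g
  rw [← integral_congr_ae (f := fun w => inner ℂ (rep h w) (rep g w)) (by
    filter_upwards [hrep] with w hw
    rw [hw])] at h1
  refine Eq.trans (integral_congr_ae (ae_of_all _ fun x => ?_)) (h1.symm.trans h0)
  simp only
  rw [inner_smul_left, Complex.conj_ofReal, ← inner_smul_right, Complex.coe_smul]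

-- The Fock space is the set of common fixed points of the isometries induced by permutations.
omit [CompleteSpace 𝔨] in
theorem isClosed_Fock : IsClosed (Fock 𝔨 : Set (Lp 𝔨 2 wordMeasure)) := by
  have : (Fock 𝔨 : Set (Lp 𝔨 2 wordMeasure)) = ⋂ p, {f | Lp.compMeasurePreservingₗᵢ ℂ (E := 𝔨)
      (p := 2) (permWord p) (measurePreserving_permWord p) f = f} := by
    ext f
    simp only [Set.mem_iInter, Set.mem_ofPred_eq]
    refine forall_congr' fun p => ?_
    have h := Lp.coeFn_compMeasurePreserving f (measurePreserving_permWord p)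
    exact ⟨fun hf => Lp.ext (h.trans hf), fun hf => h.symm.trans
      (Filter.EventuallyEq.of_eq (congrArg (fun g : Lp 𝔨 2 wordMeasure => (g : Word → 𝔨)) hf))⟩
  rw [this]
  exact isClosed_iInter fun p => isClosed_eq (LinearIsometry.continuous _) continuous_id

instance : CompleteSpace (Fock 𝔨) := isClosed_Fock.completeSpace_coe

theorem dense_testFock : Dense (testFock 𝔨 : Set (Fock 𝔨)) := by
  rw [Submodule.dense_iff_topologicalClosure_eq_top, Submodule.topologicalClosure_eq_top_iff,
    Submodule.eq_bot_iff]
  exact fun g hg => eq_zero_of_mem_testFock_orthogonal hg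

theorem denseRange_toFock : DenseRange (toFock 𝔨) :=
  dense_testFock.mono testFock_le_range

end Density

/-! ### Components of fixed length and the norms of `Γ_k`. -/

section Sectors

variable {𝔨 : Type*} [NormedAddCommGroup 𝔨] [InnerProductSpace ℂ 𝔨]

/-- The words of length `n`. -/
def sector (n : ℕ) : Set Word := {w | w.1 = n}

theorem measurableSet_sector (n : ℕ) : MeasurableSet (sector n) :=
  measurable_length (measurableSet_singleton n)

theorem iUnion_sector : ⋃ n, sector n = Set.univ :=
  Set.eq_univ_of_forall fun w => Set.mem_iUnion.2 ⟨w.1, rfl⟩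

theorem pairwise_disjoint_sector : Pairwise (Function.onFun Disjoint sector) := fun m n h =>
  Set.disjoint_left.2 fun w (h1 : w.1 = m) (h2 : w.1 = n) => h (h1.symm.trans h2)

/-- The squared norm of the component of length `n`. -/
def sectorNormSq (n : ℕ) (g : Fock 𝔨) : ℝ := ∫ w in sector n, ‖rep g w‖ ^ 2 ∂wordMeasure

theorem sectorNormSq_nonneg (n : ℕ) (g : Fock 𝔨) : 0 ≤ sectorNormSq n g :=
  integral_nonneg fun _ => sq_nonneg _

theorem norm_sq_Lp {α : Type*} [MeasurableSpace α] {μ : Measure α} (f : Lp 𝔨 2 μ) :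
    ‖f‖ ^ 2 = ∫ w, ‖f w‖ ^ 2 ∂μ := by
  have h : (RCLike.re (inner ℂ f f) : ℝ) = ‖f‖ ^ 2 := inner_self_eq_norm_sq f
  rw [← h, L2.inner_def, ← integral_re (L2.integrable_inner _ _)]
  refine integral_congr_ae (ae_of_all _ fun w => ?_)
  exact inner_self_eq_norm_sq _

/-- It is the squared norm of a bounded restriction operator. The weighted norms themselves are not
continuous on the Fock space in general, but finite combinations of these components are. -/
theorem continuous_sectorNormSq (n : ℕ) : Continuous (sectorNormSq n : Fock 𝔨 → ℝ) := by
  have h : (sectorNormSq n : Fock 𝔨 → ℝ) = fun g : Fock 𝔨 =>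
      ‖LpToLpRestrictCLM Word 𝔨 ℂ wordMeasure 2
      (sector n) (g : Lp 𝔨 2 wordMeasure)‖ ^ 2 := by
    funext g
    rw [norm_sq_Lp, sectorNormSq]
    refine integral_congr_ae ?_
    filter_upwards [LpToLpRestrictCLM_coeFn ℂ (sector n) (g : Lp 𝔨 2 wordMeasure)] with w hw
    rw [hw]
    rfl
  rw [h]
  fun_prop

theorem integrable_norm_sq_rep (g : Fock 𝔨) : Integrable (fun w => ‖rep g w‖ ^ 2) wordMeasure :=
  (memLp_two_iff_integrable_sq_norm (memLp_rep g).1).1 (memLp_rep g)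

theorem setIntegral_sector (k n : ℕ) (g : Fock 𝔨) :
    IntegrableOn (fun w : Word => weight k w.1 * ‖rep g w‖ ^ 2) (sector n) wordMeasure ∧
      ∫ w in sector n, weight k w.1 * ‖rep g w‖ ^ 2 ∂wordMeasure
        = weight k n * sectorNormSq n g := by
  have h : ∀ w ∈ sector n, weight k n * ‖rep g w‖ ^ 2 = weight k w.1 * ‖rep g w‖ ^ 2 :=
    fun w (hw : w.1 = n) => by rw [hw]
  have hi : IntegrableOn (fun w => weight k n * ‖rep g w‖ ^ 2) (sector n) wordMeasure :=
    (integrable_norm_sq_rep g).integrableOn.const_mul _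
  refine ⟨hi.congr_fun h (measurableSet_sector n), ?_⟩
  rw [← setIntegral_congr_fun (measurableSet_sector n) h, integral_const_mul, sectorNormSq]

theorem mem_Gamma_iff {k : ℕ} {g : Fock 𝔨} :
    g ∈ Gamma 𝔨 k ↔ Integrable (fun w : Word => weight k w.1 * ‖rep g w‖ ^ 2) wordMeasure :=
  Iff.rfl

theorem gammaNorm_sq (k : ℕ) (g : Fock 𝔨) :
    gammaNorm k g ^ 2 = ∫ w, weight k w.1 * ‖rep g w‖ ^ 2 ∂wordMeasure :=
  Real.sq_sqrt (integral_nonneg fun _ => mul_nonneg (weight_nonneg k _) (sq_nonneg _))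

theorem hasSum_gammaNorm_sq {k : ℕ} {g : Fock 𝔨} (hg : g ∈ Gamma 𝔨 k) :
    HasSum (fun n => weight k n * sectorNormSq n g) (gammaNorm k g ^ 2) := by
  have h := hasSum_integral_iUnion measurableSet_sector pairwise_disjoint_sector
    (Integrable.integrableOn (mem_Gamma_iff.1 hg))
  simpa only [iUnion_sector, setIntegral_univ, ← gammaNorm_sq, (setIntegral_sector k _ g).2] using h

/-- Membership in `Γ_k` and the bound are tested on finite sums of components, which survive limits
in the Fock norm. -/
theorem mem_Gamma_of_sum_le {k : ℕ} {g : Fock 𝔨} {B : ℝ}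
    (h : ∀ N, ∑ n ∈ Finset.range N, weight k n * sectorNormSq n g ≤ B) :
    g ∈ Gamma 𝔨 k ∧ gammaNorm k g ^ 2 ≤ B := by
  have h0 : ∀ n, 0 ≤ weight k n * sectorNormSq n g := fun n =>
    mul_nonneg (weight_nonneg k n) (sectorNormSq_nonneg n g)
  have hg : g ∈ Gamma 𝔨 k := by
    rw [mem_Gamma_iff, ← integrableOn_univ, ← iUnion_sector]
    refine integrableOn_iUnion_of_summable_integral_norm (fun n => (setIntegral_sector k n g).1) ?_
    have : (fun n => ∫ w in sector n, ‖weight k w.1 * ‖rep g w‖ ^ 2‖ ∂wordMeasure)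
        = fun n => weight k n * sectorNormSq n g := by
      funext n
      rw [← (setIntegral_sector k n g).2]
      refine integral_congr_ae (ae_of_all _ fun w => ?_)
      exact Real.norm_of_nonneg (mul_nonneg (weight_nonneg k _) (sq_nonneg _))
    rw [this]
    exact summable_of_sum_range_le h0 h
  exact ⟨hg, (hasSum_gammaNorm_sq hg).tsum_eq ▸ Real.tsum_le_of_sum_range_le h0 h⟩

theorem toFock_mem_Gamma (k : ℕ) (f : tame 𝔨) : toFock 𝔨 f ∈ Gamma 𝔨 k := by
  obtain ⟨C, q, R, hf⟩ := f.2
  refine mem_Gamma_iff.2 ((hf.integrable_weight_mul_norm_sq (abs_weight_le k)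
    (by positivity)).congr ?_)
  filter_upwards [rep_toFock f] with w hw
  rw [hw]

theorem gammaNorm_toFock (k : ℕ) (f : tame 𝔨) :
    gammaNorm k (toFock 𝔨 f) ^ 2 = wnorm (weight k) (f : Multiset ℝ → 𝔨) := by
  rw [gammaNorm_sq, wnorm]
  refine integral_congr_ae ?_
  filter_upwards [rep_toFock f] with w hw
  rw [hw]

/-! ### Truncation -/

/-- The words of length at most `m`. -/
def shortWords (m : ℕ) : Set Word := {w | w.1 ≤ m}

theorem measurableSet_shortWords (m : ℕ) : MeasurableSet (shortWords m) :=
  measurable_length measurableSet_Iic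

/-- The components of length at most `m`. -/
def truncate (m : ℕ) (g : Fock 𝔨) : Fock 𝔨 :=
  ⟨((memLp_rep g).indicator (measurableSet_shortWords m)).toLp _, fun p => by
    have h := ((memLp_rep g).indicator (measurableSet_shortWords m)).coeFn_toLp
    have h' := (measurePreserving_permWord p).quasiMeasurePreserving.ae_eq_comp h
    refine h'.trans (Filter.EventuallyEq.trans ?_ h.symm)
    filter_upwards [g.2 p] with w hw
    have hw' : rep g (permWord p w) = rep g w := hw
    have hiff : permWord p w ∈ shortWords m ↔ w ∈ shortWords m := Iff.rfl
    rw [Function.comp_apply]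
    by_cases h2 : w ∈ shortWords m
    · rw [Set.indicator_of_mem h2, Set.indicator_of_mem (hiff.2 h2), hw']
    · rw [Set.indicator_of_notMem h2, Set.indicator_of_notMem (mt hiff.1 h2)]⟩

theorem rep_truncate (m : ℕ) (g : Fock 𝔨) :
    rep (truncate m g) =ᵐ[wordMeasure] (shortWords m).indicator (rep g) :=
  ((memLp_rep g).indicator (measurableSet_shortWords m)).coeFn_toLp

theorem rep_sub (f g : Fock 𝔨) : rep (f - g) =ᵐ[wordMeasure] rep f - rep g :=
  Lp.coeFn_sub (f : Lp 𝔨 2 wordMeasure) g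

theorem norm_le_of_rep {f g : Fock 𝔨} (h : ∀ᵐ w ∂wordMeasure, ‖rep f w‖ ≤ ‖rep g w‖) :
    ‖f‖ ≤ ‖g‖ := Lp.norm_le_norm_of_ae_le h

theorem continuous_truncate (m : ℕ) : Continuous (truncate m : Fock 𝔨 → Fock 𝔨) := by
  refine (LipschitzWith.of_dist_le' (K := 1) fun f g => ?_).continuous
  rw [one_mul, dist_eq_norm, dist_eq_norm]
  refine norm_le_of_rep ?_
  filter_upwards [rep_sub (truncate m f) (truncate m g), rep_sub f g, rep_truncate m f,
    rep_truncate m g] with w h1 h2 h3 h4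
  rw [h1, h2, Pi.sub_apply, Pi.sub_apply, h3, h4]
  by_cases hw : w ∈ shortWords m <;> simp [hw]

theorem sectorNormSq_truncate (m n : ℕ) (g : Fock 𝔨) :
    sectorNormSq n (truncate m g) = if n ≤ m then sectorNormSq n g else 0 := by
  have h : ∀ᵐ w ∂wordMeasure.restrict (sector n), ‖rep (truncate m g) w‖ ^ 2
      = if n ≤ m then ‖rep g w‖ ^ 2 else 0 := by
    filter_upwards [ae_restrict_of_ae (rep_truncate m g), ae_restrict_mem (measurableSet_sector n)]
      with w hw hn
    have hiff : w ∈ shortWords m ↔ n ≤ m := by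
      rw [← show w.1 = n from hn]
      exact Iff.rfl
    rw [hw]
    by_cases h2 : n ≤ m
    · rw [Set.indicator_of_mem (hiff.2 h2), if_pos h2]
    · rw [Set.indicator_of_notMem (mt hiff.1 h2), if_neg h2, norm_zero, zero_pow two_ne_zero]
  rw [sectorNormSq, integral_congr_ae h, sectorNormSq]
  split_ifs <;> simp

theorem tendsto_truncate (g : Fock 𝔨) :
    Filter.Tendsto (fun m => truncate m g) Filter.atTop (nhds g) := by
  rw [tendsto_iff_norm_sub_tendsto_zero]
  have h : Filter.Tendsto (fun m => ‖truncate m g - g‖ ^ 2) Filter.atTop (nhds 0) := by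
    have he : ∀ m, ‖truncate m g - g‖ ^ 2
        = ∫ w, (shortWords m)ᶜ.indicator (fun w => ‖rep g w‖ ^ 2) w ∂wordMeasure := fun m => by
      rw [norm_sq_Fock]
      refine integral_congr_ae ?_
      filter_upwards [rep_sub (truncate m g) g, rep_truncate m g] with w h1 h2
      rw [h1, Pi.sub_apply, h2]
      by_cases hw : w ∈ shortWords m <;> simp [hw]
    simp only [he]
    rw [← integral_zero Word ℝ (μ := wordMeasure)]
    refine tendsto_integral_of_dominated_convergence (fun w => ‖rep g w‖ ^ 2) (fun m =>
      ((integrable_norm_sq_rep g).indicator (measurableSet_shortWords m).compl).1)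
      (integrable_norm_sq_rep g) (fun m => ae_of_all _ fun w => ?_) (ae_of_all _ fun w => ?_)
    · refine (norm_indicator_le_norm_self _ _).trans_eq ?_
      rw [norm_pow, norm_norm]
    · refine tendsto_const_nhds.congr' ?_
      filter_upwards [Filter.eventually_ge_atTop w.1] with m hm
      rw [Set.indicator_of_notMem]
      exact fun h' => h' hm
  have h2 := (Real.continuous_sqrt.tendsto 0).comp h
  simpa [Function.comp_def] using h2

/-- The components of length at most `m` of a function of sets of letters. -/
def tameTruncate (m : ℕ) (f : tame 𝔨) : tame 𝔨 :=
  ⟨fun M => if M.card ≤ m then (f : Multiset ℝ → 𝔨) M else 0, by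
    obtain ⟨C, q, R, hf⟩ := f.2
    refine ⟨C, q, R, ?_, hf.nonneg, fun M => ?_⟩
    · simp only [card_letters]
      exact StronglyMeasurable.ite (measurableSet_shortWords m) hf.meas stronglyMeasurable_const
    · refine le_trans ?_ (hf.bound M)
      split_ifs <;> simp⟩

theorem toFock_tameTruncate (m : ℕ) (f : tame 𝔨) :
    toFock 𝔨 (tameTruncate m f) = truncate m (toFock 𝔨 f) := by
  refine Fock_ext ((rep_toFock _).trans (Filter.EventuallyEq.trans ?_ (rep_truncate m _).symm))
  filter_upwards [rep_toFock f] with w hw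
  by_cases h2 : w.1 ≤ m
  · rw [Set.indicator_of_mem (show w ∈ shortWords m from h2), hw]
    simp only [tameTruncate, card_letters, if_pos h2]
  · rw [Set.indicator_of_notMem (show w ∉ shortWords m from h2)]
    simp only [tameTruncate, card_letters, if_neg h2]

variable [CompleteSpace 𝔨]

/-- A bound for the weighted norms on the tame functions extends to `Γ_k`. -/
theorem gammaNorm_map_le {V : Fock 𝔨 →ₗᵢ[ℂ] Fock 𝔨} {k : ℕ} {P : ℝ} (hP : 0 ≤ P)
    (hV : ∀ f : tame 𝔨, ∃ f' : tame 𝔨, V (toFock 𝔨 f) = toFock 𝔨 f' ∧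
      wnorm (weight k) (f' : Multiset ℝ → 𝔨) ≤ P * wnorm (weight k) (f : Multiset ℝ → 𝔨))
    {g : Fock 𝔨} (hg : g ∈ Gamma 𝔨 k) :
    V g ∈ Gamma 𝔨 k ∧ gammaNorm k (V g) ^ 2 ≤ P * gammaNorm k g ^ 2 := by
  have h0 : ∀ n (x : Fock 𝔨), 0 ≤ weight k n * sectorNormSq n x := fun n x =>
    mul_nonneg (weight_nonneg k n) (sectorNormSq_nonneg n x)
  have hcont : ∀ n, Continuous (sectorNormSq n : Fock 𝔨 → ℝ) := continuous_sectorNormSq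
  -- Both sides are finite sums of continuous functions of `x`, so the inequality need only be
  -- checked on the dense set of tame functions. There it follows from the hypothesis for the
  -- truncated function, whose weighted norm is the sum on the right.
  have h1 : ∀ (N m : ℕ) (x : Fock 𝔨),
      ∑ n ∈ Finset.range N, weight k n * sectorNormSq n (V (truncate m x))
        ≤ P * ∑ n ∈ Finset.range (m + 1), weight k n * sectorNormSq n x := by
    intro N m x
    have hVc := V.continuous
    have htc := continuous_truncate (𝔨 := 𝔨) m
    refine denseRange_toFock.induction_on (p := fun x =>
      ∑ n ∈ Finset.range N, weight k n * sectorNormSq n (V (truncate m x))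
        ≤ P * ∑ n ∈ Finset.range (m + 1), weight k n * sectorNormSq n x) x
      (isClosed_le (by fun_prop) (by fun_prop)) fun f => ?_
    obtain ⟨f', hf', hle⟩ := hV (tameTruncate m f)
    rw [← gammaNorm_toFock, ← gammaNorm_toFock, toFock_tameTruncate] at hle
    rw [← toFock_tameTruncate, hf']
    refine (sum_le_hasSum _ (fun n _ => h0 n _)
      (hasSum_gammaNorm_sq (toFock_mem_Gamma k f'))).trans (hle.trans_eq ?_)
    rw [← (hasSum_gammaNorm_sq (toFock_tameTruncate m f ▸ toFock_mem_Gamma k _)).tsum_eq,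
      tsum_eq_sum (s := Finset.range (m + 1))]
    · refine congrArg _ (Finset.sum_congr rfl fun n hn => ?_)
      rw [sectorNormSq_truncate, if_pos (Nat.lt_succ_iff.1 (Finset.mem_range.1 hn))]
    · intro n hn
      rw [sectorNormSq_truncate, if_neg, mul_zero]
      rwa [Finset.mem_range, Nat.lt_succ_iff] at hn
  refine mem_Gamma_of_sum_le fun N => ?_
  -- For a fixed number `N` of components the truncation is removed; the right side of `h1` is
  -- bounded by the full norm of `g` uniformly in `m`.
  have h2 : Filter.Tendsto (fun m => ∑ n ∈ Finset.range N,
      weight k n * sectorNormSq n (V (truncate m g))) Filter.atTop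
      (nhds (∑ n ∈ Finset.range N, weight k n * sectorNormSq n (V g))) := by
    have hc : Continuous fun x : Fock 𝔨 =>
        ∑ n ∈ Finset.range N, weight k n * sectorNormSq n (V x) := by
      have hVc := V.continuous
      fun_prop
    exact (hc.tendsto g).comp (tendsto_truncate g)
  refine le_of_tendsto h2 (Filter.Eventually.of_forall fun m => (h1 N m g).trans ?_)
  exact mul_le_mul_of_nonneg_left (sum_le_hasSum _ (fun n _ => h0 n _) (hasSum_gammaNorm_sq hg)) hP

-- The shift preserves both the measure and the length of words.
omit [CompleteSpace 𝔨] in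
theorem timeShift_mem_Gamma_and_gammaNorm_eq {k : ℕ} {g : Fock 𝔨} (hg : g ∈ Gamma 𝔨 k) (r : ℝ) :
    timeShift 𝔨 r g ∈ Gamma 𝔨 k ∧ gammaNorm k (timeShift 𝔨 r g) ^ 2 = gammaNorm k g ^ 2 := by
  have hs := measurePreserving_shiftWord r
  have h : rep (timeShift 𝔨 r g) =ᵐ[wordMeasure] fun w => rep g (shiftWord r w) :=
    Lp.coeFn_compMeasurePreserving (g : Lp 𝔨 2 wordMeasure) hs
  have he : (fun w : Word => weight k w.1 * ‖rep (timeShift 𝔨 r g) w‖ ^ 2) =ᵐ[wordMeasure]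
      fun w => weight k (shiftWord r w).1 * ‖rep g (shiftWord r w)‖ ^ 2 := by
    filter_upwards [h] with w hw
    rw [hw]
    rfl
  have hi := mem_Gamma_iff.1 hg
  refine ⟨mem_Gamma_iff.2 ((hs.integrable_comp_of_integrable hi).congr he.symm), ?_⟩
  have hm := hi.1
  rw [← hs.map_eq] at hm
  rw [gammaNorm_sq, gammaNorm_sq, integral_congr_ae he]
  conv_rhs => rw [← hs.map_eq]
  rw [integral_map hs.aemeasurable hm]

end Sectors

/-! ### Existence, uniqueness and growth bounds of the unitary family. -/

namespace Coeff

variable {𝔨 : Type*} [NormedAddCommGroup 𝔨] [InnerProductSpace ℂ 𝔨] [CompleteSpace 𝔨]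
  {a : Coeff 𝔨}

/-- The unitary family belongs to the evolution of the tame functions. -/
structure Extends (a : Coeff 𝔨) (U : ℝ → ℝ → (Fock 𝔨 ≃ₗᵢ[ℂ] Fock 𝔨)) : Prop where
  of_le : ∀ {s t : ℝ} (hst : s ≤ t) (f : tame 𝔨), U t s (toFock 𝔨 f) = toFock 𝔨 (a.evolution hst f)
  symm_of_le : ∀ {s t : ℝ} (hst : s ≤ t) (f : tame 𝔨),
    (U t s).symm (toFock 𝔨 f) = toFock 𝔨 (a.evolutionAdjoint hst f)
  of_lt : ∀ {s t : ℝ}, t < s → U t s = (U s t).symm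

theorem IsUnitary.exists_extends (ha : a.IsUnitary) : ∃ U, a.Extends U := by
  have h : ∀ t s : ℝ, ∃ V : Fock 𝔨 ≃ₗᵢ[ℂ] Fock 𝔨, ∀ hst : s ≤ t,
      (∀ f, V (toFock 𝔨 f) = toFock 𝔨 (a.evolution hst f)) ∧
        ∀ f, V.symm (toFock 𝔨 f) = toFock 𝔨 (a.evolutionAdjoint hst f) := fun t s => by
    by_cases hst : s ≤ t
    · obtain ⟨V, h1, h2⟩ := exists_unitary_extension (ι := toFock 𝔨) (T := a.evolution hst)
        (T' := a.evolutionAdjoint hst) denseRange_toFock (norm_toFock_evolution ha hst)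
        (norm_toFock_evolutionAdjoint ha hst) (inner_toFock_evolution hst)
      exact ⟨V, fun _ => ⟨h1, h2⟩⟩
    -- A dummy value for `t < s`, which the family defined below never uses.
    · exact ⟨LinearIsometryEquiv.refl ℂ _, fun h => absurd h hst⟩
  choose V hV using h
  refine ⟨fun t s => if s ≤ t then V t s else (V s t).symm, ?_, ?_, ?_⟩
  · intro s t hst f
    rw [if_pos hst]
    exact (hV t s hst).1 f
  · intro s t hst f
    rw [if_pos hst]
    exact (hV t s hst).2 f
  · intro s t h
    rw [if_neg (not_le.2 h), if_pos h.le]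

omit [CompleteSpace 𝔨] in
theorem kernelOp_eq_of_letters {f : Word → 𝔨} {h : Multiset ℝ → 𝔨}
    (hf : ∀ w, h (letters w) = f w) (t s : ℝ) :
    kernelOp (kernel a.create a.number a.annih a.drift t s) f
      = fun ω => a.evolve t s h (letters ω) := by
  obtain rfl : (fun w => h (letters w)) = f := funext hf
  exact funext fun ω => a.kernelOp_eq_evolve t s h ω

theorem Extends.isUnitarySolution {U : ℝ → ℝ → (Fock 𝔨 ≃ₗᵢ[ℂ] Fock 𝔨)} (hU : a.Extends U) :
    IsUnitarySolution a.create a.number a.annih a.drift U := by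
  refine ⟨fun s t hst f hf g hg => ?_, fun s t h => hU.of_lt h⟩
  obtain ⟨h, hh⟩ := exists_tame_of_mem_testFunctions hf
  obtain rfl : toFock 𝔨 h = g := toFock_eq_iff.2 (hg.trans (ae_of_all _ fun w => (hh w).symm))
  rw [hU.of_le hst, kernelOp_eq_of_letters hh]
  exact rep_toFock _

omit [CompleteSpace 𝔨] in
theorem ext_of_testFock {V V' : Fock 𝔨 ≃ₗᵢ[ℂ] Fock 𝔨} (hd : Dense (testFock 𝔨 : Set (Fock 𝔨)))
    (h : ∀ g ∈ testFock 𝔨, V g = V' g) : V = V' :=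
  LinearIsometryEquiv.ext fun x => congrFun (Continuous.ext_on hd V.continuous V'.continuous h) x

/-- For `s ≤ t` two solutions agree on the classes of test functions, which are dense; for `t < s`
both are inverses of the same operators. -/
theorem isUnitarySolution_unique {U U' : ℝ → ℝ → (Fock 𝔨 ≃ₗᵢ[ℂ] Fock 𝔨)}
    (hU : IsUnitarySolution a.create a.number a.annih a.drift U)
    (hU' : IsUnitarySolution a.create a.number a.annih a.drift U') : U = U' := by
  have h : ∀ {s t : ℝ}, s ≤ t → U t s = U' t s := fun {s t} hst =>
    ext_of_testFock dense_testFock fun g ⟨f, hf, hg⟩ =>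
      Fock_ext ((hU.1 s t hst f hf g hg).trans (hU'.1 s t hst f hf g hg).symm)
  funext t s
  rcases le_or_gt s t with hst | hst
  · exact h hst
  · rw [hU.2 s t hst, hU'.2 s t hst, h hst.le]

/-- Forward times use the evolution, backward times its adjoint, whose creation coefficient is that
of `a.dual`; the maximum of the two norms gives one polynomial for both. -/
theorem Extends.gammaNorm_le {U : ℝ → ℝ → (Fock 𝔨 ≃ₗᵢ[ℂ] Fock 𝔨)} (hU : a.Extends U)
    (ha : a.IsUnitary) (k : ℕ) (s t : ℝ) {g : Fock 𝔨} (hg : g ∈ Gamma 𝔨 k) :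
    U t s g ∈ Gamma 𝔨 k ∧ gammaNorm k (U t s g) ^ 2
      ≤ (growth (max ‖a.create‖ ‖a.dual.create‖) k).eval |t - s| * gammaNorm k g ^ 2 := by
  refine gammaNorm_map_le (V := (U t s).toLinearIsometry)
    (eval_growth_nonneg _ k (abs_nonneg _)) (fun f => ?_) hg
  rcases le_or_gt s t with hst | hst
  · rw [abs_of_nonneg (sub_nonneg.2 hst)]
    exact ⟨_, hU.of_le hst f, wnorm_evolution_le ha hst (le_max_left _ _) k f⟩
  · rw [abs_of_neg (sub_neg.2 hst), neg_sub, hU.of_lt hst]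
    exact ⟨_, hU.symm_of_le hst.le f,
      wnorm_evolutionAdjoint_le ha hst.le (le_max_right _ _) k f⟩

end Coeff

end WhiteNoise

end

theorem theorem4p6p1 {𝔨 : Type*} [NormedAddCommGroup 𝔨] [InnerProductSpace ℂ 𝔨]
    [CompleteSpace 𝔨] [TopologicalSpace.SeparableSpace 𝔨] (A₁ A₀ Am B : 𝔨 →L[ℂ] 𝔨)
    (hA : WhiteNoise.UnitarityConditions A₁ A₀ Am B) :
    (∃! U : ℝ → ℝ → (WhiteNoise.Fock 𝔨 ≃ₗᵢ[ℂ] WhiteNoise.Fock 𝔨),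
      WhiteNoise.IsUnitarySolution A₁ A₀ Am B U) ∧
    ∀ U : ℝ → ℝ → (WhiteNoise.Fock 𝔨 ≃ₗᵢ[ℂ] WhiteNoise.Fock 𝔨),
      WhiteNoise.IsUnitarySolution A₁ A₀ Am B U →
      ∀ k : ℕ, ∃ P : Polynomial ℝ, P.natDegree ≤ k ∧
        (∀ s t : ℝ, ∀ g ∈ WhiteNoise.Gamma 𝔨 k,
          U t s g ∈ WhiteNoise.Gamma 𝔨 k ∧
          WhiteNoise.gammaNorm k (U t s g) ^ 2
            ≤ P.eval |t - s| * WhiteNoise.gammaNorm k g ^ 2) ∧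
        (∀ t : ℝ, ∀ g ∈ WhiteNoise.Gamma 𝔨 k,
          WhiteNoise.groupW U t g ∈ WhiteNoise.Gamma 𝔨 k ∧
          WhiteNoise.gammaNorm k (WhiteNoise.groupW U t g) ^ 2
            ≤ P.eval |t| * WhiteNoise.gammaNorm k g ^ 2) := by
  set a : WhiteNoise.Coeff 𝔨 := ⟨A₁, A₀, Am, B⟩
  have ha : a.IsUnitary := hA
  obtain ⟨U₀, hU₀⟩ := ha.exists_extends
  refine ⟨⟨U₀, hU₀.isUnitarySolution, fun U hU =>
    WhiteNoise.Coeff.isUnitarySolution_unique (a := a) hU hU₀.isUnitarySolution⟩, ?_⟩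
  intro U hU k
  -- The bounds are known for the constructed family; uniqueness transfers them to an arbitrary
  -- solution.
  obtain rfl : U = U₀ :=
    WhiteNoise.Coeff.isUnitarySolution_unique (a := a) hU hU₀.isUnitarySolution
  refine ⟨WhiteNoise.growth (max ‖a.create‖ ‖a.dual.create‖) k,
    WhiteNoise.natDegree_growth_le _ k, fun s t g hg => hU₀.gammaNorm_le ha k s t hg,
    fun t g hg => ?_⟩
  obtain ⟨h1, h2⟩ := hU₀.gammaNorm_le ha k 0 t hg
  obtain ⟨h3, h4⟩ := WhiteNoise.timeShift_mem_Gamma_and_gammaNorm_eq h1 t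
  rw [sub_zero] at h2
  exact ⟨h3, h4.trans_le h2⟩
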